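/- Let $\mathbb{F}_q$ be a finite field. For $n\ge 0$ let $G_n=\mathrm{GL}_n(\mathbb{F}_q)$, $\mathfrak{g}_n=\mathfrak{gl}_n(\mathbb{F}_q)$ (so $\mathfrak{g}_0=0$), and let $C(\mathfrak{g}_n)$ be the complex vector space of functions $f:\mathfrak{g}_n\to\mathbb{C}$ invariant under the adjoint action of $G_n$. Let $P$ be the group of rational points of a parabolic subgroup of $\mathrm{GL}_n$ defined over $\mathbb{F}_q$ (the stabiliser in $G_n$ of a flag of subspaces of $\mathbb{F}_q^n$), let $U$ be its unipotent radical and $L$ a Levi component defined over $\mathbb{F}_q$, with Lie algebras $\mathfrak{p},\mathfrak{u},\mathfrak{l}$ over $\mathbb{F}_q$ and projection $\pi:\mathfrak{p}=\mathfrak{l}\oplus\mathfrak{u}\to\mathfrak{l}$, and let $C(\mathfrak{l})$ be the space of $L$-invariant functions $\mathfrak{l}\to\mathbb{C}$. Harish-Chandra restriction ${}^*R_L:C(\mathfrak{g}_n)\to C(\mathfrak{l})$ and induction $R_L:C(\mathfrak{l})\to C(\mathfrak{g}_n)$ (taken with respect to $P$) are $${}^*R_L(f)(x)=\frac1{|U|}\sum_{y\in\mathfrak{u}}f(x+y),\qquad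 R_L(f)(x)=\frac1{|P|}\sum_{\substack{g\in G_n\\ gxg^{-1}\in\mathfrak{p}}}f(\pi(gxg^{-1})).$$ Call $f\in C(\mathfrak{g}_n)$ pre-cuspidal if ${}^*R_L(f)=0$ for every Levi component $L$ (over $\mathbb{F}_q$) of every proper parabolic subgroup (over $\mathbb{F}_q$). For $n_1+n_2=n$ let $R_{n_1,n_2}^{n}$ be the induction for the block upper triangular parabolic subgroup with block sizes $n_1,n_2$ and its block-diagonal Levi component, and for $f_i\in C(\mathfrak{g}_{n_i})$ let $(f_1\boxtimes f_2)(x_1,x_2)=f_1(x_1)f_2(x_2)$ on $\mathfrak{g}_{n_1}\times\mathfrak{g}_{n_2}$, viewed as the block-diagonal matrices in $\mathfrak{g}_n$. Fix a Borel subgroup $B$ of $\mathrm{GL}_n$ defined over $\mathbb{F}_q$ and, for every parabolic subgroup $P\supseteq B$, a Levi component $L_P$ of $P$ defined over $\mathbb{F}_q$, and put $$\mathcal{D}_n=\sum_{P\supseteq B}(-1)^{r(P)}\,R_{L_P}\circ{}^*R_{L_P},$$ where $r(P)$ is the semisimple $\mathbb{F}_q$-rank of $P$ (that is, $n$ minus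 the number of diagonal blocks of $L_P$). **Proposition.** There is exactly one family $\{\mathbb{D}_n\}_{n\ge0}$ of linear endomorphisms $\mathbb{D}_n$ of $C(\mathfrak{g}_n)$ such that (i) $\mathbb{D}_0=\mathrm{id}$, and $\mathbb{D}_{n_1+n_2}\big(R_{n_1,n_2}^{n_1+n_2}(f_1\boxtimes f_2)\big)=R_{n_1,n_2}^{n_1+n_2}\big(\mathbb{D}_{n_1}(f_1)\boxtimes\mathbb{D}_{n_2}(f_2)\big)$ for all $n_1,n_2\ge1$ and all $f_i\in C(\mathfrak{g}_{n_i})$; (ii) $\mathbb{D}_n(f)=(-1)^{n-1}f$ for every $n\ge1$ and every pre-cuspidal $f\in C(\mathfrak{g}_n)$. Moreover, for this family, $\mathbb{D}_n=\mathcal{D}_n$ for every $n\ge0$, whatever the choice of $B$ and of the Levi components $L_P$. -/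

import Mathlib

open Matrix

namespace GLDuality

noncomputable section

variable {k : Type*} [Field k] {n : ℕ}

/-- A parabolic subgroup of `GL_n` defined over the field `k` together with a Levi component of it
defined over `k`. The columns of `frame` form a basis of `k ^ n`, and `label` groups the basis
vectors into blocks: if `V a` is the span of the basis vectors with label `a`, then
`k ^ n = ⨁ a, V a`, the parabolic subgroup is the stabiliser of the flag
`⨁ a ≤ m, V a` (`m = 0, 1, 2, …`), and the Levi component is the stabiliser of every `V a`.
All pairs (parabolic subgroup, Levi component) over `k` are of this form. -/
structure ParabolicLevi (k : Type*) [Field k] (n : ℕ) where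
  /-- The block in which a basis vector lies. -/
  label : Fin n → ℕ
  /-- The basis. -/
  frame : GL (Fin n) k

/-- Matrices that are block diagonal for the blocks given by `b`. -/
def blockDiagonalAlg (k : Type*) [Field k] {n : ℕ} (b : Fin n → ℕ) :
    Subalgebra k (Matrix (Fin n) (Fin n) k) where
  carrier := {x | ∀ i j, b i ≠ b j → x i j = 0}
  mul_mem' := by
    intro x y hx hy i j hij
    rw [Matrix.mul_apply]
    refine Finset.sum_eq_zero fun l _ => ?_
    by_cases h : b i = b l
    · rw [hy l j (fun h' => hij (h.trans h')), mul_zero]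
    · rw [hx i l h, zero_mul]
  add_mem' := by
    intro x y hx hy i j hij
    rw [Matrix.add_apply, hx i j hij, hy i j hij, add_zero]
  algebraMap_mem' := by
    intro r i j hij
    have h : i ≠ j := fun h => hij (by rw [h])
    simp [Matrix.algebraMap_matrix_apply, h]

/-- Block upper triangular matrices for the blocks given by `b`. -/
def blockTriangularAlg (k : Type*) [Field k] {n : ℕ} (b : Fin n → ℕ) :
    Subalgebra k (Matrix (Fin n) (Fin n) k) where
  carrier := {x | x.BlockTriangular b}
  mul_mem' := fun hx hy => BlockTriangular.mul hx hy
  add_mem' := fun hx hy => BlockTriangular.add hx hy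
  algebraMap_mem' := by
    intro r i j hij
    have h : i ≠ j := fun h => by simp [h] at hij
    simp [Matrix.algebraMap_matrix_apply, h]

/-- Strictly block upper triangular matrices for the blocks given by `b`. -/
def strictBlockTriangular (k : Type*) [Field k] {n : ℕ} (b : Fin n → ℕ) :
    Submodule k (Matrix (Fin n) (Fin n) k) where
  carrier := {x | ∀ i j, b j ≤ b i → x i j = 0}
  add_mem' := by
    intro x y hx hy i j hij
    rw [Matrix.add_apply, hx i j hij, hy i j hij, add_zero]
  zero_mem' := fun _ _ _ => rfl
  smul_mem' := by
    intro r x hx i j hij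
    rw [Matrix.smul_apply, hx i j hij, smul_zero]

/-- The block diagonal part of a matrix. -/
def blockDiagonalPart (k : Type*) [Field k] {n : ℕ} (b : Fin n → ℕ) :
    Matrix (Fin n) (Fin n) k →ₗ[k] Matrix (Fin n) (Fin n) k where
  toFun x := Matrix.of fun i j => if b i = b j then x i j else 0
  map_add' := by
    intro x y
    ext i j
    by_cases h : b i = b j <;> simp [h]
  map_smul' := by
    intro r x
    ext i j
    by_cases h : b i = b j <;> simp [h]

namespace ParabolicLevi

variable (d : ParabolicLevi k n)

/-- The matrix, in the basis `d.frame`, of the endomorphism `x` of `k ^ n`. -/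
def coords : Matrix (Fin n) (Fin n) k ≃ₐ[k] Matrix (Fin n) (Fin n) k where
  toFun x := (↑d.frame⁻¹ : Matrix (Fin n) (Fin n) k) * x * (↑d.frame : Matrix (Fin n) (Fin n) k)
  invFun x := (↑d.frame : Matrix (Fin n) (Fin n) k) * x * (↑d.frame⁻¹ : Matrix (Fin n) (Fin n) k)
  left_inv x := by
    simp only [mul_assoc, Units.mul_inv, mul_one]
    rw [← mul_assoc, Units.mul_inv, one_mul]
  right_inv x := by
    simp only [mul_assoc, Units.inv_mul, mul_one]
    rw [← mul_assoc, Units.inv_mul, one_mul]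
  map_mul' x y := by
    simp only [mul_assoc]
    rw [← mul_assoc (↑d.frame : Matrix (Fin n) (Fin n) k) (↑d.frame⁻¹), Units.mul_inv, one_mul]
  map_add' x y := by rw [mul_add, add_mul]
  commutes' r := by
    rw [← Algebra.commutes, mul_assoc, Units.inv_mul, mul_one]

/-- The Lie algebra of the parabolic subgroup. -/
def parLie : Subalgebra k (Matrix (Fin n) (Fin n) k) :=
  (blockTriangularAlg k d.label).comap d.coords.toAlgHom

/-- The Lie algebra of the Levi component. -/
def leviLie : Subalgebra k (Matrix (Fin n) (Fin n) k) :=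
  (blockDiagonalAlg k d.label).comap d.coords.toAlgHom

/-- The Lie algebra of the unipotent radical of the parabolic subgroup. -/
def nilLie : Submodule k (Matrix (Fin n) (Fin n) k) :=
  (strictBlockTriangular k d.label).comap d.coords.toLinearMap

/-- The rational points of the parabolic subgroup. -/
def par : Subgroup (GL (Fin n) k) := d.parLie.toSubmonoid.units

/-- The rational points of the Levi component. -/
def levi : Subgroup (GL (Fin n) k) := d.leviLie.toSubmonoid.units

theorem mem_parLie {x : Matrix (Fin n) (Fin n) k} :
    x ∈ d.parLie ↔ ∀ i j, d.label j < d.label i → d.coords x i j = 0 := by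
  constructor
  · intro h i j hij
    exact h hij
  · intro h i j hij
    exact h i j hij

theorem mem_leviLie {x : Matrix (Fin n) (Fin n) k} :
    x ∈ d.leviLie ↔ ∀ i j, d.label i ≠ d.label j → d.coords x i j = 0 := Iff.rfl

theorem mem_nilLie {x : Matrix (Fin n) (Fin n) k} :
    x ∈ d.nilLie ↔ ∀ i j, d.label j ≤ d.label i → d.coords x i j = 0 := Iff.rfl

theorem leviLie_le_parLie : d.leviLie ≤ d.parLie := by
  intro x hx
  rw [mem_parLie]
  intro i j hij
  exact hx i j hij.ne'

theorem mul_mem_nilLie {x y : Matrix (Fin n) (Fin n) k} (hx : x ∈ d.parLie) (hy : y ∈ d.nilLie) :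
    x * y ∈ d.nilLie := by
  rw [mem_parLie] at hx
  rw [mem_nilLie] at hy ⊢
  intro i j hij
  rw [map_mul, Matrix.mul_apply]
  refine Finset.sum_eq_zero fun l _ => ?_
  rcases lt_or_ge (d.label l) (d.label i) with h | h
  · rw [hx i l h, zero_mul]
  · rw [hy l j (hij.trans h), mul_zero]

theorem mem_nilLie_mul {x y : Matrix (Fin n) (Fin n) k} (hx : x ∈ d.nilLie) (hy : y ∈ d.parLie) :
    x * y ∈ d.nilLie := by
  rw [mem_parLie] at hy
  rw [mem_nilLie] at hx ⊢
  intro i j hij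
  rw [map_mul, Matrix.mul_apply]
  refine Finset.sum_eq_zero fun l _ => ?_
  rcases le_or_gt (d.label l) (d.label i) with h | h
  · rw [hx i l h, zero_mul]
  · rw [hy l j (hij.trans_lt h), mul_zero]

theorem mem_par {g : GL (Fin n) k} :
    g ∈ d.par ↔ (g : Matrix (Fin n) (Fin n) k) ∈ d.parLie ∧
      ((g⁻¹ : GL (Fin n) k) : Matrix (Fin n) (Fin n) k) ∈ d.parLie := Iff.rfl

theorem mem_levi {g : GL (Fin n) k} :
    g ∈ d.levi ↔ (g : Matrix (Fin n) (Fin n) k) ∈ d.leviLie ∧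
      ((g⁻¹ : GL (Fin n) k) : Matrix (Fin n) (Fin n) k) ∈ d.leviLie := Iff.rfl

/-- The rational points of the unipotent radical of the parabolic subgroup. -/
def unip : Subgroup (GL (Fin n) k) where
  carrier := {g | g ∈ d.par ∧ (g : Matrix (Fin n) (Fin n) k) - 1 ∈ d.nilLie}
  mul_mem' := by
    rintro g h ⟨hg, hg'⟩ ⟨hh, hh'⟩
    refine ⟨d.par.mul_mem hg hh, ?_⟩
    have e : ((g * h : GL (Fin n) k) : Matrix (Fin n) (Fin n) k) - 1
        = (g : Matrix (Fin n) (Fin n) k) * ((h : Matrix (Fin n) (Fin n) k) - 1)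
          + ((g : Matrix (Fin n) (Fin n) k) - 1) := by
      rw [Units.val_mul]; noncomm_ring
    rw [e]
    exact d.nilLie.add_mem (d.mul_mem_nilLie hg.1 hh') hg'
  one_mem' := ⟨d.par.one_mem, by simp⟩
  inv_mem' := by
    rintro g ⟨hg, hg'⟩
    refine ⟨d.par.inv_mem hg, ?_⟩
    have e : ((g⁻¹ : GL (Fin n) k) : Matrix (Fin n) (Fin n) k) - 1
        = -((↑g⁻¹ : Matrix (Fin n) (Fin n) k) * ((g : Matrix (Fin n) (Fin n) k) - 1)) := by
      rw [mul_sub, Units.inv_mul]; noncomm_ring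
    rw [e]
    exact d.nilLie.neg_mem (d.mul_mem_nilLie hg.2 hg')

/-- On the Lie algebra of the parabolic subgroup, this is the projection to the Lie algebra of the
Levi component along the Lie algebra of the unipotent radical. -/
def proj : Matrix (Fin n) (Fin n) k →ₗ[k] d.leviLie :=
  LinearMap.codRestrict (Subalgebra.toSubmodule d.leviLie)
    (d.coords.symm.toLinearMap ∘ₗ blockDiagonalPart k d.label ∘ₗ d.coords.toLinearMap) (by
      intro x
      change ∀ i j, d.label i ≠ d.label j → _
      intro i j hij
      simp [blockDiagonalPart, hij])

theorem proj_of_mem (x : d.leviLie) : d.proj x = x := by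
  apply Subtype.ext
  change d.coords.symm (blockDiagonalPart k d.label (d.coords x)) = x
  rw [AlgEquiv.symm_apply_eq]
  ext i j
  by_cases h : d.label i = d.label j
  · simp [blockDiagonalPart, h]
  · have hx : d.coords (x : Matrix (Fin n) (Fin n) k) i j = 0 := x.2 i j h
    simp [blockDiagonalPart, h, hx]

theorem sub_proj_mem_nilLie {x : Matrix (Fin n) (Fin n) k} (hx : x ∈ d.parLie) :
    x - d.proj x ∈ d.nilLie := by
  rw [mem_parLie] at hx
  rw [mem_nilLie]
  intro i j hij
  change d.coords (x - d.coords.symm (blockDiagonalPart k d.label (d.coords x))) i j = 0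
  rw [map_sub, AlgEquiv.apply_symm_apply]
  rcases hij.lt_or_eq with h | h
  · simp [blockDiagonalPart, h.ne', hx i j h]
  · simp [blockDiagonalPart, h]

/-- The semisimple rank over `k` of the parabolic subgroup, that is, of its Levi component
`∏ a, GL (V a)`: the sum of `dim (V a) - 1` over the non-zero `V a`. -/
def ssRank : ℕ := n - (Finset.univ.image d.label).card

end ParabolicLevi

/-- The adjoint action `x ↦ g x g⁻¹` of `GL_n(k)` on `𝔤𝔩_n(k)`. -/
def ad (g : GL (Fin n) k) (x : Matrix (Fin n) (Fin n) k) : Matrix (Fin n) (Fin n) k :=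
  (g : Matrix (Fin n) (Fin n) k) * x * ((g⁻¹ : GL (Fin n) k) : Matrix (Fin n) (Fin n) k)

theorem ad_mul (g h : GL (Fin n) k) (x : Matrix (Fin n) (Fin n) k) :
    ad (g * h) x = ad g (ad h x) := by
  simp only [ad, _root_.mul_inv_rev, Units.val_mul, mul_assoc]

theorem ad_one (x : Matrix (Fin n) (Fin n) k) : ad 1 x = x := by
  simp [ad]

theorem ad_add (g : GL (Fin n) k) (x y : Matrix (Fin n) (Fin n) k) :
    ad g (x + y) = ad g x + ad g y := by
  simp only [ad, mul_add, add_mul]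

theorem ad_inv_ad (g : GL (Fin n) k) (x : Matrix (Fin n) (Fin n) k) : ad g⁻¹ (ad g x) = x := by
  rw [← ad_mul, inv_mul_cancel, ad_one]

theorem ad_ad_inv (g : GL (Fin n) k) (x : Matrix (Fin n) (Fin n) k) : ad g (ad g⁻¹ x) = x := by
  rw [← ad_mul, mul_inv_cancel, ad_one]

theorem ad_mem_nilLie (d : ParabolicLevi k n) {g : GL (Fin n) k} (hg : g ∈ d.par)
    {x : Matrix (Fin n) (Fin n) k} (hx : x ∈ d.nilLie) : ad g x ∈ d.nilLie :=
  d.mem_nilLie_mul (d.mul_mem_nilLie hg.1 hx) hg.2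

theorem levi_le_par (d : ParabolicLevi k n) : d.levi ≤ d.par :=
  fun _ hg => ⟨d.leviLie_le_parLie hg.1, d.leviLie_le_parLie hg.2⟩

/-- The space `C(𝔤𝔩_n(k))` of complex functions on `𝔤𝔩_n(k)` that are invariant under the adjoint
action of `GL_n(k)`. -/
def InvFun (k : Type*) [Field k] (n : ℕ) : Submodule ℂ (Matrix (Fin n) (Fin n) k → ℂ) where
  carrier := {f | ∀ (g : GL (Fin n) k) (x : Matrix (Fin n) (Fin n) k),
    f (ad g x) = f x}
  add_mem' := by
    intro f f' hf hf' g x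
    rw [Pi.add_apply, Pi.add_apply, hf g x, hf' g x]
  zero_mem' := fun _ _ => rfl
  smul_mem' := by
    intro c f hf g x
    rw [Pi.smul_apply, Pi.smul_apply, hf g x]

/-- The space of complex functions on the Lie algebra of the Levi component of `d` that are
invariant under the adjoint action of the Levi component. -/
def LeviInvFun (d : ParabolicLevi k n) : Submodule ℂ (d.leviLie → ℂ) where
  carrier := {f | ∀ g ∈ d.levi, ∀ x y : d.leviLie,
    (y : Matrix (Fin n) (Fin n) k) = ad g x → f y = f x}
  add_mem' := by
    intro f f' hf hf' g hg x y hxy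
    rw [Pi.add_apply, Pi.add_apply, hf g hg x y hxy, hf' g hg x y hxy]
  zero_mem' := fun _ _ _ _ _ => rfl
  smul_mem' := by
    intro c f hf g hg x y hxy
    rw [Pi.smul_apply, Pi.smul_apply, hf g hg x y hxy]

section Finite

variable [Fintype k]

open Classical in
/-- The value at `x` of the Harish-Chandra restriction of `f`:
`(1 / |U|) * ∑ f (x + y)`, the sum over `y` in the Lie algebra of the unipotent radical `U`. -/
def hcResFun (d : ParabolicLevi k n) (f : Matrix (Fin n) (Fin n) k → ℂ) (x : d.leviLie) : ℂ :=
  (Nat.card d.unip : ℂ)⁻¹ *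
    ∑ y : Matrix (Fin n) (Fin n) k with y ∈ d.nilLie, f ((x : Matrix (Fin n) (Fin n) k) + y)

theorem hcResFun_mem (d : ParabolicLevi k n) (f : InvFun k n) :
    hcResFun d f.1 ∈ LeviInvFun d := by
  intro g hg x z hz
  have hp := levi_le_par d hg
  unfold hcResFun
  congr 1
  refine Finset.sum_bij' (fun y _ => ad g⁻¹ y) (fun y _ => ad g y) ?_ ?_ ?_ ?_ ?_
  · intro y hy
    simp only [Finset.mem_filter, Finset.mem_univ, true_and] at hy ⊢
    exact ad_mem_nilLie d (d.par.inv_mem hp) hy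
  · intro y hy
    simp only [Finset.mem_filter, Finset.mem_univ, true_and] at hy ⊢
    exact ad_mem_nilLie d hp hy
  · intro y _
    exact ad_ad_inv g y
  · intro y _
    exact ad_inv_ad g y
  · intro y _
    rw [← f.2 g ((x : Matrix (Fin n) (Fin n) k) + ad g⁻¹ y), ad_add, ad_ad_inv, hz]

variable [DecidableEq k]

open Classical in
/-- The value at `x` of the Harish-Chandra induction of `f`:
`(1 / |P|) * ∑ f (π (g x g⁻¹))`, the sum over the `g` in `GL_n(k)` for which `g x g⁻¹` lies in the
Lie algebra of the parabolic subgroup `P`. -/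
def hcIndFun (d : ParabolicLevi k n) (f : d.leviLie → ℂ) (x : Matrix (Fin n) (Fin n) k) : ℂ :=
  (Nat.card d.par : ℂ)⁻¹ * ∑ g : GL (Fin n) k with ad g x ∈ d.parLie, f (d.proj (ad g x))

open Classical in
theorem hcIndFun_mem (d : ParabolicLevi k n) (f : d.leviLie → ℂ) :
    hcIndFun d f ∈ InvFun k n := by
  intro g x
  unfold hcIndFun
  rw [Finset.sum_filter, Finset.sum_filter]
  refine congrArg (fun c : ℂ => (Nat.card d.par : ℂ)⁻¹ * c) ?_
  have e := Equiv.sum_comp (Equiv.mulRight g)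
    (fun a => if ad a x ∈ d.parLie then f (d.proj (ad a x)) else 0)
  simp only [Equiv.coe_mulRight, ad_mul] at e
  exact e

/-- Harish-Chandra restriction `*R`. -/
def hcRes (d : ParabolicLevi k n) : InvFun k n →ₗ[ℂ] LeviInvFun d where
  toFun f := ⟨hcResFun d f.1, hcResFun_mem d f⟩
  map_add' f f' := by
    apply Subtype.ext
    funext x
    change hcResFun d (f.1 + f'.1) x = hcResFun d f.1 x + hcResFun d f'.1 x
    simp only [hcResFun, Pi.add_apply, Finset.sum_add_distrib, mul_add]
  map_smul' c f := by
    apply Subtype.ext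
    funext x
    change hcResFun d (c • f.1) x = c * hcResFun d f.1 x
    simp only [hcResFun, Pi.smul_apply, smul_eq_mul, ← Finset.mul_sum]
    ring

/-- Harish-Chandra induction `R`. -/
def hcInd (d : ParabolicLevi k n) : LeviInvFun d →ₗ[ℂ] InvFun k n where
  toFun f := ⟨hcIndFun d f.1, hcIndFun_mem d f.1⟩
  map_add' f f' := by
    apply Subtype.ext
    funext x
    change hcIndFun d (f.1 + f'.1) x = hcIndFun d f.1 x + hcIndFun d f'.1 x
    simp only [hcIndFun, Pi.add_apply, Finset.sum_add_distrib, mul_add]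
  map_smul' c f := by
    apply Subtype.ext
    funext x
    change hcIndFun d (c • f.1) x = c * hcIndFun d f.1 x
    simp only [hcIndFun, Pi.smul_apply, smul_eq_mul, ← Finset.mul_sum]
    ring

end Finite

/-- The block upper triangular subgroup of `GL_{n₁ + n₂}` with blocks of sizes `n₁` and `n₂`,
with its block diagonal Levi component `GL_{n₁} × GL_{n₂}`. -/
def twoBlocks (k : Type*) [Field k] (n₁ n₂ : ℕ) : ParabolicLevi k (n₁ + n₂) where
  label := Fin.addCases (fun _ => 0) (fun _ => 1)
  frame := 1

theorem twoBlocks_coords {n₁ n₂ : ℕ} (x : Matrix (Fin (n₁ + n₂)) (Fin (n₁ + n₂)) k) :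
    (twoBlocks k n₁ n₂).coords x = x := by
  change (↑(1 : GL (Fin (n₁ + n₂)) k)⁻¹ : Matrix _ _ k) * x * (↑(1 : GL (Fin (n₁ + n₂)) k) :
    Matrix _ _ k) = x
  simp

/-- The first diagonal block. -/
def upperBlock {n₁ n₂ : ℕ} (x : Matrix (Fin (n₁ + n₂)) (Fin (n₁ + n₂)) k) :
    Matrix (Fin n₁) (Fin n₁) k :=
  x.submatrix (Fin.castAdd n₂) (Fin.castAdd n₂)

/-- The second diagonal block. -/
def lowerBlock {n₁ n₂ : ℕ} (x : Matrix (Fin (n₁ + n₂)) (Fin (n₁ + n₂)) k) :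
    Matrix (Fin n₂) (Fin n₂) k :=
  x.submatrix (Fin.natAdd n₁) (Fin.natAdd n₁)

theorem upperBlock_mul {n₁ n₂ : ℕ} {x : Matrix (Fin (n₁ + n₂)) (Fin (n₁ + n₂)) k}
    (hx : x ∈ (twoBlocks k n₁ n₂).leviLie) (y : Matrix (Fin (n₁ + n₂)) (Fin (n₁ + n₂)) k) :
    upperBlock (x * y) = upperBlock x * upperBlock y := by
  rw [ParabolicLevi.mem_leviLie, twoBlocks_coords] at hx
  ext i j
  simp only [upperBlock, Matrix.submatrix_apply, Matrix.mul_apply, Fin.sum_univ_add]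
  rw [add_eq_left]
  refine Finset.sum_eq_zero fun l _ => ?_
  rw [hx _ _ (by simp [twoBlocks]), zero_mul]

theorem lowerBlock_mul {n₁ n₂ : ℕ} {x : Matrix (Fin (n₁ + n₂)) (Fin (n₁ + n₂)) k}
    (hx : x ∈ (twoBlocks k n₁ n₂).leviLie) (y : Matrix (Fin (n₁ + n₂)) (Fin (n₁ + n₂)) k) :
    lowerBlock (x * y) = lowerBlock x * lowerBlock y := by
  rw [ParabolicLevi.mem_leviLie, twoBlocks_coords] at hx
  ext i j
  simp only [lowerBlock, Matrix.submatrix_apply, Matrix.mul_apply, Fin.sum_univ_add]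
  rw [add_eq_right]
  refine Finset.sum_eq_zero fun l _ => ?_
  rw [hx _ _ (by simp [twoBlocks]), zero_mul]

theorem upperBlock_one {n₁ n₂ : ℕ} :
    upperBlock (1 : Matrix (Fin (n₁ + n₂)) (Fin (n₁ + n₂)) k) = 1 := by
  ext i j
  simp [upperBlock, Matrix.one_apply]

theorem lowerBlock_one {n₁ n₂ : ℕ} :
    lowerBlock (1 : Matrix (Fin (n₁ + n₂)) (Fin (n₁ + n₂)) k) = 1 := by
  ext i j
  simp [lowerBlock, Matrix.one_apply]

theorem boxProd_invariant {n₁ n₂ : ℕ} (f₁ : InvFun k n₁) (f₂ : InvFun k n₂)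
    {g : GL (Fin (n₁ + n₂)) k} (hg : g ∈ (twoBlocks k n₁ n₂).levi)
    {x y : Matrix (Fin (n₁ + n₂)) (Fin (n₁ + n₂)) k} (hx : x ∈ (twoBlocks k n₁ n₂).leviLie)
    (hxy : y = ad g x) :
    f₁.1 (upperBlock y) * f₂.1 (lowerBlock y) = f₁.1 (upperBlock x) * f₂.1 (lowerBlock x) := by
  obtain ⟨hg1, hg2⟩ := (twoBlocks k n₁ n₂).mem_levi.1 hg
  have hgx : g.1 * x ∈ (twoBlocks k n₁ n₂).leviLie := Subalgebra.mul_mem _ hg1 hx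
  let u : GL (Fin n₁) k := ⟨upperBlock g.1, upperBlock (g⁻¹ : GL (Fin (n₁ + n₂)) k).1,
    by rw [← upperBlock_mul hg1, Units.mul_inv, upperBlock_one],
    by rw [← upperBlock_mul hg2, Units.inv_mul, upperBlock_one]⟩
  let v : GL (Fin n₂) k := ⟨lowerBlock g.1, lowerBlock (g⁻¹ : GL (Fin (n₁ + n₂)) k).1,
    by rw [← lowerBlock_mul hg1, Units.mul_inv, lowerBlock_one],
    by rw [← lowerBlock_mul hg2, Units.inv_mul, lowerBlock_one]⟩
  have hu : upperBlock y = ad u (upperBlock x) := by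
    rw [hxy, ad, upperBlock_mul hgx, upperBlock_mul hg1]
    rfl
  have hv : lowerBlock y = ad v (lowerBlock x) := by
    rw [hxy, ad, lowerBlock_mul hgx, lowerBlock_mul hg1]
    rfl
  rw [hu, hv, f₁.2 u, f₂.2 v]

/-- The external product `f₁ ⊠ f₂`, an invariant function on the block diagonal matrices
`𝔤𝔩_{n₁} × 𝔤𝔩_{n₂}` in `𝔤𝔩_{n₁ + n₂}`. -/
def boxProd {n₁ n₂ : ℕ} (f₁ : InvFun k n₁) (f₂ : InvFun k n₂) :
    LeviInvFun (twoBlocks k n₁ n₂) :=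
  ⟨fun x => f₁.1 (upperBlock x.1) * f₂.1 (lowerBlock x.1), by
    intro g hg x y hxy
    exact boxProd_invariant f₁ f₂ hg x.2 hxy⟩

section Finite

variable [Fintype k] [DecidableEq k]

/-- `f` is pre-cuspidal: its Harish-Chandra restriction to every Levi component of every proper
parabolic subgroup vanishes. -/
def IsPreCuspidal (f : InvFun k n) : Prop :=
  ∀ d : ParabolicLevi k n, d.par ≠ ⊤ → hcRes d f = 0

/-- The conditions that characterise the family of operators `𝔻_n` on `C(𝔤𝔩_n(k))`, `n ≥ 0`. -/
structure IsDualityFamily (D : ∀ n : ℕ, InvFun k n →ₗ[ℂ] InvFun k n) : Prop where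
  zero : D 0 = LinearMap.id
  comm_hcInd : ∀ n₁ n₂ : ℕ, 0 < n₁ → 0 < n₂ → ∀ (f₁ : InvFun k n₁) (f₂ : InvFun k n₂),
    D (n₁ + n₂) (hcInd (twoBlocks k n₁ n₂) (boxProd f₁ f₂))
      = hcInd (twoBlocks k n₁ n₂) (boxProd (D n₁ f₁) (D n₂ f₂))
  preCuspidal : ∀ n : ℕ, 0 < n → ∀ f : InvFun k n, IsPreCuspidal f → D n f = (-1 : ℂ) ^ (n - 1) • f

/-- Parabolic subgroups of `GL_n(k)`: stabilisers of flags in `k ^ n`. -/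
def IsParabolic (P : Subgroup (GL (Fin n) k)) : Prop :=
  ∃ d : ParabolicLevi k n, d.par = P

/-- Borel subgroups of `GL_n(k)`: stabilisers of complete flags in `k ^ n`. -/
def IsBorel (B : Subgroup (GL (Fin n) k)) : Prop :=
  ∃ d : ParabolicLevi k n, Function.Injective d.label ∧ d.par = B

/-- The duality operation `∑ (-1) ^ r(P) R ∘ *R`, the sum over the parabolic subgroups `P`
containing `B`, where `R` and `*R` are taken for the Levi component of `P` provided by `lev P`. -/
def dualityOp (B : Subgroup (GL (Fin n) k))
    (lev : Subgroup (GL (Fin n) k) → ParabolicLevi k n) : InvFun k n →ₗ[ℂ] InvFun k n :=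
  ∑ P ∈ (Set.toFinite {P : Subgroup (GL (Fin n) k) | IsParabolic P ∧ B ≤ P}).toFinset,
    (-1 : ℂ) ^ (lev P).ssRank • (hcInd (lev P) ∘ₗ hcRes (lev P))

end Finite

end

end GLDuality

/-! The spaces C(𝔤𝔩_n), taken together, behave as a commutative Hopf algebra, and up to the sign
(-1)^n the operator 𝒟_n is its antipode S. A family of invariant functions (`ClassFun`) is evaluated
at endomorphisms x of arbitrary finite spaces W by `ev`. Harish-Chandra induction becomes a
Hall-type product `mul`: (f·g)(x) is the sum of f(x|V) g(x|W/V) over the x-stable subspaces V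
(`hcInd_boxProd`). Restriction becomes the coproduct (a, b) ↦ `ev (del a f) b`, an average over
off-diagonal blocks. The Mackey formula `del_mul` says that the coproduct is multiplicative; the use
of averages makes it free of powers of q.

S is `dual`, the alternating sum over all flags. Splitting off the least non-zero member of a flag
gives the recursion `ev_dual_rec`, which is the antipode identity `sum_ev_dual_del`. As for any
antipode, products are reversed (`dual_mul`). The product is commutative (`mul_comm'`): an
endomorphism is conjugate to its transpose, and annihilators exchange subspaces and quotients. Hence
S is multiplicative, which is condition (i). On a pre-cuspidal function only the flag {0, W}
contributes, and this gives (ii).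

To compare S with 𝒟_n, note that the restriction of f at π(z) is the average of f over z + 𝔲, so R ∘
*R depends only on the flag of P and runs over the conjugates of that flag. Every flag is conjugate
to exactly one subflag of a given complete flag, so the sum over P ⊇ B is the sum over all flags
(`dualityOp_apply`), whatever B and the Levi components are.

Uniqueness: by Frobenius reciprocity, tested on characteristic functions of classes, a function
orthogonal to everything properly induced is pre-cuspidal. So every function is the sum of a
properly induced one and a pre-cuspidal one, and (i), (ii) and induction on n determine the
operators. -/

namespace GLDuality

open Module
open scoped BigOperators

set_option linter.unusedSectionVars false

noncomputable section

universe u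

section

/-! ### Finiteness of spaces of maps and subspaces -/

section FiniteInstances

variable {k : Type*} [Field k] {W Y : Type*} [AddCommGroup W] [Module k W] [Finite W]
  [AddCommGroup Y] [Module k Y] [Finite Y]

instance finite_linearMap : Finite (W →ₗ[k] Y) := DFunLike.finite _

instance finite_quotient (V : Submodule k W) : Finite (W ⧸ V) := Quotient.finite _

instance fintypeLinearMap : Fintype (W →ₗ[k] Y) := Fintype.ofFinite _

instance fintypeSubmodule : Fintype (Submodule k W) := Fintype.ofFinite _

end FiniteInstances

/-! ### Averages over finite groups -/

section Expect

open Classical in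
theorem card_addFiber {G H : Type*} [AddGroup G] [AddGroup H] [Fintype G]
    (φ : G →+ H) (hφ : Function.Surjective φ) (a b : H) :
    (Finset.univ.filter fun g => φ g = a).card = (Finset.univ.filter fun g => φ g = b).card := by
  obtain ⟨c, rfl⟩ := hφ a
  obtain ⟨d, rfl⟩ := hφ b
  refine Finset.card_bij' (fun g _ => g - c + d) (fun g _ => g - d + c) ?_ ?_ ?_ ?_
  · intro g hg
    simp only [Finset.mem_filter, Finset.mem_univ, true_and] at hg ⊢
    simp [hg]
  · intro g hg
    simp only [Finset.mem_filter, Finset.mem_univ, true_and] at hg ⊢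
    simp [hg]
  · intro g _; simp
  · intro g _; simp

/-- The average of a function pulled back along a surjective homomorphism. -/
theorem expect_comp_surjective {G H : Type*} [AddGroup G] [AddGroup H] [Fintype G] [Fintype H]
    (φ : G →+ H) (hφ : Function.Surjective φ) (F : H → ℂ) :
    Finset.expect Finset.univ (fun g => F (φ g)) = Finset.expect Finset.univ F := by
  classical
  rw [Fintype.expect_eq_sum_div_card, Fintype.expect_eq_sum_div_card]
  set c := (Finset.univ.filter fun g => φ g = 0).card with hc
  have h1 : ∀ b, (Finset.univ.filter fun g => φ g = b).card = c :=
    fun b => card_addFiber φ hφ b 0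
  have h2 : ∑ g, F (φ g) = (c : ℂ) * ∑ b, F b := by
    rw [← Finset.sum_fiberwise Finset.univ φ, Finset.mul_sum]
    refine Finset.sum_congr rfl fun b _ => ?_
    rw [Finset.sum_congr rfl (g := fun _ => F b)
      (fun g hg => by rw [(Finset.mem_filter.1 hg).2]), Finset.sum_const, h1, nsmul_eq_mul]
  have h3 : (Fintype.card G : ℂ) = c * Fintype.card H := by
    have := Finset.card_eq_sum_card_fiberwise (s := (Finset.univ : Finset G))
      (t := (Finset.univ : Finset H)) (f := φ) (fun _ _ => Finset.mem_univ _)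
    rw [Finset.card_univ, Finset.sum_congr rfl (fun b _ => h1 b), Finset.sum_const,
      Finset.card_univ, smul_eq_mul] at this
    rw [this]; push_cast; ring
  have hc0 : (c : ℂ) ≠ 0 := by
    rw [hc, Nat.cast_ne_zero]
    exact (Finset.card_pos.2 ⟨0, by simp⟩).ne'
  rw [h2, h3, mul_div_mul_left _ _ hc0]

theorem expect_add_left {G : Type*} [AddCommGroup G] [Fintype G] (c : G) (F : G → ℂ) :
    Finset.expect Finset.univ (fun g => F (c + g)) = Finset.expect Finset.univ F :=
  Fintype.expect_equiv (Equiv.addLeft c) _ _ fun _ => rfl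

theorem expect_add_right {G : Type*} [AddCommGroup G] [Fintype G] (c : G) (F : G → ℂ) :
    Finset.expect Finset.univ (fun g => F (g + c)) = Finset.expect Finset.univ F :=
  Fintype.expect_equiv (Equiv.addRight c) _ _ fun _ => rfl

theorem expect_prod_mul {G H : Type*} [Fintype G] [Fintype H] (F : G → ℂ) (F' : H → ℂ) :
    Finset.expect Finset.univ (fun g : G × H => F g.1 * F' g.2)
      = Finset.expect Finset.univ F * Finset.expect Finset.univ F' := by
  rw [Finset.expect_mul_expect]
  exact Finset.expect_product Finset.univ Finset.univ (fun g : G × H => F g.1 * F' g.2)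

end Expect

variable {k : Type u} [Field k]

/-! ### Conjugacy of endomorphisms of different spaces -/

section Conj

variable {W W' W'' : Type*} [AddCommGroup W] [Module k W] [AddCommGroup W'] [Module k W']
  [AddCommGroup W''] [Module k W'']

/-- Two endomorphisms of possibly different spaces are conjugate. -/
def Conj (x : End k W) (x' : End k W') : Prop := ∃ e : W ≃ₗ[k] W', ∀ w, e (x w) = x' (e w)

theorem Conj.refl (x : End k W) : Conj x x := ⟨LinearEquiv.refl k W, fun _ => rfl⟩

theorem Conj.symm {x : End k W} {x' : End k W'} (h : Conj x x') : Conj x' x := by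
  obtain ⟨e, he⟩ := h
  refine ⟨e.symm, fun w => ?_⟩
  rw [LinearEquiv.symm_apply_eq, he, LinearEquiv.apply_symm_apply]

theorem Conj.trans {x : End k W} {x' : End k W'} {x'' : End k W''} (h : Conj x x')
    (h' : Conj x' x'') : Conj x x'' := by
  obtain ⟨e, he⟩ := h
  obtain ⟨e', he'⟩ := h'
  exact ⟨e.trans e', fun w => by simp [he, he']⟩

theorem conj_conj (e : W ≃ₗ[k] W') (x : End k W) : Conj x (e.conj x) :=
  ⟨e, fun w => by simp [LinearEquiv.conj_apply]⟩

end Conj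

/-- Families of invariant functions on all the `𝔤𝔩_n(k)`. -/
abbrev ClassFun (k : Type u) [Field k] : Type u := ∀ n, InvFun k n

/-! ### Coordinate-free evaluation of invariant functions -/

section Ev

variable {W W' : Type*} [AddCommGroup W] [Module k W] [AddCommGroup W'] [Module k W']

/-- The value of `f` at an endomorphism of an arbitrary finite-dimensional space. -/
def ev (f : ClassFun k) [Module.Finite k W] (x : End k W) : ℂ :=
  (f (finrank k W)).1 (LinearMap.toMatrix (finBasis k W) (finBasis k W) x)

theorem InvFun.apply_eq_of_conj {n : ℕ} (f : InvFun k n) {x y : Matrix (Fin n) (Fin n) k}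
    (p q : Matrix (Fin n) (Fin n) k) (hpq : p * q = 1) (h : y = p * x * q) : f.1 y = f.1 x := by
  have := f.2 ⟨p, q, hpq, mul_eq_one_comm.1 hpq⟩ x
  rw [← this, h]; rfl

/-- A change of basis conjugates the matrix, so the choice of `finBasis` in `ev` is immaterial. -/
theorem ev_eq_toMatrix (f : ClassFun k) [Module.Finite k W] {n : ℕ} (b : Basis (Fin n) k W)
    (x : End k W) : ev f x = (f n).1 (LinearMap.toMatrix b b x) := by
  obtain rfl : n = finrank k W := by rw [finrank_eq_card_basis b, Fintype.card_fin]
  refine InvFun.apply_eq_of_conj _ ((finBasis k W).toMatrix b) (b.toMatrix (finBasis k W)) ?_ ?_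
  · exact Basis.toMatrix_mul_toMatrix_flip _ _
  · exact (basis_toMatrix_mul_linearMap_toMatrix_mul_basis_toMatrix _ _ _ _ _).symm

theorem ev_congr (f : ClassFun k) [Module.Finite k W] [Module.Finite k W'] {x : End k W}
    {x' : End k W'} (h : Conj x x') : ev f x = ev f x' := by
  obtain ⟨e, he⟩ := h
  rw [ev_eq_toMatrix f ((finBasis k W).map e) x']
  refine congrArg (f _).1 ?_
  ext i j
  simp only [LinearMap.toMatrix_apply, Basis.map_apply, Basis.map_repr, ← he,
    LinearEquiv.trans_apply, LinearEquiv.symm_apply_apply]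

theorem ev_toLin' (f : ClassFun k) {n : ℕ} (x : Matrix (Fin n) (Fin n) k) :
    ev f (Matrix.toLin' x) = (f n).1 x := by
  rw [ev_eq_toMatrix f (Pi.basisFun k (Fin n))]
  exact congrArg (f n).1 (LinearMap.toMatrix'_toLin' x)

theorem ev_add (f g : ClassFun k) [Module.Finite k W] (x : End k W) :
    ev (f + g) x = ev f x + ev g x := rfl

theorem ev_smul (c : ℂ) (f : ClassFun k) [Module.Finite k W] (x : End k W) :
    ev (c • f) x = c * ev f x := rfl

theorem ev_sum {ι : Type*} (s : Finset ι) (f : ι → ClassFun k) [Module.Finite k W] (x : End k W) :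
    ev (∑ i ∈ s, f i) x = ∑ i ∈ s, ev (f i) x := by
  classical
  induction s using Finset.induction_on with
  | empty => rfl
  | insert a s ha ih => rw [Finset.sum_insert ha, Finset.sum_insert ha, ev_add, ih]

theorem conj_of_toMatrix {n : ℕ} (b : Basis (Fin n) k W) (x : End k W) :
    Conj (Matrix.toLin' (LinearMap.toMatrix b b x)) x := by
  refine Conj.symm ⟨b.equivFun, fun w => ?_⟩
  rw [Matrix.toLin'_apply, Basis.equivFun_apply, Basis.equivFun_apply,
    LinearMap.toMatrix_mulVec_repr]

theorem conj_ad {n : ℕ} (g : GL (Fin n) k) (x : Matrix (Fin n) (Fin n) k) :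
    Conj (Matrix.toLin' x) (Matrix.toLin' (ad g x)) := by
  refine ⟨Matrix.GeneralLinearGroup.toLin g |>.toLinearEquiv, fun w => ?_⟩
  change g.1 *ᵥ (x *ᵥ w) = (ad g x) *ᵥ (g.1 *ᵥ w)
  simp only [ad, Matrix.mulVec_mulVec, mul_assoc, Units.inv_mul, mul_one]

variable [Fintype k]

/-- The family of invariant functions given by a conjugation invariant function on the
endomorphisms of all finite spaces. -/
def mkClass (F : ∀ (W : Type u) [AddCommGroup W] [Module k W] [Finite W], End k W → ℂ)
    (hF : ∀ (W W' : Type u) [AddCommGroup W] [Module k W] [Finite W] [AddCommGroup W'] [Module k W']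
      [Finite W'] (x : End k W) (x' : End k W'), Conj x x' → F W x = F W' x') : ClassFun k :=
  fun n => ⟨fun x => F (Fin n → k) (Matrix.toLin' x), fun g x => (hF _ _ _ _ (conj_ad g x)).symm⟩

theorem ev_mkClass (F : ∀ (W : Type u) [AddCommGroup W] [Module k W] [Finite W], End k W → ℂ)
    (hF : ∀ (W W' : Type u) [AddCommGroup W] [Module k W] [Finite W] [AddCommGroup W'] [Module k W']
      [Finite W'] (x : End k W) (x' : End k W'), Conj x x' → F W x = F W' x')
    {W : Type u} [AddCommGroup W] [Module k W] [Finite W] (x : End k W) :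
    ev (mkClass F hF) x = F W x :=
  hF _ _ _ _ (conj_of_toMatrix (finBasis k W) x)

/-- This lets identities between families be proved on abstract spaces, without coordinates. -/
theorem classFun_ext {f g : ClassFun k}
    (h : ∀ (W : Type u) [AddCommGroup W] [Module k W] [Finite W] (x : End k W), ev f x = ev g x) :
    f = g := by
  funext n
  apply Subtype.ext
  funext x
  rw [← ev_toLin', ← ev_toLin']
  exact h _ _

end Ev

end

section

variable {k : Type u} [Field k]

/-! ### Stable subspaces and subquotients -/

section Subquotients

variable {W Y Y' : Type*} [AddCommGroup W] [Module k W] [AddCommGroup Y] [Module k Y]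
  [AddCommGroup Y'] [Module k Y']

/-- The subspaces stable under an endomorphism. -/
abbrev Inv (x : End k W) : Type _ := {V : Submodule k W // V ≤ V.comap x}

instance fintypeInv [Finite W] (x : End k W) : Fintype (Inv x) := Fintype.ofFinite _

instance (x : End k W) : Bot (Inv x) := ⟨⟨⊥, bot_le⟩⟩

instance (x : End k W) : Top (Inv x) := ⟨⟨⊤, by simp⟩⟩

/-- The endomorphism induced on a stable subspace. -/
def subE (x : End k W) (V : Inv x) : End k V.1 := x.restrict V.2

/-- The endomorphism induced on the quotient by a stable subspace. -/
def quotE (x : End k W) (V : Inv x) : End k (W ⧸ V.1) := V.1.mapQ V.1 x V.2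

@[simp] theorem coe_subE (x : End k W) (V : Inv x) (v : V.1) : (subE x V v : W) = x v := rfl

@[simp] theorem quotE_mkQ (x : End k W) (V : Inv x) (w : W) :
    quotE x V (V.1.mkQ w) = V.1.mkQ (x w) := rfl

/-- `y` is, up to conjugation, the endomorphism induced by `x` on `B / A`. -/
def IsSubquot (x : End k W) (A B : Submodule k W) (y : End k Y) : Prop :=
  ∃ p : B →ₗ[k] Y, Function.Surjective p ∧ (∀ b, p b = 0 ↔ (b : W) ∈ A) ∧
    ∀ b b' : B, (b' : W) = x b → p b' = y (p b)

theorem isSubquot_subE (x : End k W) (V : Inv x) : IsSubquot x ⊥ V.1 (subE x V) := by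
  refine ⟨LinearMap.id, Function.surjective_id, fun b => ?_, fun b b' h => ?_⟩
  · simp
  · exact Subtype.ext h

theorem isSubquot_quotE (x : End k W) (V : Inv x) : IsSubquot x V.1 ⊤ (quotE x V) := by
  refine ⟨V.1.mkQ ∘ₗ Submodule.subtype ⊤, ?_, fun b => ?_, fun b b' h => ?_⟩
  · intro q
    obtain ⟨w, rfl⟩ := V.1.mkQ_surjective q
    exact ⟨⟨w, trivial⟩, rfl⟩
  · simp
  · simp only [LinearMap.comp_apply, Submodule.subtype_apply, h, quotE_mkQ]

theorem isSubquot_self (x : End k W) : IsSubquot x ⊥ ⊤ x :=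
  ⟨Submodule.subtype ⊤, fun w => ⟨⟨w, trivial⟩, rfl⟩, fun b => by simp, fun b b' h => h⟩

theorem submoduleOf_stable (x : End k W) (A B : Inv x) :
    A.1.submoduleOf B.1 ≤ (A.1.submoduleOf B.1).comap (subE x B) :=
  fun b hb => A.2 (x := (b : W)) hb

/-- The endomorphism induced on the subquotient `B / A` (for `A ≤ B`). -/
def sq (x : End k W) (A B : Inv x) : End k (B.1 ⧸ A.1.submoduleOf B.1) :=
  quotE (subE x B) ⟨A.1.submoduleOf B.1, submoduleOf_stable x A B⟩

theorem isSubquot_sq (x : End k W) (A B : Inv x) : IsSubquot x A.1 B.1 (sq x A B) := by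
  refine ⟨(A.1.submoduleOf B.1).mkQ, Submodule.mkQ_surjective _, fun b => ?_, fun b b' h => ?_⟩
  · rw [Submodule.mkQ_apply, Submodule.Quotient.mk_eq_zero]; rfl
  · have : b' = subE x B b := Subtype.ext h
    rw [this]; rfl

/-- Both models are the quotient of B by the same kernel, namely A ∩ B. -/
theorem IsSubquot.conj {x : End k W} {A B : Submodule k W} (hB : B ≤ B.comap x) {y : End k Y}
    {y' : End k Y'} (h : IsSubquot x A B y) (h' : IsSubquot x A B y') : Conj y y' := by
  obtain ⟨p, hp, hp0, hpx⟩ := h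
  obtain ⟨p', hp', hp0', hpx'⟩ := h'
  have hker : LinearMap.ker p = LinearMap.ker p' := by
    ext b; rw [LinearMap.mem_ker, LinearMap.mem_ker, hp0, hp0']
  let e : Y ≃ₗ[k] Y' := (p.quotKerEquivOfSurjective hp).symm ≪≫ₗ
    Submodule.quotEquivOfEq _ _ hker ≪≫ₗ p'.quotKerEquivOfSurjective hp'
  have he : ∀ b, e (p b) = p' b := by
    intro b
    have h1 : (p.quotKerEquivOfSurjective hp).symm (p b) = Submodule.Quotient.mk b := by
      rw [LinearEquiv.symm_apply_eq]; rfl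
    simp only [e, LinearEquiv.trans_apply, h1]
    rfl
  refine ⟨e, fun w => ?_⟩
  obtain ⟨b, rfl⟩ := hp w
  rw [← hpx b ⟨x b, hB b.2⟩ rfl, he, he, ← hpx' b ⟨x b, hB b.2⟩ rfl]

theorem IsSubquot.ev_eq {x : End k W} {A B : Submodule k W} (hB : B ≤ B.comap x)
    [Module.Finite k Y] [Module.Finite k Y'] {y : End k Y}
    {y' : End k Y'} (h : IsSubquot x A B y) (h' : IsSubquot x A B y') (f : ClassFun k) :
    ev f y = ev f y' :=
  ev_congr f (h.conj hB h')

/-- The stable subspaces of a subquotient `B / A` are the stable subspaces between `A` and `B`. -/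
theorem IsSubquot.sum_inv [Finite W] [Finite Y] {M : Type*} [AddCommMonoid M] {x : End k W}
    {A B : Submodule k W} (hB : B ≤ B.comap x) (hAB : A ≤ B) {y : End k Y} (h : IsSubquot x A B y)
    (Φ : Inv y → M) (Ψ : Inv x → M)
    (H : ∀ (V' : Inv y) (V : Inv x), IsSubquot x A V.1 (subE y V') →
      IsSubquot x V.1 B (quotE y V') → Φ V' = Ψ V) :
    open Classical in ∑ V', Φ V' = ∑ V : Inv x with A ≤ V.1 ∧ V.1 ≤ B, Ψ V := by
  classical
  obtain ⟨p, hp, hp0, hpx⟩ := h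
  have hmem : ∀ (V' : Submodule k Y) (w : W),
      w ∈ (V'.comap p).map B.subtype ↔ ∃ hw : w ∈ B, p ⟨w, hw⟩ ∈ V' := by
    intro V' w
    constructor
    · rintro ⟨b, hb, rfl⟩
      exact ⟨b.2, hb⟩
    · rintro ⟨hw, h⟩
      exact ⟨⟨w, hw⟩, h, rfl⟩
  -- The correspondence theorem: V' goes to its inverse image in B, regarded as a subspace of W.
  let i : Inv y → Inv x := fun V' => ⟨(V'.1.comap p).map B.subtype, by
    intro w hw
    obtain ⟨hwB, hw⟩ := (hmem _ _).1 hw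
    refine (hmem _ _).2 ⟨hB hwB, ?_⟩
    rw [hpx ⟨w, hwB⟩ ⟨x w, hB hwB⟩ rfl]
    exact V'.2 hw⟩
  have hi : ∀ (V' : Inv y) (w : W), w ∈ (i V').1 ↔ ∃ hw : w ∈ B, p ⟨w, hw⟩ ∈ V'.1 :=
    fun V' w => hmem V'.1 w
  have hiB : ∀ V', (i V').1 ≤ B := fun V' w hw => ((hi V' w).1 hw).1
  refine Finset.sum_bij (fun V' _ => i V') ?_ ?_ ?_ ?_
  · intro V' _
    refine Finset.mem_filter.2 ⟨Finset.mem_univ _, fun w hw => ?_, hiB V'⟩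
    refine (hi V' w).2 ⟨hAB hw, ?_⟩
    rw [(hp0 ⟨w, hAB hw⟩).2 hw]
    exact V'.1.zero_mem
  · intro V _ V' _ hVV
    apply Subtype.ext
    ext q
    obtain ⟨b, rfl⟩ := hp q
    have h1 := hi V b
    have h2 := hi V' b
    change i V = i V' at hVV
    rw [hVV] at h1
    have h3 := h1.symm.trans h2
    constructor
    · intro h
      exact (h3.1 ⟨b.2, h⟩).2
    · intro h
      exact (h3.2 ⟨b.2, h⟩).2
  · intro V hV
    obtain ⟨hAV, hVB⟩ := (Finset.mem_filter.1 hV).2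
    refine ⟨⟨(V.1.comap B.subtype).map p, ?_⟩, Finset.mem_univ _, ?_⟩
    · rintro _ ⟨b, hb, rfl⟩
      exact ⟨⟨x b, hB b.2⟩, V.2 hb, hpx b _ rfl⟩
    · apply Subtype.ext
      ext w
      rw [hi]
      constructor
      · rintro ⟨hw, b, hb, hbw⟩
        have : p (⟨w, hw⟩ - b) = 0 := by rw [map_sub, hbw, sub_self]
        have h1 : w - (b : W) ∈ V.1 := hAV ((hp0 _).1 this)
        have h2 : (b : W) ∈ V.1 := hb
        simpa using V.1.add_mem h1 h2
      · intro hw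
        exact ⟨hVB hw, ⟨w, hVB hw⟩, hw, rfl⟩
  · intro V' _
    refine H V' (i V') ?_ ?_
    · refine ⟨(p ∘ₗ Submodule.inclusion (hiB V')).codRestrict V'.1
        (fun w => ((hi V' w).1 w.2).2), ?_, fun b => ?_, fun b b' hb => ?_⟩
      · rintro ⟨q, hq⟩
        obtain ⟨b, rfl⟩ := hp q
        exact ⟨⟨b, (hi V' b).2 ⟨b.2, hq⟩⟩, rfl⟩
      · exact Subtype.ext_iff.trans (hp0 (Submodule.inclusion (hiB V') b))
      · apply Subtype.ext
        exact hpx (Submodule.inclusion (hiB V') b) (Submodule.inclusion (hiB V') b') hb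
    · refine ⟨V'.1.mkQ ∘ₗ p, V'.1.mkQ_surjective.comp hp, fun b => ?_, fun b b' hb => ?_⟩
      · rw [LinearMap.comp_apply, Submodule.mkQ_apply, Submodule.Quotient.mk_eq_zero, hi]
        exact ⟨fun h => ⟨b.2, h⟩, fun h => h.2⟩
      · rw [LinearMap.comp_apply, hpx b b' hb]
        rfl

theorem Conj.isSubquot {x : End k W} {y : End k Y} (h : Conj x y) : IsSubquot x ⊥ ⊤ y := by
  obtain ⟨e, he⟩ := h
  refine ⟨e.toLinearMap ∘ₗ Submodule.subtype ⊤, ?_, fun b => ?_, fun b b' h => ?_⟩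
  · intro q
    exact ⟨⟨e.symm q, trivial⟩, by simp⟩
  · simp
  · simp [h, he]

end Subquotients

/-! ### The product -/

section Mul

variable [Fintype k]

/-- The value of the product of `f` and `g` at `x`. -/
def mulFun (f g : ClassFun k) (W : Type u) [AddCommGroup W] [Module k W] [Finite W]
    (x : End k W) : ℂ :=
  ∑ V : Inv x, ev f (subE x V) * ev g (quotE x V)

variable {W Y : Type u} [AddCommGroup W] [Module k W] [Finite W] [AddCommGroup Y] [Module k Y]
  [Finite Y]

-- Products on a subquotient are rewritten as sums over an interval of stable subspaces of W, so
-- that nested products live in a single lattice and can be summed in any order.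
open Classical in
theorem IsSubquot.mulFun_eq (f g : ClassFun k) {x : End k W} {A B : Inv x} (hAB : A.1 ≤ B.1)
    {y : End k Y} (h : IsSubquot x A.1 B.1 y) :
    mulFun f g Y y = ∑ V : Inv x with A.1 ≤ V.1 ∧ V.1 ≤ B.1,
      ev f (sq x A V) * ev g (sq x V B) := by
  refine h.sum_inv B.2 hAB _ _ fun V' V h1 h2 => ?_
  rw [h1.ev_eq V.2 (isSubquot_sq x A V), h2.ev_eq B.2 (isSubquot_sq x V B)]

/-- Both x and its conjugate are models of the subquotient W/0 of x, so the two values are the same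
sum over stable subspaces of W. -/
theorem mulFun_congr (f g : ClassFun k) (W W' : Type u) [AddCommGroup W] [Module k W] [Finite W]
    [AddCommGroup W'] [Module k W'] [Finite W'] (x : End k W) (x' : End k W') (h : Conj x x') :
    mulFun f g W x = mulFun f g W' x' := by
  rw [(isSubquot_self x).mulFun_eq f g (A := ⊥) (B := ⊤) bot_le,
    h.isSubquot.mulFun_eq f g (A := ⊥) (B := ⊤) bot_le]

/-- The product of two families of invariant functions (Harish-Chandra induction). -/
def mul (f g : ClassFun k) : ClassFun k := mkClass (mulFun f g) (mulFun_congr f g)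

theorem ev_mul (f g : ClassFun k) (x : End k W) :
    ev (mul f g) x = ∑ V : Inv x, ev f (subE x V) * ev g (quotE x V) :=
  ev_mkClass _ _ _

open Classical in
theorem IsSubquot.ev_mul (f g : ClassFun k) {x : End k W} {A B : Inv x} (hAB : A.1 ≤ B.1)
    {y : End k Y} (h : IsSubquot x A.1 B.1 y) :
    ev (mul f g) y = ∑ V : Inv x with A.1 ≤ V.1 ∧ V.1 ≤ B.1,
      ev f (sq x A V) * ev g (sq x V B) := by
  rw [← h.mulFun_eq f g hAB]; exact ev_mkClass _ _ _

end Mul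

end

section

variable {k : Type u} [Field k]

/-! ### Block triangular endomorphisms and shears -/

section Tri

variable {A B A' B' : Type*} [AddCommGroup A] [Module k A] [AddCommGroup B] [Module k B]
  [AddCommGroup A'] [Module k A'] [AddCommGroup B'] [Module k B']

/-- The block triangular endomorphism of `A × B` with given blocks. -/
def tri (a : End k A) (h : B →ₗ[k] A) (b : End k B) : End k (A × B) :=
  (a ∘ₗ LinearMap.fst k A B + h ∘ₗ LinearMap.snd k A B).prod (b ∘ₗ LinearMap.snd k A B)

theorem tri_apply (a : End k A) (h : B →ₗ[k] A) (b : End k B) (v : A × B) :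
    tri a h b v = (a v.1 + h v.2, b v.2) := rfl

/-- The shear `(α, β) ↦ (α + s β, β)`. -/
def shear (s : B →ₗ[k] A) : (A × B) ≃ₗ[k] (A × B) :=
  LinearEquiv.ofLinearMap (tri LinearMap.id s LinearMap.id) (tri LinearMap.id (-s) LinearMap.id)
    (by ext v <;> simp [tri_apply]) (by ext v <;> simp [tri_apply])

theorem shear_apply (s : B →ₗ[k] A) (v : A × B) : shear s v = (v.1 + s v.2, v.2) := rfl

/-- Conjugation by a shear keeps the diagonal blocks and translates the off-diagonal one. An average
over off-diagonal blocks is therefore insensitive to shears. -/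
theorem shear_tri (a : End k A) (h : B →ₗ[k] A) (b : End k B) (s : B →ₗ[k] A) (v : A × B) :
    shear s (tri a h b v) = tri a (h + (s ∘ₗ b - a ∘ₗ s)) b (shear s v) := by
  simp only [shear_apply, tri_apply, LinearMap.add_apply, LinearMap.sub_apply,
    LinearMap.comp_apply, map_add]
  ext
  · simp only; abel
  · rfl

variable [Finite A] [Finite B] [Finite A'] [Finite B']

theorem expect_tri_congr (f : ClassFun k) {a : End k A} {a' : End k A'} {b : End k B}
    {b' : End k B'} (ha : Conj a a') (hb : Conj b b') :
    Finset.expect Finset.univ (fun h : B →ₗ[k] A => ev f (tri a h b))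
      = Finset.expect Finset.univ (fun h : B' →ₗ[k] A' => ev f (tri a' h b')) := by
  obtain ⟨e, he⟩ := ha
  obtain ⟨e', he'⟩ := hb
  refine Fintype.expect_equiv (LinearEquiv.arrowCongr e' e).toEquiv _ _ fun h => ?_
  refine ev_congr f ⟨e.prodCongr e', fun v => ?_⟩
  simp [tri_apply, he, he', LinearEquiv.arrowCongr_apply]

end Tri

/-! ### Restriction as a coproduct -/

section Del

variable [Fintype k]

variable {A : Type u} [AddCommGroup A] [Module k A] [Finite A]

/-- The family of invariant functions obtained from `f` by Harish-Chandra restriction and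
evaluation of the first variable at `a`. -/
def del (a : End k A) (f : ClassFun k) : ClassFun k :=
  mkClass (fun B _ _ _ b => Finset.expect Finset.univ (fun h : B →ₗ[k] A => ev f (tri a h b)))
    (fun _ _ _ _ _ _ _ _ _ _ h => expect_tri_congr f (Conj.refl a) h)

variable {B : Type u} [AddCommGroup B] [Module k B] [Finite B]

theorem ev_del (a : End k A) (f : ClassFun k) (b : End k B) :
    ev (del a f) b = Finset.expect Finset.univ (fun h : B →ₗ[k] A => ev f (tri a h b)) :=
  ev_mkClass _ _ _

theorem del_congr {A' : Type u} [AddCommGroup A'] [Module k A'] [Finite A'] {a : End k A}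
    {a' : End k A'} (h : Conj a a') (f : ClassFun k) : del a f = del a' f := by
  refine classFun_ext fun W _ _ _ x => ?_
  rw [ev_del, ev_del]
  exact expect_tri_congr f h (Conj.refl x)

/-- A splitting of W → W/V identifies W with V × W/V and makes x block triangular with some
off-diagonal block h₀. Adding a map W/V → V to x adds the same map to h₀. -/
theorem conj_add_tri {W : Type*} [AddCommGroup W] [Module k W] (x : End k W) (V : Inv x) :
    ∃ h₀ : (W ⧸ V.1) →ₗ[k] V.1, ∀ h : (W ⧸ V.1) →ₗ[k] V.1,
      Conj (tri (subE x V) (h₀ + h) (quotE x V)) (x + V.1.subtype ∘ₗ h ∘ₗ V.1.mkQ) := by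
  obtain ⟨s, hs⟩ := V.1.mkQ.exists_rightInverse_of_surjective (Submodule.range_mkQ V.1)
  have hs' : ∀ q, V.1.mkQ (s q) = q := fun q => LinearMap.congr_fun hs q
  have hV : ∀ w, V.1.mkQ w = 0 → w ∈ V.1 := fun w hw =>
    (Submodule.Quotient.mk_eq_zero V.1).1 hw
  have hmem : ∀ q, x (s q) - s (quotE x V q) ∈ V.1 := by
    intro q
    apply hV
    rw [map_sub, hs', ← quotE_mkQ, hs', sub_self]
  -- The off-diagonal block measures how far the splitting is from intertwining x with the induced
  -- map on W/V.
  let h₀ : (W ⧸ V.1) →ₗ[k] V.1 := (x ∘ₗ s - s ∘ₗ quotE x V).codRestrict V.1 hmem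
  have hh₀ : ∀ q, (h₀ q : W) = x (s q) - s (quotE x V q) := fun q => rfl
  have hproj : ∀ w, w - s (V.1.mkQ w) ∈ V.1 := by
    intro w
    apply hV
    rw [map_sub, hs', sub_self]
  let e : (V.1 × (W ⧸ V.1)) ≃ₗ[k] W := LinearEquiv.ofLinearMap
    (V.1.subtype.coprod s)
    (((LinearMap.id - s ∘ₗ V.1.mkQ).codRestrict V.1 hproj).prod V.1.mkQ)
    (by ext w; simp)
    (by
      apply LinearMap.ext
      rintro ⟨v, q⟩
      have h1 : V.1.mkQ (v : W) = 0 := by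
        rw [← LinearMap.mem_ker, V.1.ker_mkQ]; exact v.2
      have h2 : V.1.mkQ ((v : W) + s q) = q := by rw [map_add, h1, hs', zero_add]
      ext
      · change (v : W) + s q - s (V.1.mkQ ((v : W) + s q)) = v
        rw [h2]; simp
      · exact h2)
  refine ⟨h₀, fun h => ⟨e, ?_⟩⟩
  rintro ⟨v, q⟩
  have h1 : V.1.mkQ (v : W) = 0 := by
    rw [← LinearMap.mem_ker, V.1.ker_mkQ]; exact v.2
  have h2 : V.1.mkQ ((v : W) + s q) = q := by rw [map_add, h1, hs', zero_add]
  change ((subE x V v + (h₀ + h) q : V.1) : W) + s (quotE x V q)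
    = x ((v : W) + s q) + (h (V.1.mkQ ((v : W) + s q)) : W)
  rw [h2, Submodule.coe_add, LinearMap.add_apply, Submodule.coe_add, hh₀, coe_subE, map_add]
  abel

/-- The translation by h₀ disappears in the average, so restriction has a description independent of
any splitting: the average of f over x + Hom(W/V, V). -/
theorem ev_del_quotE {W : Type u} [AddCommGroup W] [Module k W] [Finite W] (f : ClassFun k)
    (x : End k W) (V : Inv x) :
    ev (del (subE x V) f) (quotE x V) = Finset.expect Finset.univ
      (fun h : (W ⧸ V.1) →ₗ[k] V.1 => ev f (x + V.1.subtype ∘ₗ h ∘ₗ V.1.mkQ)) := by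
  obtain ⟨h₀, hh⟩ := conj_add_tri x V
  rw [ev_del, ← expect_add_left h₀]
  exact Finset.expect_congr rfl fun h _ => ev_congr f (hh h)

end Del

/-! ### Subspaces of A × B and their averaged contributions -/

section Mackey

theorem sum_inv_eq {W : Type*} [AddCommGroup W] [Module k W] [Finite W] {M : Type*}
    [AddCommMonoid M] (x : End k W) (F : Submodule k W → M)
    (hF : ∀ V, ¬ V ≤ V.comap x → F V = 0) : ∑ V, F V = ∑ V : Inv x, F V.1 := by
  classical
  rw [← Finset.sum_filter_of_ne (p := fun V => V ≤ V.comap x)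
    (fun V _ h => by_contra fun h' => h (hF V h'))]
  exact Finset.sum_subtype _ (fun V => by simp) F

open Classical in
/-- The contribution of the subspace `V` to the value at `z` of the product of `f` and `g`. -/
def prodAt (f g : ClassFun k) {W : Type*} [AddCommGroup W] [Module k W] [Finite W]
    (z : End k W) (V : Submodule k W) : ℂ :=
  if hV : V ≤ V.comap z then ev f (subE z ⟨V, hV⟩) * ev g (quotE z ⟨V, hV⟩) else 0

theorem ev_mul_eq_sum_prodAt [Fintype k] (f g : ClassFun k) {W : Type u} [AddCommGroup W]
    [Module k W] [Finite W] (z : End k W) : ev (mul f g) z = ∑ V, prodAt f g z V := by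
  rw [ev_mul, sum_inv_eq z (prodAt f g z) (fun V hV => dif_neg hV)]
  refine Finset.sum_congr rfl fun V _ => ?_
  rw [prodAt, dif_pos V.2]

theorem prodAt_map (f g : ClassFun k) {W W' : Type*} [AddCommGroup W] [Module k W] [Finite W]
    [AddCommGroup W'] [Module k W'] [Finite W'] {z : End k W} {z' : End k W'}
    (e : W ≃ₗ[k] W') (he : ∀ w, e (z w) = z' (e w)) (V : Submodule k W) :
    prodAt f g z' (V.map e.toLinearMap) = prodAt f g z V := by
  have hst : V.map e.toLinearMap ≤ (V.map e.toLinearMap).comap z' ↔ V ≤ V.comap z := by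
    constructor
    · intro h v hv
      obtain ⟨w, hw, hw'⟩ := h (Submodule.mem_map_of_mem hv)
      have : e w = e (z v) := by rw [he]; exact hw'
      rw [e.injective this] at hw
      exact hw
    · rintro h _ ⟨v, hv, rfl⟩
      exact ⟨z v, h hv, he v⟩
  by_cases hV : V ≤ V.comap z
  · rw [prodAt, prodAt, dif_pos hV, dif_pos (hst.2 hV)]
    congr 1
    · refine ev_congr f (Conj.symm ⟨e.submoduleMap V, fun v => ?_⟩)
      exact Subtype.ext (he v)
    · refine ev_congr g (Conj.symm ⟨Submodule.Quotient.equiv V _ e rfl, fun q => ?_⟩)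
      obtain ⟨w, rfl⟩ := V.mkQ_surjective q
      exact congrArg (Submodule.Quotient.mk (p := V.map e.toLinearMap)) (he w)
  · rw [prodAt, prodAt, dif_neg hV, dif_neg (fun h => hV (hst.1 h))]

variable {A B : Type*} [AddCommGroup A] [Module k A] [AddCommGroup B] [Module k B]

theorem mem_map_shear (U : Submodule k A) (X : Submodule k B) (s : B →ₗ[k] A) (v : A × B) :
    v ∈ (U.prod X).map (shear s).toLinearMap ↔ v.1 - s v.2 ∈ U ∧ v.2 ∈ X := by
  constructor
  · rintro ⟨w, ⟨h1, h2⟩, rfl⟩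
    exact ⟨by simpa [shear_apply] using h1, h2⟩
  · rintro ⟨h1, h2⟩
    exact ⟨(v.1 - s v.2, v.2), ⟨h1, h2⟩, by simp [shear_apply]⟩

/-- Let X be the image of V in B. A linear section of V → X, followed by the projection to A and
extended from X to B, is the required s. -/
theorem exists_shear (V : Submodule k (A × B)) : ∃ s : B →ₗ[k] A,
    ((V.comap (LinearMap.inl k A B)).prod (V.map (LinearMap.snd k A B))).map
      (shear s).toLinearMap = V := by
  set X := V.map (LinearMap.snd k A B)
  let π : V →ₗ[k] X := (LinearMap.snd k A B ∘ₗ V.subtype).codRestrict X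
    (fun v => Submodule.mem_map_of_mem v.2)
  have hπ : LinearMap.range π = ⊤ := by
    rw [LinearMap.range_eq_top]
    rintro ⟨_, v, hv, rfl⟩
    exact ⟨⟨v, hv⟩, rfl⟩
  obtain ⟨σ, hσ⟩ := π.exists_rightInverse_of_surjective hπ
  obtain ⟨s, hs⟩ := LinearMap.exists_extend (LinearMap.fst k A B ∘ₗ V.subtype ∘ₗ σ)
  have key : ∀ β : X, ((s β, (β : B)) : A × B) ∈ V := by
    intro β
    have h1 : s β = (σ β : A × B).1 := LinearMap.congr_fun hs β
    have h2 : (β : B) = (σ β : A × B).2 :=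
      (congrArg Subtype.val (LinearMap.congr_fun hσ β)).symm
    rw [h1, h2]
    exact (σ β).2
  refine ⟨s, Submodule.ext fun v => ?_⟩
  rw [mem_map_shear]
  constructor
  · rintro ⟨h1, h2⟩
    have := V.add_mem h1 (key ⟨v.2, h2⟩)
    simpa using this
  · intro hv
    have h2 : v.2 ∈ X := Submodule.mem_map_of_mem (f := LinearMap.snd k A B) hv
    refine ⟨?_, h2⟩
    have := V.sub_mem hv (key ⟨v.2, h2⟩)
    have e : v - (s v.2, v.2) = LinearMap.inl k A B (v.1 - s v.2) := by
      ext <;> simp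
    rw [e] at this
    exact this

theorem comap_inl_map_shear (U : Submodule k A) (X : Submodule k B) (s : B →ₗ[k] A) :
    ((U.prod X).map (shear s).toLinearMap).comap (LinearMap.inl k A B) = U := by
  ext v
  rw [Submodule.mem_comap, mem_map_shear]
  simp

theorem map_snd_map_shear (U : Submodule k A) (X : Submodule k B) (s : B →ₗ[k] A) :
    ((U.prod X).map (shear s).toLinearMap).map (LinearMap.snd k A B) = X := by
  ext β
  constructor
  · rintro ⟨v, hv, rfl⟩
    exact ((mem_map_shear U X s v).1 hv).2
  · intro hβ
    exact ⟨(s β, β), (mem_map_shear U X s _).2 ⟨by simp, hβ⟩, rfl⟩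

/-- The linear maps sending `X` into `U`. -/
def homInto (U : Submodule k A) (X : Submodule k B) : Submodule k (B →ₗ[k] A) where
  carrier := {h | ∀ β ∈ X, h β ∈ U}
  add_mem' := fun h h' β hβ => U.add_mem (h β hβ) (h' β hβ)
  zero_mem' := fun _ _ => U.zero_mem
  smul_mem' := fun c _ h β hβ => U.smul_mem c (h β hβ)

theorem map_shear_eq_iff (U : Submodule k A) (X : Submodule k B) (s t : B →ₗ[k] A) :
    (U.prod X).map (shear s).toLinearMap = (U.prod X).map (shear t).toLinearMap
      ↔ s - t ∈ homInto U X := by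
  constructor
  · intro h β hβ
    have h1 : ((s β, β) : A × B) ∈ (U.prod X).map (shear s).toLinearMap :=
      (mem_map_shear U X s _).2 ⟨by simp, hβ⟩
    rw [h, mem_map_shear] at h1
    exact h1.1
  · intro h
    ext v
    rw [mem_map_shear, mem_map_shear]
    refine and_congr_left fun hv => ?_
    have := h v.2 hv
    rw [LinearMap.sub_apply] at this
    have e : v.1 - t v.2 = v.1 - s v.2 + (s v.2 - t v.2) := by abel
    rw [e]
    exact (U.add_mem_iff_left this).symm

/-- The maps induced by `h ∈ homInto U X` on `X` and on the quotients. -/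
def homIntoParts (U : Submodule k A) (X : Submodule k B) :
    homInto U X →+ (X →ₗ[k] U) × ((B ⧸ X) →ₗ[k] (A ⧸ U)) where
  toFun h := (h.1.restrict h.2, X.mapQ U h.1 h.2)
  map_zero' := by
    ext v
    · rfl
    · rfl
  map_add' h h' := by
    ext v
    · rfl
    · rfl

/-- A retraction of B onto X and a section of A → A/U assemble prescribed parts into one map. -/
theorem homIntoParts_surjective (U : Submodule k A) (X : Submodule k B) :
    Function.Surjective (homIntoParts U X) := by
  rintro ⟨h₁, h₂⟩
  obtain ⟨r, hr⟩ := X.subtype.exists_leftInverse_of_injective X.ker_subtype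
  obtain ⟨σ, hσ⟩ := U.mkQ.exists_rightInverse_of_surjective (Submodule.range_mkQ U)
  have hr' : ∀ β : X, r β = β := fun β => LinearMap.congr_fun hr β
  have hσ' : ∀ q, U.mkQ (σ q) = q := fun q => LinearMap.congr_fun hσ q
  let h : B →ₗ[k] A := U.subtype ∘ₗ h₁ ∘ₗ r + σ ∘ₗ h₂ ∘ₗ X.mkQ
  have hX : ∀ β : X, h β = h₁ β := by
    intro β
    have : X.mkQ (β : B) = 0 := by rw [← LinearMap.mem_ker, X.ker_mkQ]; exact β.2
    change (h₁ (r β) : A) + σ (h₂ (X.mkQ β)) = h₁ β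
    rw [this, hr', map_zero, map_zero, add_zero]
  refine ⟨⟨h, fun β hβ => ?_⟩, Prod.ext ?_ ?_⟩
  · rw [hX ⟨β, hβ⟩]; exact (h₁ _).2
  · ext β
    exact hX β
  · apply LinearMap.ext
    intro q
    obtain ⟨β, rfl⟩ := X.mkQ_surjective q
    change U.mkQ ((h₁ (r β) : A) + σ (h₂ (X.mkQ β))) = h₂ (X.mkQ β)
    rw [map_add, hσ']
    have : U.mkQ (h₁ (r β) : A) = 0 := by rw [← LinearMap.mem_ker, U.ker_mkQ]; exact (h₁ _).2
    rw [this, zero_add]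

variable [Finite A] [Finite B]

-- Orbit and stabiliser: Hom(B, A) acts by shears, transitively on the V with V ∩ A = U and image X
-- in B (`exists_shear`), and the stabiliser of U × X is `homInto U X`.
open Classical in
theorem card_shear_fiber (U : Submodule k A) (X : Submodule k B) :
    (Finset.univ.filter fun V : Submodule k (A × B) =>
      V.comap (LinearMap.inl k A B) = U ∧ V.map (LinearMap.snd k A B) = X).card
      * (Finset.univ.filter fun h : B →ₗ[k] A => h ∈ homInto U X).card
      = Fintype.card (B →ₗ[k] A) := by
  rw [← Finset.card_univ, Finset.card_eq_sum_card_fiberwise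
    (s := (Finset.univ : Finset (B →ₗ[k] A))) (f := fun s : B →ₗ[k] A => (U.prod X).map (shear s).toLinearMap)
    (t := Finset.univ.filter fun V : Submodule k (A × B) =>
      V.comap (LinearMap.inl k A B) = U ∧ V.map (LinearMap.snd k A B) = X)
    (fun s _ => Finset.mem_coe.2 (Finset.mem_filter.2 ⟨Finset.mem_univ _, comap_inl_map_shear U X s,
      map_snd_map_shear U X s⟩))]
  rw [Finset.sum_congr rfl (g := fun _ =>
    (Finset.univ.filter fun h : B →ₗ[k] A => h ∈ homInto U X).card), Finset.sum_const, smul_eq_mul]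
  intro V hV
  obtain ⟨h1, h2⟩ := (Finset.mem_filter.1 hV).2
  obtain ⟨t, ht⟩ := exists_shear V
  rw [h1, h2] at ht
  refine Finset.card_bij' (fun s _ => s - t) (fun h _ => h + t) ?_ ?_ ?_ ?_
  · intro s hs
    have hs := (Finset.mem_filter.1 hs).2
    rw [← ht] at hs
    exact Finset.mem_filter.2 ⟨Finset.mem_univ _, (map_shear_eq_iff U X s t).1 hs⟩
  · intro h hh
    have hh := (Finset.mem_filter.1 hh).2
    refine Finset.mem_filter.2 ⟨Finset.mem_univ _, ?_⟩
    rw [← ht]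
    refine (map_shear_eq_iff U X _ t).2 ?_
    simpa using hh
  · intro s _; simp
  · intro s _; simp

theorem expect_prodAt_shear (f g : ClassFun k) (a : End k A) (b : End k B) (s : B →ₗ[k] A)
    (V : Submodule k (A × B)) :
    Finset.expect Finset.univ
        (fun h : B →ₗ[k] A => prodAt f g (tri a h b) (V.map (shear s).toLinearMap))
      = Finset.expect Finset.univ (fun h : B →ₗ[k] A => prodAt f g (tri a h b) V) := by
  rw [← expect_add_right (s ∘ₗ b - a ∘ₗ s)]
  exact Finset.expect_congr rfl fun h _ => prodAt_map f g (shear s) (shear_tri a h b s) V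

/-- On U × X and on its quotient A/U × B/X the endomorphism is again block triangular, and the
off-diagonal blocks are the two parts of h. -/
theorem prodAt_tri_prod (f g : ClassFun k) (a : End k A) (b : End k B) (U : Inv a) (X : Inv b)
    (h : homInto U.1 X.1) :
    prodAt f g (tri a h.1 b) (U.1.prod X.1)
      = ev f (tri (subE a U) (homIntoParts U.1 X.1 h).1 (subE b X))
        * ev g (tri (quotE a U) (homIntoParts U.1 X.1 h).2 (quotE b X)) := by
  have hst : U.1.prod X.1 ≤ (U.1.prod X.1).comap (tri a h.1 b) := by
    rintro ⟨α, β⟩ ⟨hα, hβ⟩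
    exact ⟨U.1.add_mem (U.2 hα) (h.2 β hβ), X.2 hβ⟩
  rw [prodAt, dif_pos hst]
  congr 1
  · refine IsSubquot.ev_eq hst (isSubquot_subE _ ⟨_, hst⟩) ?_ f
    refine ⟨((LinearMap.fst k A B ∘ₗ (U.1.prod X.1).subtype).codRestrict U.1 (fun v => v.2.1)).prod
      ((LinearMap.snd k A B ∘ₗ (U.1.prod X.1).subtype).codRestrict X.1 (fun v => v.2.2)), ?_,
      fun v => ?_, fun v v' hv => ?_⟩
    · rintro ⟨α, β⟩
      exact ⟨⟨(α, β), α.2, β.2⟩, rfl⟩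
    · rw [Submodule.mem_bot]
      exact ⟨fun h => Prod.ext (congrArg (fun w => (w.1 : A)) h) (congrArg (fun w => (w.2 : B)) h),
        fun h => Prod.ext (Subtype.ext (congrArg Prod.fst h)) (Subtype.ext (congrArg Prod.snd h))⟩
    · ext
      · exact congrArg Prod.fst hv
      · exact congrArg Prod.snd hv
  · refine IsSubquot.ev_eq (B := ⊤) (by simp) (isSubquot_quotE _ ⟨_, hst⟩) ?_ g
    refine ⟨(U.1.mkQ.prodMap X.1.mkQ) ∘ₗ Submodule.subtype ⊤, ?_, fun v => ?_, fun v v' hv => ?_⟩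
    · rintro ⟨q, q'⟩
      obtain ⟨α, rfl⟩ := U.1.mkQ_surjective q
      obtain ⟨β, rfl⟩ := X.1.mkQ_surjective q'
      exact ⟨⟨(α, β), trivial⟩, rfl⟩
    · simp [Prod.ext_iff]
    · rw [LinearMap.comp_apply, Submodule.subtype_apply, hv]
      rfl

-- All V in the fibre have the same average, since a shear moves V to U × X. There only h in
-- `homInto` contribute, and its two parts are independent and uniformly distributed because
-- `homIntoParts` is a surjective homomorphism. The size of the fibre times that of `homInto` is
-- |Hom(B, A)|, so the normalising constants cancel.
open Classical in
theorem sum_shear_fiber (f g : ClassFun k) (a : End k A) (b : End k B) (U : Inv a) (X : Inv b) :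
    (∑ V : Submodule k (A × B) with
        V.comap (LinearMap.inl k A B) = U.1 ∧ V.map (LinearMap.snd k A B) = X.1,
      Finset.expect Finset.univ (fun h : B →ₗ[k] A => prodAt f g (tri a h b) V))
    = Finset.expect Finset.univ (fun h => ev f (tri (subE a U) h (subE b X)))
        * Finset.expect Finset.univ (fun h => ev g (tri (quotE a U) h (quotE b X))) := by
  rw [← expect_prod_mul]
  have e1 := expect_comp_surjective (homIntoParts U.1 X.1) (homIntoParts_surjective U.1 X.1)
    (fun h => ev f (tri (subE a U) h.1 (subE b X)) * ev g (tri (quotE a U) h.2 (quotE b X)))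
  rw [← e1, Finset.expect_congr rfl (fun h _ => (prodAt_tri_prod f g a b U X h).symm)]
  have e2 : ∀ V ∈ Finset.univ.filter (fun V : Submodule k (A × B) =>
        V.comap (LinearMap.inl k A B) = U.1 ∧ V.map (LinearMap.snd k A B) = X.1),
      Finset.expect Finset.univ (fun h : B →ₗ[k] A => prodAt f g (tri a h b) V)
        = Finset.expect Finset.univ
          (fun h : B →ₗ[k] A => prodAt f g (tri a h b) (U.1.prod X.1)) := by
    intro V hV
    obtain ⟨h1, h2⟩ := (Finset.mem_filter.1 hV).2
    obtain ⟨s, hs⟩ := exists_shear V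
    rw [h1, h2] at hs
    rw [← hs, expect_prodAt_shear]
  rw [Finset.sum_congr rfl e2, Finset.sum_const, nsmul_eq_mul, Fintype.expect_eq_sum_div_card,
    Fintype.expect_eq_sum_div_card, ← card_shear_fiber U.1 X.1]
  have e3 : ∑ h : B →ₗ[k] A, prodAt f g (tri a h b) (U.1.prod X.1)
      = ∑ h : homInto U.1 X.1, prodAt f g (tri a h.1 b) (U.1.prod X.1) := by
    rw [← Finset.sum_filter_of_ne (p := fun h => h ∈ homInto U.1 X.1)]
    · exact Finset.sum_subtype _ (fun h => by simp)
        (fun h => prodAt f g (tri a h b) (U.1.prod X.1))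
    · intro h _ hne
      by_contra hh
      -- Stability of U × X forces h to send X into U, as one sees on the vectors (0, β).
      refine hne (dif_neg fun hst => hh fun β hβ => ?_)
      have := (hst (x := ((0 : A), β)) ⟨U.1.zero_mem, hβ⟩).1
      simpa [tri_apply] using this
  have e4 : (Finset.univ.filter fun h : B →ₗ[k] A => h ∈ homInto U.1 X.1).card
      = Fintype.card (homInto U.1 X.1) := (Fintype.card_subtype _).symm
  have e5 : ((Finset.univ.filter fun V : Submodule k (A × B) =>
      V.comap (LinearMap.inl k A B) = U.1 ∧ V.map (LinearMap.snd k A B) = X.1).card : ℂ) ≠ 0 := by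
    rw [Nat.cast_ne_zero]
    intro h0
    have := card_shear_fiber U.1 X.1
    rw [h0, zero_mul] at this
    exact Fintype.card_ne_zero this.symm
  rw [e3, e4, Nat.cast_mul, ← mul_div_assoc, mul_div_mul_left _ _ e5]

end Mackey

/-! ### The Mackey formula -/

section MackeyFormula

variable [Fintype k] {A : Type u} [AddCommGroup A] [Module k A] [Finite A]

/-- The Mackey formula for the restriction of a product. -/
theorem del_mul (a : End k A) (f g : ClassFun k) :
    del a (mul f g) = ∑ U : Inv a, mul (del (subE a U) f) (del (quotE a U) g) := by
  classical
  refine classFun_ext fun B _ _ _ b => ?_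
  rw [ev_del, ev_sum]
  simp_rw [ev_mul_eq_sum_prodAt f g]
  rw [Finset.expect_sum_comm]
  -- Subspaces V of A × B are sorted by U = V ∩ A and then by their image X in B. If U or X is not
  -- stable, then neither is V, and the contribution is zero.
  rw [← Finset.sum_fiberwise Finset.univ
    (fun V : Submodule k (A × B) => V.comap (LinearMap.inl k A B)), sum_inv_eq a]
  · refine Finset.sum_congr rfl fun U _ => ?_
    rw [← Finset.sum_fiberwise _
      (fun V : Submodule k (A × B) => V.map (LinearMap.snd k A B)), sum_inv_eq b]
    · rw [ev_mul]
      refine Finset.sum_congr rfl fun X _ => ?_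
      rw [Finset.filter_filter, sum_shear_fiber, ev_del, ev_del]
    · intro X hX
      refine Finset.sum_eq_zero fun V hV => Finset.expect_eq_zero fun h _ => dif_neg fun hst => hX ?_
      obtain rfl := (Finset.mem_filter.1 hV).2
      rintro _ ⟨v, hv, rfl⟩
      exact ⟨_, hst hv, rfl⟩
  · intro U hU
    refine Finset.sum_eq_zero fun V hV => Finset.expect_eq_zero fun h _ => dif_neg fun hst => hU ?_
    obtain rfl := (Finset.mem_filter.1 hV).2
    intro α hα
    have := hst hα
    rw [Submodule.mem_comap, tri_apply] at this
    simpa using this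

end MackeyFormula

end

section

variable {k : Type u} [Field k]

/-! ### Flags, their nilpotent radicals and the alternating sum -/

section Flags

variable {W W' : Type*} [AddCommGroup W] [Module k W] [AddCommGroup W'] [Module k W']

/-- Flags of subspaces, as finite chains containing the zero subspace and the whole space. -/
def IsFlag (C : Finset (Submodule k W)) : Prop :=
  ⊥ ∈ C ∧ ⊤ ∈ C ∧ IsChain (· ≤ ·) (C : Set (Submodule k W))

/-- The endomorphism `x` preserves every member of `C`. -/
def FlagStable (C : Finset (Submodule k W)) (x : End k W) : Prop := ∀ A ∈ C, A ≤ A.comap x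

/-- The endomorphisms that send every member of the flag `C` to the preceding one. -/
def flagNil (C : Finset (Submodule k W)) : Submodule k (End k W) where
  -- Letting D range over all subspaces above the smaller members of C avoids naming the predecessor
  -- of A. For A = ⊥ the condition is empty.
  carrier := {y | ∀ A ∈ C, ∀ D : Submodule k W, (∀ B ∈ C, B < A → B ≤ D) → A ≤ D.comap y}
  add_mem' := fun hy hy' A hA D hD _ hw => D.add_mem (hy A hA D hD hw) (hy' A hA D hD hw)
  zero_mem' := fun _ _ D _ _ _ => D.zero_mem
  smul_mem' := fun c _ hy A hA D hD _ hw => D.smul_mem c (hy A hA D hD hw)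

theorem mem_flagNil {C : Finset (Submodule k W)} {y : End k W} : y ∈ flagNil C ↔
    ∀ A ∈ C, ∀ D : Submodule k W, (∀ B ∈ C, B < A → B ≤ D) → A ≤ D.comap y := Iff.rfl

/-- The image of a flag under an isomorphism. -/
def flagMap (e : W ≃ₗ[k] W') (C : Finset (Submodule k W)) : Finset (Submodule k W') :=
  C.map (Submodule.orderIsoMapComap e).toEquiv.toEmbedding

theorem mem_flagMap {e : W ≃ₗ[k] W'} {C : Finset (Submodule k W)} {A : Submodule k W'} :
    A ∈ flagMap e C ↔ ∃ B ∈ C, B.map e.toLinearMap = A := by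
  simp only [flagMap, Finset.mem_map]
  rfl

theorem map_mem_flagMap (e : W ≃ₗ[k] W') {C : Finset (Submodule k W)} {A : Submodule k W} :
    A.map e.toLinearMap ∈ flagMap e C ↔ A ∈ C := by
  rw [mem_flagMap]
  constructor
  · rintro ⟨B, hB, h⟩
    rwa [← Submodule.map_injective_of_injective e.injective h]
  · exact fun h => ⟨A, h, rfl⟩

theorem card_flagMap (e : W ≃ₗ[k] W') (C : Finset (Submodule k W)) :
    (flagMap e C).card = C.card := Finset.card_map _

theorem flagMap_trans {W'' : Type*} [AddCommGroup W''] [Module k W''] (e : W ≃ₗ[k] W')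
    (e' : W' ≃ₗ[k] W'') (C : Finset (Submodule k W)) :
    flagMap e' (flagMap e C) = flagMap (e.trans e') C := by
  ext A
  rw [mem_flagMap, mem_flagMap]
  constructor
  · rintro ⟨B, hB, rfl⟩
    obtain ⟨D, hD, rfl⟩ := mem_flagMap.1 hB
    exact ⟨D, hD, (Submodule.map_comp _ _ _)⟩
  · rintro ⟨D, hD, rfl⟩
    exact ⟨D.map e.toLinearMap, (map_mem_flagMap e).2 hD, (Submodule.map_comp _ _ _).symm⟩

theorem flagMap_refl (C : Finset (Submodule k W)) : flagMap (LinearEquiv.refl k W) C = C := by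
  ext A
  rw [mem_flagMap]
  constructor
  · rintro ⟨B, hB, rfl⟩
    simpa using hB
  · exact fun h => ⟨A, h, Submodule.map_id A⟩

theorem flagMap_symm_flagMap (e : W ≃ₗ[k] W') (C : Finset (Submodule k W)) :
    flagMap e.symm (flagMap e C) = C := by
  rw [flagMap_trans, LinearEquiv.self_trans_symm, flagMap_refl]

theorem flagMap_flagMap_symm (e : W ≃ₗ[k] W') (C : Finset (Submodule k W')) :
    flagMap e (flagMap e.symm C) = C := by
  rw [flagMap_trans, LinearEquiv.symm_trans_self, flagMap_refl]

theorem IsFlag.map (e : W ≃ₗ[k] W') {C : Finset (Submodule k W)} (h : IsFlag C) :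
    IsFlag (flagMap e C) := by
  obtain ⟨h1, h2, h3⟩ := h
  refine ⟨mem_flagMap.2 ⟨⊥, h1, Submodule.map_bot _⟩, mem_flagMap.2 ⟨⊤, h2, ?_⟩, ?_⟩
  · rw [Submodule.map_top, LinearEquiv.range]
  · intro A hA A' hA' _
    obtain ⟨B, hB, rfl⟩ := mem_flagMap.1 hA
    obtain ⟨B', hB', rfl⟩ := mem_flagMap.1 hA'
    rcases h3.total hB hB' with h | h
    · exact Or.inl (Submodule.map_mono h)
    · exact Or.inr (Submodule.map_mono h)

theorem FlagStable.map {e : W ≃ₗ[k] W'} {C : Finset (Submodule k W)} {x : End k W} {x' : End k W'}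
    (he : ∀ w, e (x w) = x' (e w)) (h : FlagStable C x) : FlagStable (flagMap e C) x' := by
  intro A hA
  obtain ⟨B, hB, rfl⟩ := mem_flagMap.1 hA
  rintro _ ⟨w, hw, rfl⟩
  exact ⟨x w, h B hB hw, he w⟩

theorem symm_intertwine {e : W ≃ₗ[k] W'} {x : End k W} {x' : End k W'}
    (he : ∀ w, e (x w) = x' (e w)) (w : W') : e.symm (x' w) = x (e.symm w) := by
  rw [LinearEquiv.symm_apply_eq, he, LinearEquiv.apply_symm_apply]

theorem flagStable_flagMap_iff {e : W ≃ₗ[k] W'} {C : Finset (Submodule k W)} {x : End k W}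
    {x' : End k W'} (he : ∀ w, e (x w) = x' (e w)) :
    FlagStable (flagMap e C) x' ↔ FlagStable C x := by
  refine ⟨fun h => ?_, FlagStable.map he⟩
  have := h.map (symm_intertwine he)
  rwa [flagMap_symm_flagMap] at this

theorem flagNil_map {e : W ≃ₗ[k] W'} {C : Finset (Submodule k W)} {x : End k W} {x' : End k W'}
    (he : ∀ w, e (x w) = x' (e w)) (h : x ∈ flagNil C) : x' ∈ flagNil (flagMap e C) := by
  intro A hA D hD
  obtain ⟨B, hB, rfl⟩ := mem_flagMap.1 hA
  rintro _ ⟨w, hw, rfl⟩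
  have := h B hB (D.comap e.toLinearMap) (fun B' hB' hlt => Submodule.map_le_iff_le_comap.1
    (hD _ ((map_mem_flagMap e).2 hB') (Submodule.map_strictMono_of_injective e.injective hlt))) hw
  change x' (e w) ∈ D
  rw [← he]
  exact this

theorem flagNil_flagMap_iff {e : W ≃ₗ[k] W'} {C : Finset (Submodule k W)} {x : End k W}
    {x' : End k W'} (he : ∀ w, e (x w) = x' (e w)) :
    x' ∈ flagNil (flagMap e C) ↔ x ∈ flagNil C := by
  refine ⟨fun h => ?_, flagNil_map he⟩
  have := flagNil_map (symm_intertwine he) h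
  rwa [flagMap_symm_flagMap] at this

variable [Finite W] [Finite W']

instance fintypeFlagNil (C : Finset (Submodule k W)) : Fintype (flagNil C) := Fintype.ofFinite _

open Classical in
/-- The average of `φ` over `x + flagNil C` if `x` preserves the flag `C`, and zero otherwise. -/
def flagTerm (φ : End k W → ℂ) (x : End k W) (C : Finset (Submodule k W)) : ℂ :=
  if FlagStable C x then Finset.expect Finset.univ (fun y : flagNil C => φ (x + y)) else 0

theorem conj_intertwine (e : W ≃ₗ[k] W') (x : End k W) (w : W) : e (x w) = e.conj x (e w) := by
  simp [LinearEquiv.conj_apply]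

theorem flagTerm_map (e : W ≃ₗ[k] W') {φ : End k W → ℂ} {φ' : End k W' → ℂ}
    (hφ : ∀ y, φ y = φ' (e.conj y)) (x : End k W) (C : Finset (Submodule k W)) :
    flagTerm φ' (e.conj x) (flagMap e C) = flagTerm φ x C := by
  unfold flagTerm
  by_cases h : FlagStable C x
  · rw [if_pos h, if_pos ((flagStable_flagMap_iff (conj_intertwine e x)).2 h)]
    refine (Fintype.expect_equiv (e.conj.toEquiv.subtypeEquiv fun y =>
      (flagNil_flagMap_iff (conj_intertwine e y)).symm) _ _ fun y => ?_).symm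
    rw [hφ, map_add]
    rfl
  · rw [if_neg h, if_neg (fun h' => h ((flagStable_flagMap_iff (conj_intertwine e x)).1 h'))]

open Classical in
/-- The alternating sum over all flags of the averages of `φ`. -/
def flagSum (φ : End k W → ℂ) (x : End k W) : ℂ :=
  -- A flag with c members has c - 1 blocks, so the exponent c + 1 has the parity of the number of
  -- blocks.
  ∑ C : Finset (Submodule k W) with IsFlag C, (-1 : ℂ) ^ (C.card + 1) * flagTerm φ x C

theorem flagSum_conj (e : W ≃ₗ[k] W') {φ : End k W → ℂ} {φ' : End k W' → ℂ}
    (hφ : ∀ y, φ y = φ' (e.conj y)) (x : End k W) :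
    flagSum φ' (e.conj x) = flagSum φ x := by
  classical
  refine (Finset.sum_bij' (fun C _ => flagMap e C) (fun C _ => flagMap e.symm C) ?_ ?_ ?_ ?_ ?_).symm
  · intro C hC
    exact Finset.mem_filter.2 ⟨Finset.mem_univ _, (Finset.mem_filter.1 hC).2.map e⟩
  · intro C hC
    exact Finset.mem_filter.2 ⟨Finset.mem_univ _, (Finset.mem_filter.1 hC).2.map e.symm⟩
  · intro C _; exact flagMap_symm_flagMap e C
  · intro C _; exact flagMap_flagMap_symm e C
  · intro C _; rw [card_flagMap, flagTerm_map e hφ]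

end Flags

/-! ### Splitting off the least non-zero member of a flag -/

section LiftFlag

variable {W : Type*} [AddCommGroup W] [Module k W]

open Classical in
/-- The flag of `W` whose least non-zero member is `V` given by a flag of `W ⧸ V`. -/
def liftFlag (V : Submodule k W) (C : Finset (Submodule k (W ⧸ V))) : Finset (Submodule k W) :=
  insert ⊥ (C.map (Submodule.comapMkQOrderEmbedding V).toEmbedding)

theorem mem_liftFlag {V : Submodule k W} {C : Finset (Submodule k (W ⧸ V))} {A : Submodule k W} :
    A ∈ liftFlag V C ↔ A = ⊥ ∨ ∃ A' ∈ C, A'.comap V.mkQ = A := by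
  simp only [liftFlag, Finset.mem_insert, Finset.mem_map]
  rfl

theorem le_comap_mkQ' (V : Submodule k W) (A : Submodule k (W ⧸ V)) : V ≤ A.comap V.mkQ :=
  Submodule.le_comap_mkQ V A

theorem comap_mkQ_le_iff {V : Submodule k W} {A B : Submodule k (W ⧸ V)} :
    A.comap V.mkQ ≤ B.comap V.mkQ ↔ A ≤ B :=
  (Submodule.comapMkQOrderEmbedding V).le_iff_le

theorem comap_mkQ_lt_iff {V : Submodule k W} {A B : Submodule k (W ⧸ V)} :
    A.comap V.mkQ < B.comap V.mkQ ↔ A < B :=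
  (Submodule.comapMkQOrderEmbedding V).lt_iff_lt

theorem comap_mkQ_injective (V : Submodule k W) :
    Function.Injective (fun A : Submodule k (W ⧸ V) => A.comap V.mkQ) :=
  (Submodule.comapMkQOrderEmbedding V).injective

theorem comap_mkQ_ne_bot {V : Submodule k W} (hV : V ≠ ⊥) (A : Submodule k (W ⧸ V)) :
    A.comap V.mkQ ≠ ⊥ := fun h => hV (le_bot_iff.1 (h ▸ le_comap_mkQ' V A))

theorem comap_mkQ_bot (V : Submodule k W) : (⊥ : Submodule k (W ⧸ V)).comap V.mkQ = V := V.ker_mkQ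

theorem comap_mkQ_mem_liftFlag {V : Submodule k W} (hV : V ≠ ⊥)
    {C : Finset (Submodule k (W ⧸ V))} {A : Submodule k (W ⧸ V)} :
    A.comap V.mkQ ∈ liftFlag V C ↔ A ∈ C := by
  rw [mem_liftFlag]
  constructor
  · rintro (h | ⟨A', hA', h⟩)
    · exact absurd h (comap_mkQ_ne_bot hV A)
    · rwa [← comap_mkQ_injective V h]
  · exact fun h => Or.inr ⟨A, h, rfl⟩

theorem card_liftFlag {V : Submodule k W} (hV : V ≠ ⊥) (C : Finset (Submodule k (W ⧸ V))) :
    (liftFlag V C).card = C.card + 1 := by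
  classical
  rw [liftFlag, Finset.card_insert_of_notMem, Finset.card_map]
  rw [Finset.mem_map]
  rintro ⟨A, _, h⟩
  exact comap_mkQ_ne_bot hV A h

theorem IsFlag.lift {V : Submodule k W} {C : Finset (Submodule k (W ⧸ V))} (h : IsFlag C) :
    IsFlag (liftFlag V C) := by
  obtain ⟨h1, h2, h3⟩ := h
  refine ⟨mem_liftFlag.2 (Or.inl rfl), mem_liftFlag.2 (Or.inr ⟨⊤, h2, Submodule.comap_top _⟩), ?_⟩
  intro A hA A' hA' _
  rcases mem_liftFlag.1 hA with rfl | ⟨B, hB, rfl⟩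
  · exact Or.inl bot_le
  rcases mem_liftFlag.1 hA' with rfl | ⟨B', hB', rfl⟩
  · exact Or.inr bot_le
  exact (h3.total hB hB').imp comap_mkQ_le_iff.2 comap_mkQ_le_iff.2

theorem le_of_mem_liftFlag {V : Submodule k W} {C : Finset (Submodule k (W ⧸ V))}
    {A : Submodule k W} (hA : A ∈ liftFlag V C) (h : A ≠ ⊥) : V ≤ A := by
  rcases mem_liftFlag.1 hA with rfl | ⟨B, hB, rfl⟩
  · exact absurd rfl h
  · exact le_comap_mkQ' V B

-- A flag of a non-zero space has a least non-zero member V, and the flags with this V correspond to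
-- the flags of W/V.
open Classical in
theorem sum_isFlag [Finite W] [Nontrivial W] {M : Type*} [AddCommMonoid M]
    (Φ : Finset (Submodule k W) → M) :
    ∑ C : Finset (Submodule k W) with IsFlag C, Φ C
      = ∑ V : Submodule k W with V ≠ ⊥,
          ∑ C : Finset (Submodule k (W ⧸ V)) with IsFlag C, Φ (liftFlag V C) := by
  rw [Finset.sum_sigma']
  symm
  refine Finset.sum_bij (fun p _ => liftFlag p.1 p.2) ?_ ?_ ?_ ?_
  · rintro ⟨V, C⟩ h
    simp only [Finset.mem_sigma, Finset.mem_filter, Finset.mem_univ, true_and] at h ⊢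
    exact h.2.lift
  · rintro ⟨V, C⟩ h ⟨V', C'⟩ h' heq
    simp only [Finset.mem_sigma, Finset.mem_filter, Finset.mem_univ, true_and] at h h' heq
    have hV : V ∈ liftFlag V C := mem_liftFlag.2 (Or.inr ⟨⊥, h.2.1, comap_mkQ_bot V⟩)
    have hV' : V' ∈ liftFlag V' C' := mem_liftFlag.2 (Or.inr ⟨⊥, h'.2.1, comap_mkQ_bot V'⟩)
    obtain rfl : V = V' := le_antisymm (le_of_mem_liftFlag (heq ▸ hV') h'.1)
      (le_of_mem_liftFlag (heq ▸ hV) h.1)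
    congr 1
    ext A
    rw [← comap_mkQ_mem_liftFlag h.1, heq, comap_mkQ_mem_liftFlag h.1]
  · intro C hC
    obtain ⟨h1, h2, h3⟩ := (Finset.mem_filter.1 hC).2
    have hne : (C.erase ⊥).Nonempty := ⟨⊤, Finset.mem_erase.2 ⟨top_ne_bot, h2⟩⟩
    obtain ⟨V, hV⟩ := (C.erase ⊥).exists_minimal hne
    obtain ⟨hV0, hVC⟩ := Finset.mem_erase.1 hV.1
    have hmin : ∀ A ∈ C, A ≠ ⊥ → V ≤ A := by
      intro A hA hA0
      rcases h3.total hVC hA with h | h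
      · exact h
      · exact hV.2 (Finset.mem_erase.2 ⟨hA0, hA⟩) h
    refine ⟨⟨V, Finset.univ.filter fun A => A.comap V.mkQ ∈ C⟩, ?_, ?_⟩
    · simp only [Finset.mem_sigma, Finset.mem_filter, Finset.mem_univ, true_and]
      refine ⟨hV0, ?_, ?_, ?_⟩
      · simpa using hVC
      · simpa using h2
      · intro A hA A' hA' _
        simp only [Finset.coe_filter, Finset.mem_univ, true_and, Set.mem_ofPred_eq] at hA hA'
        exact (h3.total hA hA').imp comap_mkQ_le_iff.1 comap_mkQ_le_iff.1
    · ext A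
      simp only [mem_liftFlag, Finset.mem_filter, Finset.mem_univ, true_and]
      constructor
      · rintro (rfl | ⟨A', hA', rfl⟩)
        · exact h1
        · exact hA'
      · intro hA
        by_cases hA0 : A = ⊥
        · exact Or.inl hA0
        · have : (A.map V.mkQ).comap V.mkQ = A := by
            rw [Submodule.comap_map_mkQ, sup_eq_right]
            exact hmin A hA hA0
          exact Or.inr ⟨A.map V.mkQ, by rwa [this], this⟩
  · intro p _; rfl

theorem flagStable_liftFlag_iff {V : Submodule k W} {C : Finset (Submodule k (W ⧸ V))}
    (x : End k W) (hV : V ≤ V.comap x) :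
    FlagStable (liftFlag V C) x ↔ FlagStable C (V.mapQ V x hV) := by
  constructor
  · intro h A hA q hq
    obtain ⟨w, rfl⟩ := V.mkQ_surjective q
    exact h _ (mem_liftFlag.2 (Or.inr ⟨A, hA, rfl⟩)) (x := w) hq
  · intro h A hA
    rcases mem_liftFlag.1 hA with rfl | ⟨B, hB, rfl⟩
    · exact bot_le
    · intro w hw
      exact h B hB (x := V.mkQ w) hw

theorem flagNil_liftFlag_vanish {V : Submodule k W} {C : Finset (Submodule k (W ⧸ V))}
    (hC : IsFlag C) {y : End k W} (hy : y ∈ flagNil (liftFlag V C)) {v : W} (hv : v ∈ V) :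
    y v = 0 := by
  refine hy V (mem_liftFlag.2 (Or.inr ⟨⊥, hC.1, comap_mkQ_bot V⟩)) ⊥ (fun B hB hlt => ?_) hv
  by_contra h
  exact absurd (le_of_mem_liftFlag hB (fun h' => h (h'.le))) (not_le_of_gt hlt)

theorem flagNil_of_quot {V : Submodule k W} {C : Finset (Submodule k (W ⧸ V))} (hC : IsFlag C)
    (hV : V ≠ ⊥) {y : End k W} (hy : ∀ v ∈ V, y v = 0) {y' : End k (W ⧸ V)} (hy' : y' ∈ flagNil C)
    (hyy' : ∀ w, V.mkQ (y w) = y' (V.mkQ w)) : y ∈ flagNil (liftFlag V C) := by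
  intro A hA D hD w hw
  rcases mem_liftFlag.1 hA with rfl | ⟨A', hA', rfl⟩
  · have hw0 : w = 0 := hw
    rw [hw0]; exact Submodule.zero_mem _
  by_cases hA0 : A' = ⊥
  · rw [hA0, comap_mkQ_bot] at hw
    rw [Submodule.mem_comap, hy w hw]; exact D.zero_mem
  -- For a member strictly above V every admissible D contains V, hence is the inverse image of its
  -- image in W/V.
  · have hVD : V ≤ D := by
      refine hD V (mem_liftFlag.2 (Or.inr ⟨⊥, hC.1, comap_mkQ_bot V⟩)) ?_
      have := comap_mkQ_lt_iff.2 (bot_lt_iff_ne_bot.2 hA0)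
      rwa [comap_mkQ_bot] at this
    have hD' : (D.map V.mkQ).comap V.mkQ = D := by
      rw [Submodule.comap_map_mkQ, sup_eq_right]; exact hVD
    have := hy' A' hA' (D.map V.mkQ) (fun B hB hlt => by
      rw [← comap_mkQ_le_iff, hD']
      exact hD _ ((comap_mkQ_mem_liftFlag hV).2 hB) (comap_mkQ_lt_iff.2 hlt)) hw
    rw [Submodule.mem_comap, ← hD', Submodule.mem_comap, hyy']
    exact this

theorem flagNil_quot {V : Submodule k W} {C : Finset (Submodule k (W ⧸ V))}
    {y : End k W} (hy : y ∈ flagNil (liftFlag V C)) (hV : V ≤ V.comap y) :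
    V.mapQ V y hV ∈ flagNil C := by
  intro A hA D hD q hq
  obtain ⟨w, rfl⟩ := V.mkQ_surjective q
  refine hy _ (mem_liftFlag.2 (Or.inr ⟨A, hA, rfl⟩)) (D.comap V.mkQ) (fun B hB hlt => ?_) hq
  rcases mem_liftFlag.1 hB with rfl | ⟨B', hB', rfl⟩
  · exact bot_le
  · exact comap_mkQ_le_iff.2 (hD B' hB' (comap_mkQ_lt_iff.1 hlt))

/-- Passing to the quotient by the least non-zero member of a flag. -/
def flagNilQuot {V : Submodule k W} {C : Finset (Submodule k (W ⧸ V))} (hC : IsFlag C) :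
    flagNil (liftFlag V C) →+ flagNil C where
  toFun y := ⟨V.mapQ V y.1 (fun v hv => by
      rw [Submodule.mem_comap, flagNil_liftFlag_vanish hC y.2 hv]; exact V.zero_mem),
    flagNil_quot y.2 _⟩
  map_zero' := by
    apply Subtype.ext
    ext v
    rfl
  map_add' y y' := by
    apply Subtype.ext
    ext v
    rfl

theorem flagNilQuot_surjective {V : Submodule k W} {C : Finset (Submodule k (W ⧸ V))}
    (hC : IsFlag C) (hV : V ≠ ⊥) : Function.Surjective (flagNilQuot hC) := by
  rintro ⟨y', hy'⟩
  obtain ⟨s, hs⟩ := V.mkQ.exists_rightInverse_of_surjective (Submodule.range_mkQ V)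
  have hs' : ∀ q, V.mkQ (s q) = q := fun q => LinearMap.congr_fun hs q
  refine ⟨⟨s ∘ₗ y' ∘ₗ V.mkQ, flagNil_of_quot hC hV (fun v hv => ?_) hy' fun w => hs' _⟩, ?_⟩
  · have : V.mkQ v = 0 := by rw [← LinearMap.mem_ker, V.ker_mkQ]; exact hv
    rw [LinearMap.comp_apply, LinearMap.comp_apply, this, map_zero, map_zero]
  · apply Subtype.ext
    apply LinearMap.ext
    intro q
    obtain ⟨w, rfl⟩ := V.mkQ_surjective q
    exact hs' _

end LiftFlag

/-! ### The antipode and its recursion -/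

section Dual

variable [Fintype k] {W : Type u} [AddCommGroup W] [Module k W] [Finite W]

/-- Transitivity of restriction. The kernel of `flagNilQuot` is never computed: the maps W → W/V → V
lie in the nilpotent radical of the lifted flag, so averaging over them as well changes nothing, and
together with the surjection onto `flagNil C` this yields the iterated average. -/
theorem flagTerm_liftFlag (f : ClassFun k) (x : End k W) (V : Inv x) (hV : V.1 ≠ ⊥)
    {C : Finset (Submodule k (W ⧸ V.1))} (hC : IsFlag C) :
    flagTerm (ev f) x (liftFlag V.1 C) = flagTerm (ev (del (subE x V) f)) (quotE x V) C := by
  unfold flagTerm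
  by_cases h : FlagStable C (quotE x V)
  swap
  · rw [if_neg h, if_neg fun h' => h ((flagStable_liftFlag_iff x V.2).1 h')]
  rw [if_pos h, if_pos ((flagStable_liftFlag_iff x V.2).2 h)]
  rw [← expect_comp_surjective (flagNilQuot hC) (flagNilQuot_surjective hC hV)
    (fun y => ev (del (subE x V) f) (quotE x V + y.1))]
  have e1 : ∀ y : flagNil (liftFlag V.1 C),
      ev (del (subE x V) f) (quotE x V + (flagNilQuot hC y).1)
        = Finset.expect Finset.univ (fun h : (W ⧸ V.1) →ₗ[k] V.1 =>
            ev f (x + y.1 + V.1.subtype ∘ₗ h ∘ₗ V.1.mkQ)) := by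
    intro y
    have hy : ∀ v ∈ V.1, y.1 v = 0 := fun v hv => flagNil_liftFlag_vanish hC y.2 hv
    have hVy : V.1 ≤ V.1.comap (x + y.1) := by
      intro v hv
      rw [Submodule.mem_comap, LinearMap.add_apply, hy v hv, add_zero]
      exact V.2 hv
    have e2 := ev_del_quotE f (x + y.1) ⟨V.1, hVy⟩
    have e3 : subE (x + y.1) ⟨V.1, hVy⟩ = subE x V := by
      ext v
      change x v + y.1 v = x v
      rw [hy v v.2, add_zero]
    have e4 : quotE (x + y.1) ⟨V.1, hVy⟩ = quotE x V + (flagNilQuot hC y).1 := by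
      apply LinearMap.ext
      intro q
      obtain ⟨w, rfl⟩ := V.1.mkQ_surjective q
      rfl
    rw [e3, e4] at e2
    exact e2
  rw [Finset.expect_congr rfl (fun y _ => e1 y), Finset.expect_comm]
  have e5 : ∀ h : (W ⧸ V.1) →ₗ[k] V.1,
      Finset.expect Finset.univ (fun y : flagNil (liftFlag V.1 C) =>
        ev f (x + y.1 + V.1.subtype ∘ₗ h ∘ₗ V.1.mkQ))
      = Finset.expect Finset.univ (fun y : flagNil (liftFlag V.1 C) => ev f (x + y.1)) := by
    intro h
    have hmem : V.1.subtype ∘ₗ h ∘ₗ V.1.mkQ ∈ flagNil (liftFlag V.1 C) := by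
      refine flagNil_of_quot hC hV (fun v hv => ?_) (flagNil C).zero_mem fun w => ?_
      · have : V.1.mkQ v = 0 := by rw [← LinearMap.mem_ker, V.1.ker_mkQ]; exact hv
        rw [LinearMap.comp_apply, LinearMap.comp_apply, this, map_zero, map_zero]
      · exact (Submodule.Quotient.mk_eq_zero V.1).2 (h _).2
    refine Eq.trans ?_ (expect_add_right (⟨_, hmem⟩ : flagNil (liftFlag V.1 C))
      (fun y => ev f (x + y.1)))
    refine Finset.expect_congr rfl fun y _ => ?_
    rw [add_assoc]
    rfl
  rw [Finset.expect_congr rfl (fun h _ => e5 h), Fintype.expect_const]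

/-- The value at `x` of the (unsigned) dual of `f`. -/
def dualFun (f : ClassFun k) (W : Type u) [AddCommGroup W] [Module k W] [Finite W]
    (x : End k W) : ℂ := flagSum (ev f) x

theorem dualFun_congr (f : ClassFun k) (W W' : Type u) [AddCommGroup W] [Module k W] [Finite W]
    [AddCommGroup W'] [Module k W'] [Finite W'] (x : End k W) (x' : End k W') (h : Conj x x') :
    dualFun f W x = dualFun f W' x' := by
  obtain ⟨e, he⟩ := h
  have : x' = e.conj x := by
    ext w
    rw [LinearEquiv.conj_apply_apply, he, LinearEquiv.apply_symm_apply]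
  rw [this]
  exact (flagSum_conj e (fun y => ev_congr f (conj_conj e y)) x).symm

/-- The alternating sum of the composites of Harish-Chandra restriction and induction, where the
sign of a parabolic subgroup is given by its number of blocks. -/
def dual : ClassFun k →ₗ[ℂ] ClassFun k where
  toFun f := mkClass (dualFun f) (dualFun_congr f)
  map_add' f g := by
    refine classFun_ext fun W _ _ _ x => ?_
    rw [ev_add, ev_mkClass, ev_mkClass, ev_mkClass]
    simp only [dualFun, flagSum, ← Finset.sum_add_distrib]
    refine Finset.sum_congr rfl fun C _ => ?_
    rw [← mul_add]
    congr 1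
    unfold flagTerm
    split_ifs
    · rw [← Finset.expect_add_distrib]; rfl
    · rw [add_zero]
  map_smul' c f := by
    refine classFun_ext fun W _ _ _ x => ?_
    rw [RingHom.id_apply, ev_smul, ev_mkClass, ev_mkClass]
    simp only [dualFun, flagSum, Finset.mul_sum]
    refine Finset.sum_congr rfl fun C _ => ?_
    rw [mul_left_comm]
    congr 1
    unfold flagTerm
    split_ifs
    · rw [Finset.mul_expect]; rfl
    · rw [mul_zero]

theorem ev_dual (f : ClassFun k) (x : End k W) : ev (dual f) x = flagSum (ev f) x :=
  ev_mkClass (dualFun f) (dualFun_congr f) x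

-- Sort the flags by their least non-zero member V. By transitivity each class sums to a dual on
-- W/V, and the minus sign arises because the lifted flag has one member more.
open Classical in
theorem ev_dual_rec [Nontrivial W] (f : ClassFun k) (x : End k W) :
    ev (dual f) x = - ∑ V : Inv x with V.1 ≠ ⊥, ev (dual (del (subE x V) f)) (quotE x V) := by
  rw [ev_dual, flagSum, sum_isFlag, Finset.sum_filter, sum_inv_eq x, Finset.sum_filter,
    ← Finset.sum_neg_distrib]
  · refine Finset.sum_congr rfl fun V _ => ?_
    by_cases hV : V.1 ≠ ⊥
    · rw [if_pos hV, if_pos hV, ev_dual, flagSum, ← Finset.sum_neg_distrib]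
      refine Finset.sum_congr rfl fun C hC => ?_
      rw [flagTerm_liftFlag f x V hV (Finset.mem_filter.1 hC).2, card_liftFlag hV]
      ring
    · rw [if_neg hV, if_neg hV, neg_zero]
  · intro V hV
    split_ifs with h
    · refine Finset.sum_eq_zero fun C hC => ?_
      rw [flagTerm, if_neg, mul_zero]
      intro h'
      exact hV (h' V (mem_liftFlag.2 (Or.inr ⟨⊥, (Finset.mem_filter.1 hC).2.1, comap_mkQ_bot V⟩)))
    · rfl

theorem del_of_subsingleton {A : Type u} [AddCommGroup A] [Module k A] [Finite A]
    [Subsingleton A] (a : End k A) (f : ClassFun k) : del a f = f := by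
  refine classFun_ext fun W _ _ _ x => ?_
  rw [ev_del]
  have : ∀ h : W →ₗ[k] A, ev f (tri a h x) = ev f x := by
    intro h
    refine ev_congr f ⟨LinearEquiv.ofBijective (LinearMap.snd k A W) ⟨?_, ?_⟩, fun _ => rfl⟩
    · intro v v' hv
      exact Prod.ext (Subsingleton.elim _ _) hv
    · exact fun w => ⟨(0, w), rfl⟩
  rw [Finset.expect_congr rfl fun h _ => this h, Fintype.expect_const]

theorem ev_of_subsingleton [Subsingleton W] (f : ClassFun k) (x : End k W) :
    ev f x = (f 0).1 0 := by
  rw [ev_eq_toMatrix f (Basis.empty W (ι := Fin 0))]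
  exact congrArg (f 0).1 (Subsingleton.elim _ _)

theorem ev_dual_of_subsingleton [Subsingleton W] (f : ClassFun k) (x : End k W) :
    ev (dual f) x = (f 0).1 0 := by
  classical
  have : Subsingleton (Submodule k W) := Submodule.subsingleton_iff k |>.2 inferInstance
  have hC : ∀ C : Finset (Submodule k W), IsFlag C ↔ C = {⊥} := by
    intro C
    constructor
    · intro h
      ext A
      rw [Subsingleton.elim A ⊥]
      simp [h.1]
    · rintro rfl
      refine ⟨by simp, by simp [Subsingleton.elim ⊤ (⊥ : Submodule k W)], by simp⟩
  rw [ev_dual, flagSum, Finset.filter_congr (fun C _ => hC C), Finset.filter_eq',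
    if_pos (Finset.mem_univ _), Finset.sum_singleton, flagTerm, if_pos]
  · have : ∀ y : flagNil ({⊥} : Finset (Submodule k W)), ev f (x + y.1) = (f 0).1 0 :=
      fun y => ev_of_subsingleton f _
    rw [Finset.expect_congr rfl fun y _ => this y, Fintype.expect_const]
    simp
  · intro A _ w _
    rw [Subsingleton.elim w 0]; exact Submodule.zero_mem _

theorem conj_quotE_bot (x : End k W) : Conj (quotE x ⊥) x :=
  (isSubquot_quotE x ⊥).conj (by simp) (isSubquot_self x)

instance (x : End k W) : Subsingleton (⊥ : Inv x).1 :=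
  inferInstanceAs (Subsingleton (⊥ : Submodule k W))

-- The antipode identity m ∘ (id ⊗ S) ∘ Δ = ε. The term V = ⊥ is S(f)(x), and for W ≠ 0 the
-- recursion makes the other terms cancel it.
open Classical in
theorem sum_ev_dual_del (f : ClassFun k) (x : End k W) :
    ∑ V : Inv x, ev (dual (del (subE x V) f)) (quotE x V)
      = if Subsingleton W then (f 0).1 0 else 0 := by
  have hbot : ev (dual (del (subE x ⊥) f)) (quotE x ⊥) = ev (dual f) x := by
    rw [del_of_subsingleton, ev_congr _ (conj_quotE_bot x)]
  rw [← Finset.add_sum_erase _ _ (Finset.mem_univ (⊥ : Inv x)), hbot]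
  split_ifs with h
  · rw [ev_dual_of_subsingleton, Finset.sum_eq_zero, add_zero]
    intro V hV
    refine absurd (Subtype.ext ?_) (Finset.mem_erase.1 hV).1
    have : Subsingleton (Submodule k W) := Submodule.subsingleton_iff k |>.2 inferInstance
    exact Subsingleton.elim _ _
  · have : Nontrivial W := not_subsingleton_iff_nontrivial.1 h
    have e : (Finset.univ.filter fun V : Inv x => V.1 ≠ ⊥) = Finset.univ.erase ⊥ := by
      ext V
      simp only [Finset.mem_filter, Finset.mem_univ, true_and, Finset.mem_erase, and_true]
      exact not_congr (Subtype.ext_iff (a2 := (⊥ : Inv x))).symm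
    rw [ev_dual_rec, e, neg_add_cancel]

end Dual

end

section

variable {k : Type u} [Field k]

/-! ### The antipode reverses products -/

section Antihom

variable [Fintype k] {W : Type u} [AddCommGroup W] [Module k W] [Finite W]

theorem subsingleton_subquot_iff (x : End k W) {U Z : Inv x} (h : U.1 ≤ Z.1) :
    Subsingleton (Z.1 ⧸ U.1.submoduleOf Z.1) ↔ U = Z := by
  rw [Submodule.Quotient.subsingleton_iff, Submodule.submoduleOf_eq_top]
  exact ⟨fun h' => Subtype.ext (le_antisymm h h'), fun h' => h' ▸ le_rfl⟩

open Classical in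
theorem sum_ev_dual_del_sq (f : ClassFun k) (x : End k W) {U Z : Inv x} (h : U.1 ≤ Z.1) :
    ∑ V : Inv x with U.1 ≤ V.1 ∧ V.1 ≤ Z.1, ev (dual (del (sq x U V) f)) (sq x V Z)
      = if U = Z then (f 0).1 0 else 0 := by
  have e := sum_ev_dual_del f (sq x U Z)
  simp only [subsingleton_subquot_iff x h] at e
  rw [← e]
  symm
  refine (isSubquot_sq x U Z).sum_inv Z.2 h _ _ fun V' V h1 h2 => ?_
  rw [h2.ev_eq Z.2 (isSubquot_sq x V Z), del_congr (h1.conj V.2 (isSubquot_sq x U V))]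

open Classical in
theorem del_subE_mul (x : End k W) (V : Inv x) (f g : ClassFun k) :
    del (subE x V) (mul f g) = ∑ U : Inv x with (⊥ : Inv x).1 ≤ U.1 ∧ U.1 ≤ V.1,
      mul (del (sq x ⊥ U) f) (del (sq x U V) g) := by
  rw [del_mul]
  refine (isSubquot_subE x V).sum_inv V.2 bot_le _ _ fun U' U h1 h2 => ?_
  rw [del_congr (h1.conj U.2 (isSubquot_sq x ⊥ U)), del_congr (h2.conj V.2 (isSubquot_sq x U V))]

theorem ev_mul_of_subsingleton [Subsingleton W] (f g : ClassFun k) (x : End k W) :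
    ev (mul f g) x = (f 0).1 0 * (g 0).1 0 := by
  have : Subsingleton (Submodule k W) := Submodule.subsingleton_iff k |>.2 inferInstance
  rw [ev_mul, Fintype.sum_eq_single ⊥ (fun V hV => absurd (Subtype.ext (Subsingleton.elim _ _)) hV)]
  have : Subsingleton (W ⧸ (⊥ : Inv x).1) := Quotient.instSubsingletonQuotient _
  rw [ev_of_subsingleton, ev_of_subsingleton]

theorem apply_zero_dual (f : ClassFun k) : (dual f 0).1 0 = (f 0).1 0 := by
  rw [← ev_of_subsingleton (dual f) (0 : End k PUnit.{u+1}), ev_dual_of_subsingleton]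

/-- Induction on dim W. The recursion, the Mackey formula on V and the induction hypothesis on W/V
turn S(fg)(x) into a sum over U ≤ V ≤ Z with V ≠ 0. Summing over V first, the antipode identity for
g leaves the terms U = Z, corrected by the missing V = 0. The former vanish by the antipode identity
for f; the correction is S(g)S(f). -/
theorem ev_dual_mul (n : ℕ) : ∀ (W : Type u) [AddCommGroup W] [Module k W] [Finite W]
    (f g : ClassFun k) (x : End k W), finrank k W = n →
    ev (dual (mul f g)) x = ev (mul (dual g) (dual f)) x := by
  classical
  induction n using Nat.strong_induction_on with
  | _ n ih =>
  intro W _ _ _ f g x hn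
  rcases subsingleton_or_nontrivial W with hW | hW
  · rw [ev_dual_of_subsingleton, ev_mul_of_subsingleton, apply_zero_dual, apply_zero_dual,
      ← ev_of_subsingleton (mul f g) x, ev_mul_of_subsingleton, mul_comm]
  set a : Inv x → Inv x → Inv x → ℂ := fun U V Z => ev (dual (del (sq x U V) g)) (sq x V Z)
    with ha
  set b : Inv x → Inv x → ℂ := fun U Z => ev (dual (del (sq x ⊥ U) f)) (sq x Z ⊤) with hb
  have h1 : ∀ V : Inv x, V.1 ≠ ⊥ → ev (dual (del (subE x V) (mul f g))) (quotE x V)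
      = ∑ U : Inv x with (⊥ : Inv x).1 ≤ U.1 ∧ U.1 ≤ V.1,
        ∑ Z : Inv x with V.1 ≤ Z.1 ∧ Z.1 ≤ (⊤ : Inv x).1, a U V Z * b U Z := by
    intro V hV
    rw [del_subE_mul, map_sum, ev_sum]
    refine Finset.sum_congr rfl fun U _ => ?_
    have hlt : finrank k (W ⧸ V.1) < n := by
      have h2 := Submodule.finrank_quotient_add_finrank V.1
      have h3 : 0 < finrank k V.1 := Submodule.one_le_finrank_iff.2 hV
      omega
    rw [ih _ hlt (W ⧸ V.1) _ _ _ rfl]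
    exact (isSubquot_quotE x V).ev_mul (B := ⊤) _ _ le_top
  -- The sum over all V in [U, Z] is the antipode identity for g on Z/U. The excluded V = ⊥ lies in
  -- the interval only if U = ⊥.
  have h2 : ∀ U Z : Inv x, (∑ V : Inv x,
      if V.1 ≠ ⊥ ∧ U.1 ≤ V.1 ∧ V.1 ≤ Z.1 then a U V Z else 0)
      = (if U = Z then (g 0).1 0 else 0) - if U = ⊥ then a ⊥ ⊥ Z else 0 := by
    intro U Z
    have e1 : ∀ V : Inv x, (if V.1 ≠ ⊥ ∧ U.1 ≤ V.1 ∧ V.1 ≤ Z.1 then a U V Z else 0)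
        = (if U.1 ≤ V.1 ∧ V.1 ≤ Z.1 then a U V Z else 0)
          - if V = ⊥ then (if U = ⊥ then a ⊥ ⊥ Z else 0) else 0 := by
      intro V
      by_cases hV : V = ⊥
      · subst hV
        have h3 : U.1 ≤ (⊥ : Inv x).1 ↔ U = ⊥ :=
          ⟨fun h => Subtype.ext (le_bot_iff.1 h), fun h => h ▸ le_rfl⟩
        have h4 : (⊥ : Inv x).1 ≤ Z.1 := bot_le
        rw [if_neg (fun h => h.1 rfl)]
        by_cases h6 : U = ⊥
        · subst h6
          rw [if_pos ⟨le_rfl, h4⟩, if_pos rfl, if_pos rfl, sub_self]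
        · rw [if_neg (fun h => h6 (h3.1 h.1)), if_pos rfl, if_neg h6, sub_zero]
      · have h3 : V.1 ≠ ⊥ := fun h => hV (Subtype.ext h)
        simp [h3, hV]
    rw [Finset.sum_congr rfl (fun V _ => e1 V), Finset.sum_sub_distrib, Finset.sum_ite_eq',
      if_pos (Finset.mem_univ _), ← Finset.sum_filter]
    by_cases hUZ : U.1 ≤ Z.1
    · rw [sum_ev_dual_del_sq g x hUZ]
    · have h3 : U ≠ Z := fun h => hUZ (h ▸ le_rfl)
      rw [if_neg h3, Finset.sum_eq_zero]
      intro V hV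
      exact absurd ((Finset.mem_filter.1 hV).2.1.trans (Finset.mem_filter.1 hV).2.2) hUZ
  have h3 : ev (dual (mul f g)) x = - ∑ U : Inv x, ∑ Z : Inv x, (∑ V : Inv x,
      if V.1 ≠ ⊥ ∧ U.1 ≤ V.1 ∧ V.1 ≤ Z.1 then a U V Z else 0) * b U Z := by
    rw [ev_dual_rec, Finset.sum_congr rfl (fun V hV => h1 V (Finset.mem_filter.1 hV).2)]
    congr 1
    simp only [Finset.sum_filter, Finset.sum_mul]
    rw [Finset.sum_congr rfl (fun U _ => Finset.sum_comm), Finset.sum_comm]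
    refine Finset.sum_congr rfl fun V _ => ?_
    by_cases hV : V.1 ≠ ⊥
    · rw [if_pos hV]
      refine Finset.sum_congr rfl fun U _ => ?_
      by_cases hU : U.1 ≤ V.1
      · rw [if_pos ⟨bot_le, hU⟩]
        refine Finset.sum_congr rfl fun Z _ => ?_
        by_cases hZ : V.1 ≤ Z.1
        · rw [if_pos ⟨hZ, le_top⟩, if_pos ⟨hV, hU, hZ⟩]
        · rw [if_neg (fun h => hZ h.1), if_neg (fun h => hZ h.2.2), zero_mul]
      · rw [if_neg (fun h => hU h.2)]
        symm
        refine Finset.sum_eq_zero fun Z _ => ?_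
        rw [if_neg (fun h => hU h.2.1), zero_mul]
    · rw [if_neg hV]
      symm
      refine Finset.sum_eq_zero fun U _ => Finset.sum_eq_zero fun Z _ => ?_
      rw [if_neg (fun h => hV h.1), zero_mul]
  -- The terms with U = Z form the antipode identity for f on W, which is non-zero here.
  have h4 : ∑ U : Inv x, b U U = 0 := by
    have e := sum_ev_dual_del_sq f x (U := ⊥) (Z := ⊤) bot_le
    have h5 : (⊥ : Inv x) ≠ ⊤ := fun h => bot_ne_top (α := Submodule k W) (Subtype.ext_iff.1 h)
    rw [if_neg h5, Finset.filter_true_of_mem (fun V _ => ⟨bot_le, le_top⟩)] at e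
    exact e
  rw [h3, (isSubquot_self x).ev_mul (A := ⊥) (B := ⊤) (dual g) (dual f) bot_le,
    Finset.filter_true_of_mem (fun V _ => ⟨bot_le, le_top⟩)]
  simp only [h2, sub_mul, Finset.sum_sub_distrib, ite_mul, zero_mul, Finset.sum_ite_eq,
    Finset.mem_univ, if_true]
  rw [← Finset.mul_sum, h4, mul_zero, zero_sub, neg_neg]
  have h6 : ∀ U : Inv x, (∑ Z : Inv x, if U = ⊥ then a ⊥ ⊥ Z * b U Z else 0)
      = if U = ⊥ then ∑ Z, a ⊥ ⊥ Z * b U Z else 0 := by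
    intro U
    split_ifs <;> simp
  rw [Finset.sum_congr rfl (fun U _ => h6 U), Finset.sum_ite_eq', if_pos (Finset.mem_univ _)]
  refine Finset.sum_congr rfl fun Z _ => ?_
  have : Subsingleton ((⊥ : Inv x).1 ⧸ (⊥ : Inv x).1.submoduleOf (⊥ : Inv x).1) :=
    (subsingleton_subquot_iff x le_rfl).2 rfl
  simp only [ha, hb, del_of_subsingleton]

theorem dual_mul (f g : ClassFun k) : dual (mul f g) = mul (dual g) (dual f) :=
  classFun_ext fun W _ _ _ x => ev_dual_mul _ W f g x rfl

end Antihom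

end

section

variable {k : Type u} [Field k]

/-! ### Balanced forms on torsion k[X]-modules -/

section BalancedForm

open Polynomial

/-- The `k[X]`-module `M` has a `k`-bilinear form with trivial left radical for which
multiplication by `X` is self-adjoint. -/
def HasBalancedForm (k : Type*) [Field k] (M : Type*) [AddCommGroup M] [Module k[X] M] : Prop :=
  ∃ β : M → M → k, (∀ a b c, β (a + b) c = β a c + β b c) ∧ (∀ a b c, β a (b + c) = β a b + β a c) ∧
    (∀ (t : k) a b, β ((C t : k[X]) • a) b = t * β a b) ∧
    (∀ (r : k[X]) a b, β (r • a) b = β a (r • b)) ∧ ∀ a, (∀ b, β a b = 0) → a = 0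

theorem HasBalancedForm.of_equiv {M M' : Type*} [AddCommGroup M] [Module k[X] M] [AddCommGroup M']
    [Module k[X] M'] (e : M ≃ₗ[k[X]] M') (h : HasBalancedForm k M') : HasBalancedForm k M := by
  obtain ⟨β, h1, h2, h3, h4, h5⟩ := h
  refine ⟨fun a b => β (e a) (e b), fun a b c => ?_, fun a b c => ?_, fun t a b => ?_,
    fun r a b => ?_, fun a ha => ?_⟩
  · beta_reduce; rw [map_add, h1]
  · beta_reduce; rw [map_add, h2]
  · beta_reduce; rw [map_smul, h3]
  · beta_reduce; rw [map_smul, map_smul, h4]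
  · refine e.map_eq_zero_iff.1 (h5 _ fun b => ?_)
    have := ha (e.symm b)
    beta_reduce at this
    rwa [e.apply_symm_apply] at this

theorem HasBalancedForm.directSum {ι : Type*} [Fintype ι] (M : ι → Type*)
    [∀ i, AddCommGroup (M i)] [∀ i, Module k[X] (M i)] (h : ∀ i, HasBalancedForm k (M i)) :
    HasBalancedForm k (DirectSum ι M) := by
  classical
  choose β h1 h2 h3 h4 h5 using h
  refine ⟨fun a b => ∑ i, β i (a i) (b i), fun a b c => ?_, fun a b c => ?_, fun t a b => ?_,
    fun r a b => ?_, fun a ha => ?_⟩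
  · simp only [DirectSum.add_apply, h1, Finset.sum_add_distrib]
  · simp only [DirectSum.add_apply, h2, Finset.sum_add_distrib]
  · simp only [DirectSum.smul_apply, h3, Finset.mul_sum]
  · simp only [DirectSum.smul_apply, h4]
  · have hz : ∀ i (m : M i), β i m 0 = 0 := fun i m => by
      have := h2 i m 0 0
      rw [add_zero] at this
      simpa using this
    refine DFinsupp.ext fun i => h5 i _ fun b => ?_
    have := ha (DirectSum.of M i b)
    beta_reduce at this
    rw [Finset.sum_eq_single i] at this
    · rwa [DirectSum.of_eq_same] at this
    · intro j _ hj
      rw [DirectSum.of_eq_of_ne _ _ _ hj, hz]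
    · intro hi
      exact absurd (Finset.mem_univ i) hi

/-- Let p be the monic associate of q and d its degree. The form sends (a, b) to the coefficient of
X^(d-1) in ab mod p. A non-zero remainder of degree e pairs with X^(d-1-e) to its leading
coefficient, so the radical is trivial. -/
theorem hasBalancedForm_quotient {q : k[X]} (hq : q ≠ 0) :
    HasBalancedForm k (k[X] ⧸ Submodule.span k[X] {q}) := by
  set p := q * C q.leadingCoeff⁻¹ with hp
  have hpm : p.Monic := monic_mul_leadingCoeff_inv hq
  have hpq : p ∣ q := ⟨C q.leadingCoeff, by
    rw [hp, mul_assoc, ← C_mul, inv_mul_cancel₀ (leadingCoeff_ne_zero.2 hq), C_1, mul_one]⟩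
  have hqp : q ∣ p := ⟨_, hp⟩
  let d := p.natDegree
  let l : k[X] →ₗ[k] k := lcoeff k (d - 1) ∘ₗ modByMonicHom p
  have hl0 : ∀ a, p ∣ a → l a = 0 := by
    intro a ha
    change (a %ₘ p).coeff (d - 1) = 0
    rw [(modByMonic_eq_zero_iff_dvd hpm).2 ha, coeff_zero]
  let I := Submodule.span k[X] {q}
  have hI : ∀ a b : k[X], (Submodule.Quotient.mk a : k[X] ⧸ I) = Submodule.Quotient.mk b →
      p ∣ a - b := by
    intro a b hab
    rw [Submodule.Quotient.eq] at hab
    exact hpq.trans (Ideal.mem_span_singleton.1 hab)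
  have hout : ∀ m : k[X] ⧸ I, Submodule.Quotient.mk (Quotient.out m) = m :=
    fun m => Quotient.out_eq m
  -- The form is defined through chosen representatives; as `l` kills the multiples of p, any others
  -- give the same value.
  have key : ∀ (m m' : k[X] ⧸ I) (a b : k[X]), Submodule.Quotient.mk a = m →
      Submodule.Quotient.mk b = m' → l (Quotient.out m * Quotient.out m') = l (a * b) := by
    intro m m' a b ha hb
    rw [← sub_eq_zero, ← map_sub]
    have h1 := hI _ _ ((hout m).trans ha.symm)
    have h2 := hI _ _ ((hout m').trans hb.symm)
    have e : Quotient.out m * Quotient.out m' - a * b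
        = (Quotient.out m - a) * Quotient.out m' + a * (Quotient.out m' - b) := by ring
    rw [e]
    exact hl0 _ (dvd_add (h1.mul_right _) (h2.mul_left _))
  refine ⟨fun m m' => l (Quotient.out m * Quotient.out m'), fun a b c => ?_, fun a b c => ?_,
    fun t a b => ?_, fun r a b => ?_, fun a ha => ?_⟩
  · beta_reduce
    rw [key (a + b) c (Quotient.out a + Quotient.out b) (Quotient.out c)
      (by rw [Submodule.Quotient.mk_add, hout, hout]) (hout c), add_mul, map_add]
  · beta_reduce
    rw [key a (b + c) (Quotient.out a) (Quotient.out b + Quotient.out c) (hout a)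
      (by rw [Submodule.Quotient.mk_add, hout, hout]), mul_add, map_add]
  · beta_reduce
    rw [key (C t • a) b (C t * Quotient.out a) (Quotient.out b)
      (by rw [← smul_eq_mul, Submodule.Quotient.mk_smul, hout]) (hout b), mul_assoc,
      ← smul_eq_C_mul, map_smul, smul_eq_mul]
  · beta_reduce
    rw [key (r • a) b (r * Quotient.out a) (Quotient.out b)
      (by rw [← smul_eq_mul, Submodule.Quotient.mk_smul, hout]) (hout b),
      key a (r • b) (Quotient.out a) (r * Quotient.out b) (hout a)
      (by rw [← smul_eq_mul, Submodule.Quotient.mk_smul, hout])]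
    congr 1
    ring
  · set f := Quotient.out a with hf
    set r := f %ₘ p with hr
    by_cases hr0 : r = 0
    · rw [← hout a, ← hf, Submodule.Quotient.mk_eq_zero]
      exact Ideal.mem_span_singleton.2 (hqp.trans ((modByMonic_eq_zero_iff_dvd hpm).1 hr0))
    · exfalso
      have hdeg : r.natDegree < d := natDegree_lt_natDegree hr0 (degree_modByMonic_lt f hpm)
      set j := d - 1 - r.natDegree with hj
      have h1 := ha (Submodule.Quotient.mk (X ^ j))
      beta_reduce at h1
      rw [key a _ f (X ^ j) (hout a) rfl] at h1
      have h2 : (f * X ^ j) %ₘ p = r * X ^ j := by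
        have h3 : p ∣ f * X ^ j - r * X ^ j := by
          rw [← sub_mul]
          refine Dvd.dvd.mul_right ?_ _
          rw [hr]
          exact ⟨f /ₘ p, by rw [sub_eq_iff_eq_add', modByMonic_add_div]⟩
        have h4 : (f * X ^ j) %ₘ p = (r * X ^ j) %ₘ p := by
          rw [← sub_eq_zero, ← sub_modByMonic]
          exact (modByMonic_eq_zero_iff_dvd hpm).2 h3
        rw [h4, modByMonic_eq_self_iff hpm]
        refine degree_lt_degree ?_
        rw [natDegree_mul_X_pow j hr0]
        omega
      change ((f * X ^ j) %ₘ p).coeff (d - 1) = 0 at h1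
      rw [h2] at h1
      have h5 : d - 1 = r.natDegree + j := by omega
      rw [h5, coeff_mul_X_pow] at h1
      exact hr0 (leadingCoeff_eq_zero.1 h1)

/-- The structure theorem over k[X] reduces this to cyclic modules. -/
theorem hasBalancedForm_aeval {W : Type u} [AddCommGroup W] [Module k W] [Module.Finite k W]
    (x : End k W) : HasBalancedForm k (Module.AEval' x) := by
  obtain ⟨ι, hι, p, hp, e, ⟨E⟩⟩ := Module.equiv_directSum_of_isTorsion (R := k[X])
    (M := Module.AEval' x) (Module.AEval.isTorsion_of_finiteDimensional k W x)
  exact HasBalancedForm.of_equiv E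
    (HasBalancedForm.directSum _ fun i => hasBalancedForm_quotient (pow_ne_zero _ (hp i).ne_zero))

end BalancedForm

/-! ### Transposition and commutativity of the product -/

section Transpose

variable {W : Type u} [AddCommGroup W] [Module k W]

/-- An endomorphism of a finite-dimensional space is conjugate to its transpose. -/
theorem conj_dualMap [Module.Finite k W] (x : End k W) : Conj x x.dualMap := by
  obtain ⟨β, h1, h2, h3, h4, h5⟩ := hasBalancedForm_aeval x
  let o := Module.AEval'.of x
  have hC : ∀ (t : k) w, o (t • w) = (Polynomial.C t : Polynomial k) • o w := fun t w => by
    rw [map_smul, Module.AEval.C_smul]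
  have hX : ∀ w, o (x w) = (Polynomial.X : Polynomial k) • o w := fun w =>
    (Module.AEval'.X_smul_of x w).symm
  -- Read as a map W → W*, the form intertwines x with its transpose. It is injective, hence
  -- bijective by dimension.
  let E : W →ₗ[k] Dual k W := LinearMap.mk₂ k (fun v w => β (o v) (o w))
    (fun v v' w => by rw [map_add, h1]) (fun t v w => by rw [hC, h3, smul_eq_mul])
    (fun v w w' => by rw [map_add, h2])
    (fun t v w => by rw [hC, ← h4, h3, smul_eq_mul])
  have hE : Function.Injective E := by
    rw [← LinearMap.ker_eq_bot, LinearMap.ker_eq_bot']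
    intro v hv
    refine o.map_eq_zero_iff.1 (h5 _ fun b => ?_)
    have := LinearMap.congr_fun hv (o.symm b)
    change β (o v) (o (o.symm b)) = 0 at this
    rwa [o.apply_symm_apply] at this
  refine ⟨E.linearEquivOfInjective hE Subspace.dual_finrank_eq.symm, fun w => ?_⟩
  ext v
  change β (o (x w)) (o v) = β (o w) (o (x v))
  rw [hX, h4, hX]

variable [Fintype k] [Finite W]

instance : Finite (Dual k W) := inferInstanceAs (Finite (W →ₗ[k] k))

/-- Annihilators match the x-stable subspaces of W with those of W* stable under the transpose. The
transpose acts on the annihilator of V as the dual of x on W/V, and on the quotient as the dual of x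
on V. Since endomorphisms are conjugate to their duals, passing to W* swaps the two factors. -/
theorem mul_comm' (f g : ClassFun k) : mul f g = mul g f := by
  refine classFun_ext fun W _ _ _ x => ?_
  rw [ev_congr _ (conj_dualMap x), ev_mul, ev_mul]
  symm
  have hst : ∀ V : Inv x, V.1.dualAnnihilator ≤ V.1.dualAnnihilator.comap x.dualMap := by
    intro V φ hφ
    rw [Submodule.mem_comap, Submodule.mem_dualAnnihilator]
    rw [Submodule.mem_dualAnnihilator] at hφ
    exact fun w hw => hφ _ (V.2 hw)
  refine Finset.sum_bij (fun V _ => ⟨V.1.dualAnnihilator, hst V⟩) (fun _ _ => Finset.mem_univ _)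
    ?_ ?_ ?_
  · intro V _ V' _ h
    exact Subtype.ext (Subspace.dualAnnihilator_inj.1 (Subtype.ext_iff.1 h))
  · intro V' _
    refine ⟨⟨V'.1.dualCoannihilator, ?_⟩, Finset.mem_univ _,
      Subtype.ext Subspace.dualCoannihilator_dualAnnihilator_eq⟩
    intro w hw
    rw [Submodule.mem_comap, Submodule.mem_dualCoannihilator]
    rw [Submodule.mem_dualCoannihilator] at hw
    exact fun φ hφ => hw (x.dualMap φ) (V'.2 hφ)
  · intro V _
    rw [mul_comm]
    congr 1
    · refine ev_congr f ((conj_dualMap (quotE x V)).trans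
        ⟨V.1.dualQuotEquivDualAnnihilator, fun φ => ?_⟩)
      apply Subtype.ext
      ext w
      rfl
    · refine ev_congr g ((conj_dualMap (subE x V)).trans
        (Conj.symm ⟨Subspace.quotAnnihilatorEquiv V.1, fun q => ?_⟩))
      obtain ⟨φ, rfl⟩ := Submodule.mkQ_surjective _ q
      ext w
      rfl

end Transpose

end

section

variable {k : Type u} [Field k] {n : ℕ}

/-! ### Invertible matrices and bases -/

section Frames

/-- The linear automorphism of `k ^ n` given by an invertible matrix. -/
def glEquiv (g : GL (Fin n) k) : (Fin n → k) ≃ₗ[k] (Fin n → k) :=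
  (Matrix.GeneralLinearGroup.toLin g).toLinearEquiv

theorem glEquiv_apply (g : GL (Fin n) k) (v : Fin n → k) : glEquiv g v = g.1 *ᵥ v := rfl

theorem coe_glEquiv (g : GL (Fin n) k) : (glEquiv g).toLinearMap = Matrix.toLin' g.1 := rfl

theorem glEquiv_mul (g h : GL (Fin n) k) : glEquiv (g * h) = (glEquiv h).trans (glEquiv g) := by
  ext v : 2
  simp [glEquiv_apply, Matrix.mulVec_mulVec]

theorem glEquiv_one : glEquiv (1 : GL (Fin n) k) = LinearEquiv.refl k _ := by
  ext v : 2
  simp [glEquiv_apply]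

theorem glEquiv_inv (g : GL (Fin n) k) : glEquiv g⁻¹ = (glEquiv g).symm := by
  apply LinearEquiv.ext
  intro v
  rw [LinearEquiv.eq_symm_apply, glEquiv_apply, glEquiv_apply, Matrix.mulVec_mulVec, Units.mul_inv,
    Matrix.one_mulVec]

theorem conj_glEquiv (g : GL (Fin n) k) (x : Matrix (Fin n) (Fin n) k) :
    (glEquiv g).conj (Matrix.toLin' x) = Matrix.toLin' (ad g x) := by
  apply LinearMap.ext
  intro v
  rw [LinearEquiv.conj_apply_apply, ← glEquiv_inv]
  simp only [glEquiv_apply, Matrix.toLin'_apply, ad, Matrix.mulVec_mulVec, mul_assoc]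

theorem exists_frame (b : Basis (Fin n) k (Fin n → k)) :
    ∃ F : GL (Fin n) k, ∀ v i, ((F⁻¹).1 *ᵥ v) i = b.repr v i := by
  refine ⟨⟨(Pi.basisFun k (Fin n)).toMatrix b, b.toMatrix (Pi.basisFun k (Fin n)),
    Basis.toMatrix_mul_toMatrix_flip _ _, Basis.toMatrix_mul_toMatrix_flip _ _⟩, fun v i => ?_⟩
  have := Basis.toMatrix_mulVec_repr (Pi.basisFun k (Fin n)) b v
  exact congrFun this i

theorem exists_basis_of_frame (F : GL (Fin n) k) :
    ∃ b : Basis (Fin n) k (Fin n → k), ∀ v i, b.repr v i = ((F⁻¹).1 *ᵥ v) i :=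
  ⟨Basis.ofEquivFun (glEquiv F⁻¹), fun _ _ => rfl⟩

end Frames

/-! ### The flag of a parabolic subgroup -/

namespace ParabolicLevi

variable (d : ParabolicLevi k n)

/-- The coordinates of a vector in the basis `d.frame`. -/
def coordVec : (Fin n → k) ≃ₗ[k] (Fin n → k) := glEquiv d.frame⁻¹

theorem coordVec_apply (v : Fin n → k) : d.coordVec v = (d.frame⁻¹).1 *ᵥ v := rfl

theorem coordVec_mulVec (x : Matrix (Fin n) (Fin n) k) (v : Fin n → k) :
    d.coordVec (x *ᵥ v) = d.coords x *ᵥ d.coordVec v := by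
  change _ = ((d.frame⁻¹).1 * x * d.frame.1) *ᵥ ((d.frame⁻¹).1 *ᵥ v)
  rw [Matrix.mulVec_mulVec, mul_assoc, Units.mul_inv, mul_one, coordVec_apply,
    Matrix.mulVec_mulVec]

/-- The members of the flag stabilised by the parabolic subgroup. -/
def fil (m : ℕ) : Submodule k (Fin n → k) where
  carrier := {v | ∀ i, m ≤ d.label i → d.coordVec v i = 0}
  add_mem' := by
    intro v w hv hw i hi
    rw [map_add, Pi.add_apply, hv i hi, hw i hi, add_zero]
  zero_mem' := by
    intro i _
    rw [map_zero, Pi.zero_apply]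
  smul_mem' := by
    intro c v hv i hi
    rw [map_smul, Pi.smul_apply, hv i hi, smul_zero]

theorem mem_fil {m : ℕ} {v : Fin n → k} :
    v ∈ d.fil m ↔ ∀ i, m ≤ d.label i → d.coordVec v i = 0 := Iff.rfl

theorem fil_mono : Monotone d.fil := fun _ _ h _ hv i hi => hv i (h.trans hi)

theorem fil_zero : d.fil 0 = ⊥ := by
  rw [eq_bot_iff]
  intro v hv
  refine (Submodule.mem_bot k).2 (d.coordVec.map_eq_zero_iff.1 ?_)
  funext i
  exact hv i (Nat.zero_le _)

theorem exists_fil_eq_top : ∃ m, d.fil m = ⊤ := by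
  refine ⟨Finset.univ.sup d.label + 1, ?_⟩
  rw [eq_top_iff]
  intro v _ i hi
  have := Finset.le_sup (f := d.label) (Finset.mem_univ i)
  omega

theorem coordVec_symm_single_mem {m : ℕ} {i : Fin n} :
    d.coordVec.symm (Pi.single i 1) ∈ d.fil m ↔ d.label i < m := by
  rw [mem_fil]
  simp only [LinearEquiv.apply_symm_apply]
  constructor
  · intro h
    by_contra hi
    have := h i (not_lt.1 hi)
    simp at this
  · intro h j hj
    rw [Pi.single_eq_of_ne]
    rintro rfl
    omega

open Classical in
/-- The flag stabilised by the parabolic subgroup. -/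
def flagOf [Finite k] : Finset (Submodule k (Fin n → k)) :=
  Finset.univ.filter fun A => ∃ m, d.fil m = A

section

variable [Finite k]

theorem mem_flagOf {A : Submodule k (Fin n → k)} : A ∈ d.flagOf ↔ ∃ m, d.fil m = A := by
  simp [flagOf]

theorem fil_mem_flagOf (m : ℕ) : d.fil m ∈ d.flagOf := d.mem_flagOf.2 ⟨m, rfl⟩

theorem isFlag_flagOf : IsFlag d.flagOf := by
  refine ⟨d.mem_flagOf.2 ⟨0, d.fil_zero⟩, d.mem_flagOf.2 d.exists_fil_eq_top, ?_⟩
  intro A hA A' hA' _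
  obtain ⟨m, rfl⟩ := d.mem_flagOf.1 hA
  obtain ⟨m', rfl⟩ := d.mem_flagOf.1 hA'
  exact (le_total m m').imp (fun h => d.fil_mono h) (fun h => d.fil_mono h)

theorem coords_apply_eq (x : Matrix (Fin n) (Fin n) k) (i j : Fin n) :
    d.coords x i j = d.coordVec (x *ᵥ d.coordVec.symm (Pi.single j 1)) i := by
  rw [coordVec_mulVec, LinearEquiv.apply_symm_apply, Matrix.mulVec_single_one]
  rfl

theorem mem_parLie_iff {x : Matrix (Fin n) (Fin n) k} :
    x ∈ d.parLie ↔ FlagStable d.flagOf (Matrix.toLin' x) := by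
  rw [mem_parLie]
  constructor
  · intro h A hA v hv
    obtain ⟨m, rfl⟩ := d.mem_flagOf.1 hA
    intro i hi
    rw [Matrix.toLin'_apply, coordVec_mulVec]
    change ∑ j, d.coords x i j * d.coordVec v j = 0
    refine Finset.sum_eq_zero fun j _ => ?_
    rcases lt_or_ge (d.label j) (d.label i) with hj | hj
    · rw [h i j hj, zero_mul]
    · rw [hv j (hi.trans hj), mul_zero]
  · intro h i j hij
    rw [coords_apply_eq]
    exact h _ (d.fil_mem_flagOf (d.label j + 1)) (d.coordVec_symm_single_mem.2 (Nat.lt_succ_self _))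
      i hij

theorem mem_nilLie_iff_fil {x : Matrix (Fin n) (Fin n) k} :
    x ∈ d.nilLie ↔ ∀ m, d.fil (m + 1) ≤ (d.fil m).comap (Matrix.toLin' x) := by
  rw [mem_nilLie]
  constructor
  · intro h m v hv i hi
    rw [Matrix.toLin'_apply, coordVec_mulVec]
    change ∑ j, d.coords x i j * d.coordVec v j = 0
    refine Finset.sum_eq_zero fun j _ => ?_
    rcases le_or_gt (d.label j) (d.label i) with hj | hj
    · rw [h i j hj, zero_mul]
    · rw [hv j (by omega), mul_zero]
  · intro h i j hij
    rw [coords_apply_eq]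
    exact h (d.label j) (d.coordVec_symm_single_mem.2 (Nat.lt_succ_self _)) i hij

theorem mem_nilLie_iff {x : Matrix (Fin n) (Fin n) k} :
    x ∈ d.nilLie ↔ Matrix.toLin' x ∈ flagNil d.flagOf := by
  rw [mem_nilLie_iff_fil, mem_flagNil]
  constructor
  · intro h A hA D hD
    obtain ⟨m, rfl⟩ := d.mem_flagOf.1 hA
    induction m with
    | zero => rw [fil_zero]; exact bot_le
    | succ m ih =>
      by_cases he : d.fil m = d.fil (m + 1)
      · rw [← he]
        exact ih (d.fil_mem_flagOf m) (by rw [he]; exact hD)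
      · have hlt : d.fil m < d.fil (m + 1) := lt_of_le_of_ne (d.fil_mono (Nat.le_succ m)) he
        exact (h m).trans (Submodule.comap_mono (hD _ (d.fil_mem_flagOf m) hlt))
  · intro h m
    induction m with
    | zero =>
      refine h _ (d.fil_mem_flagOf 1) _ fun B hB hlt => ?_
      obtain ⟨j, rfl⟩ := d.mem_flagOf.1 hB
      have : j < 1 := by
        by_contra hj
        exact absurd (d.fil_mono (not_lt.1 hj)) (not_le_of_gt hlt)
      exact d.fil_mono (Nat.lt_succ_iff.1 this)
    | succ m _ =>
      refine h _ (d.fil_mem_flagOf (m + 2)) _ fun B hB hlt => ?_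
      obtain ⟨j, rfl⟩ := d.mem_flagOf.1 hB
      have : j < m + 2 := by
        by_contra hj
        exact absurd (d.fil_mono (not_lt.1 hj)) (not_le_of_gt hlt)
      exact d.fil_mono (Nat.lt_succ_iff.1 this)

/-- The filtration jumps exactly after the labels l that occur, so its non-zero members are the
distinct `fil (l + 1)`. -/
theorem card_flagOf : d.flagOf.card = (Finset.univ.image d.label).card + 1 := by
  classical
  have h1 : d.flagOf = insert ⊥ ((Finset.univ.image d.label).image fun l => d.fil (l + 1)) := by
    ext A
    rw [mem_flagOf, Finset.mem_insert]
    constructor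
    · rintro ⟨m, rfl⟩
      induction m with
      | zero => exact Or.inl d.fil_zero
      | succ m ih =>
        by_cases hm : ∃ i, d.label i = m
        · obtain ⟨i, hi⟩ := hm
          refine Or.inr (Finset.mem_image.2 ⟨m, Finset.mem_image.2 ⟨i, Finset.mem_univ _, hi⟩, rfl⟩)
        · have : d.fil (m + 1) = d.fil m := by
            refine le_antisymm (fun v hv i hi => hv i ?_) (d.fil_mono (Nat.le_succ m))
            have : d.label i ≠ m := fun h => hm ⟨i, h⟩
            omega
          rw [this]; exact ih
    · rintro (rfl | h)
      · exact ⟨0, d.fil_zero⟩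
      · obtain ⟨l, _, rfl⟩ := Finset.mem_image.1 h
        exact ⟨l + 1, rfl⟩
  rw [h1, Finset.card_insert_of_notMem, Finset.card_image_of_injOn]
  · intro l hl l' hl' he
    obtain ⟨i, _, rfl⟩ := Finset.mem_image.1 hl
    obtain ⟨i', _, rfl⟩ := Finset.mem_image.1 hl'
    have e1 := (d.coordVec_symm_single_mem (m := d.label i + 1) (i := i)).2 (Nat.lt_succ_self _)
    have e2 := (d.coordVec_symm_single_mem (m := d.label i' + 1) (i := i')).2 (Nat.lt_succ_self _)
    beta_reduce at he
    rw [he, coordVec_symm_single_mem] at e1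
    rw [← he, coordVec_symm_single_mem] at e2
    omega
  · intro h
    obtain ⟨l, hl, he⟩ := Finset.mem_image.1 h
    obtain ⟨i, _, rfl⟩ := Finset.mem_image.1 hl
    have e1 := (d.coordVec_symm_single_mem (m := d.label i + 1) (i := i)).2 (Nat.lt_succ_self _)
    rw [he, Submodule.mem_bot, LinearEquiv.map_eq_zero_iff] at e1
    have := congrFun e1 i
    simp at this

end

end ParabolicLevi

theorem IsFlag.eq_of_finrank_eq {W : Type*} [AddCommGroup W] [Module k W] [Module.Finite k W]
    {C : Finset (Submodule k W)} (hC : IsFlag C) {A A' : Submodule k W} (hA : A ∈ C) (hA' : A' ∈ C)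
    (h : finrank k A = finrank k A') : A = A' := by
  rcases hC.2.2.total hA hA' with h' | h'
  · exact Submodule.eq_of_le_of_finrank_eq h' h
  · exact (Submodule.eq_of_le_of_finrank_eq h' h.symm).symm

/-- Automorphisms preserve dimension and a flag has at most one member of each dimension, so
preserving the flag as a set is the same as preserving every member. -/
theorem IsFlag.stable_iff {W : Type*} [AddCommGroup W] [Module k W] [Module.Finite k W]
    {C : Finset (Submodule k W)} (hC : IsFlag C) (e : W ≃ₗ[k] W) :
    FlagStable C e.toLinearMap ↔ flagMap e C = C := by
  constructor
  · intro h
    have h1 : ∀ A ∈ C, A.map e.toLinearMap = A := fun A hA =>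
      Submodule.eq_of_le_of_finrank_eq (Submodule.map_le_iff_le_comap.2 (h A hA))
        (LinearEquiv.finrank_map_eq e A)
    ext A
    rw [mem_flagMap]
    constructor
    · rintro ⟨B, hB, rfl⟩
      rwa [h1 B hB]
    · exact fun hA => ⟨A, hA, h1 A hA⟩
  · intro h A hA
    have h1 : A.map e.toLinearMap ∈ C := by
      rw [← h]; exact (map_mem_flagMap e).2 hA
    have h2 := hC.eq_of_finrank_eq h1 hA (LinearEquiv.finrank_map_eq e A)
    exact Submodule.map_le_iff_le_comap.1 h2.le

namespace ParabolicLevi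

variable (d : ParabolicLevi k n) [Finite k]

theorem mem_par_iff {g : GL (Fin n) k} : g ∈ d.par ↔ flagMap (glEquiv g) d.flagOf = d.flagOf := by
  rw [mem_par, mem_parLie_iff, mem_parLie_iff, ← coe_glEquiv, ← coe_glEquiv,
    d.isFlag_flagOf.stable_iff, d.isFlag_flagOf.stable_iff]
  refine and_iff_left_of_imp fun h => ?_
  rw [glEquiv_inv]
  conv_lhs => rw [← h]
  exact flagMap_symm_flagMap _ _

theorem par_le_iff_aux {g : GL (Fin n) k} (hg : g.1 ∈ d.parLie) : g ∈ d.par := by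
  rw [mem_par_iff, ← d.isFlag_flagOf.stable_iff]
  exact d.mem_parLie_iff.1 hg

theorem coords_mul_frame (t : GL (Fin n) k) :
    d.coords (d.frame * t * d.frame⁻¹ : GL (Fin n) k).1 = t.1 := by
  change (d.frame⁻¹).1 * (d.frame.1 * t.1 * (d.frame⁻¹).1) * d.frame.1 = t.1
  simp only [mul_assoc, Units.inv_mul, mul_one]
  rw [← mul_assoc, Units.inv_mul, one_mul]

/-- A transvection in the basis of d belongs to the parabolic subgroup and changes v by its j-th
coordinate times the i-th basis vector; A contains this difference. -/
theorem single_mem_of_stable {A : Submodule k (Fin n → k)}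
    (hA : ∀ g ∈ d.par, ∀ v ∈ A, g.1 *ᵥ v ∈ A) {i j : Fin n} (hij : i ≠ j)
    (hl : d.label i ≤ d.label j) {v : Fin n → k} (hv : v ∈ A) (hvj : d.coordVec v j ≠ 0) :
    d.coordVec.symm (Pi.single i 1) ∈ A := by
  let t : GL (Fin n) k := ⟨Matrix.transvection i j 1, Matrix.transvection i j (-1),
    by rw [Matrix.transvection_mul_transvection_same _ _ hij]; simp,
    by rw [Matrix.transvection_mul_transvection_same _ _ hij]; simp⟩
  have ht : d.frame * t * d.frame⁻¹ ∈ d.par := by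
    refine d.par_le_iff_aux ?_
    rw [mem_parLie]
    intro a b hab
    rw [coords_mul_frame]
    have h1 : a ≠ b := by rintro rfl; omega
    have h2 : ¬ (i = a ∧ j = b) := by rintro ⟨rfl, rfl⟩; omega
    simp [t, Matrix.transvection, Matrix.one_apply_ne h1, Matrix.single_apply_of_ne _ _ _ _ _ h2]
  have h3 : (d.frame * t * d.frame⁻¹ : GL (Fin n) k).1 *ᵥ v
      = v + d.coordVec v j • d.coordVec.symm (Pi.single i 1) := by
    apply d.coordVec.injective
    rw [coordVec_mulVec, coords_mul_frame, map_add, map_smul, LinearEquiv.apply_symm_apply]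
    change Matrix.transvection i j 1 *ᵥ _ = _
    rw [Matrix.transvection, Matrix.add_mulVec, Matrix.one_mulVec, Matrix.single_mulVec, one_mul]
    congr 1
    ext a
    simp [Pi.single_apply, Function.update_apply]
  have h4 := hA _ ht v hv
  rw [h3, A.add_mem_iff_right hv] at h4
  exact (A.smul_mem_iff hvj).1 h4

theorem sum_coordVec (v : Fin n → k) :
    v = ∑ i, d.coordVec v i • d.coordVec.symm (Pi.single i 1) := by
  apply d.coordVec.injective
  rw [map_sum]
  simp only [map_smul, LinearEquiv.apply_symm_apply]
  exact pi_eq_sum_univ' _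

/-- Let m be the greatest label carrying a non-zero coordinate of a vector of A. Transvections place
all basis vectors of label at most m in A, so A = `fil (m + 1)`. Consequently a parabolic subgroup
determines its flag, whatever frame and labels present it. -/
theorem mem_flagOf_of_stable {A : Submodule k (Fin n → k)}
    (hA : ∀ g ∈ d.par, ∀ v ∈ A, g.1 *ᵥ v ∈ A) : A ∈ d.flagOf := by
  classical
  by_cases h0 : A = ⊥
  · rw [h0]; exact d.isFlag_flagOf.1
  obtain ⟨v₀, hv₀, hv₀'⟩ := A.exists_mem_ne_zero_of_ne_bot h0
  let S := Finset.univ.filter fun j => ∃ v ∈ A, d.coordVec v j ≠ 0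
  have hS : S.Nonempty := by
    by_contra h
    rw [Finset.not_nonempty_iff_eq_empty] at h
    refine hv₀' (d.coordVec.map_eq_zero_iff.1 (funext fun j => ?_))
    by_contra hj
    have : j ∈ S := Finset.mem_filter.2 ⟨Finset.mem_univ _, v₀, hv₀, hj⟩
    rw [h] at this
    exact absurd this (Finset.notMem_empty _)
  obtain ⟨j, hj, hmax⟩ := S.exists_max_image d.label hS
  obtain ⟨v, hv, hvj⟩ := (Finset.mem_filter.1 hj).2
  have hlab : ∀ w ∈ A, ∀ i, d.coordVec w i ≠ 0 → d.label i ≤ d.label j := fun w hw i hi =>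
    hmax i (Finset.mem_filter.2 ⟨Finset.mem_univ _, w, hw, hi⟩)
  have hne : ∀ i, i ≠ j → d.label i ≤ d.label j → d.coordVec.symm (Pi.single i 1) ∈ A :=
    fun i hij hl => d.single_mem_of_stable hA hij hl hv hvj
  -- Transvections only reach indices i ≠ j; the j-th basis vector remains after subtracting the
  -- other components from v.
  have hjA : d.coordVec.symm (Pi.single j 1) ∈ A := by
    have h1 := d.sum_coordVec v
    rw [← Finset.add_sum_erase _ _ (Finset.mem_univ j)] at h1
    have h2 : ∑ i ∈ Finset.univ.erase j, d.coordVec v i • d.coordVec.symm (Pi.single i 1) ∈ A := by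
      refine A.sum_mem fun i hi => ?_
      by_cases hvi : d.coordVec v i = 0
      · rw [hvi, zero_smul]; exact A.zero_mem
      · exact A.smul_mem _ (hne i (Finset.mem_erase.1 hi).1 (hlab v hv i hvi))
    have hv' := hv
    rw [h1, A.add_mem_iff_left h2] at hv'
    exact (A.smul_mem_iff hvj).1 hv'
  refine d.mem_flagOf.2 ⟨d.label j + 1, le_antisymm ?_ ?_⟩
  · intro w hw
    rw [d.sum_coordVec w]
    refine A.sum_mem fun i _ => ?_
    by_cases hi : d.label i ≤ d.label j
    · by_cases hij : i = j
      · rw [hij]; exact A.smul_mem _ hjA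
      · exact A.smul_mem _ (hne i hij hi)
    · rw [hw i (by omega), zero_smul]; exact A.zero_mem
  · intro w hw i hi
    by_contra h
    have := hlab w hw i h
    omega

theorem flagOf_subset_of_par_le {d' : ParabolicLevi k n} (h : d'.par ≤ d.par) :
    d.flagOf ⊆ d'.flagOf := by
  intro A hA
  refine d'.mem_flagOf_of_stable fun g hg v hv => ?_
  have := (d.isFlag_flagOf.stable_iff _).2 (d.mem_par_iff.1 (h hg))
  exact this A hA hv

theorem flagOf_eq_of_par_eq {d' : ParabolicLevi k n} (h : d.par = d'.par) :
    d.flagOf = d'.flagOf :=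
  Finset.Subset.antisymm (d.flagOf_subset_of_par_le h.ge) (d'.flagOf_subset_of_par_le h.le)

theorem par_le_of_flagOf_subset {d' : ParabolicLevi k n} (h : d.flagOf ⊆ d'.flagOf) :
    d'.par ≤ d.par := by
  intro g hg
  rw [mem_par_iff, ← d.isFlag_flagOf.stable_iff]
  exact fun A hA => (d'.isFlag_flagOf.stable_iff _).2 (d'.mem_par_iff.1 hg) A (h hA)

end ParabolicLevi

end

section

variable {k : Type u} [Field k] {n : ℕ}

/-! ### Adapted bases and conjugacy of flags -/

section Adapted

/-- Remove the greatest member M, take an adapted set for the rest and extend it to span M. The last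
clause ensures that the set lies in M before the extension. -/
theorem exists_adapted_set {W : Type*} [AddCommGroup W] [Module k W]
    (C : Finset (Submodule k W)) : IsChain (· ≤ ·) (C : Set (Submodule k W)) →
    ∃ s : Set W, LinearIndepOn k id s ∧
      (∀ A ∈ C, Submodule.span k (s ∩ A) = A) ∧ ∀ M : Submodule k W, (∀ A ∈ C, A ≤ M) → s ⊆ M := by
  classical
  induction C using Finset.strongInduction with
  | H C ih =>
  intro hC
  rcases C.eq_empty_or_nonempty with rfl | hne
  · exact ⟨∅, linearIndepOn_empty k id, by simp, by simp⟩
  obtain ⟨M, hM⟩ := C.exists_maximal hne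
  have hmax : ∀ A ∈ C, A ≤ M := fun A hA =>
    (hC.total hA hM.1).elim id fun h => hM.2 hA h
  obtain ⟨s, hs, hsA, hsM⟩ := ih (C.erase M) (Finset.erase_ssubset hM.1)
    (hC.mono (by simp))
  obtain ⟨t, htM, hst, hMt, ht⟩ := exists_linearIndepOn_id_extension hs
    (hsM M fun A hA => hmax A (Finset.mem_of_mem_erase hA))
  refine ⟨t, ht, fun A hA => le_antisymm (Submodule.span_le.2 Set.inter_subset_right) ?_,
    fun M' hM' => htM.trans (hM' M hM.1)⟩
  by_cases hAM : A = M
  · rw [hAM, Set.inter_eq_self_of_subset_left htM]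
    exact hMt
  · conv_lhs => rw [← hsA A (Finset.mem_erase.2 ⟨hAM, hA⟩)]
    exact Submodule.span_mono (Set.inter_subset_inter_left _ hst)

theorem exists_adapted_basis {C : Finset (Submodule k (Fin n → k))}
    (hC : IsFlag C) : ∃ b : Basis (Fin n) k (Fin n → k), ∀ A ∈ C,
      A = Submodule.span k (b '' {i | b i ∈ A}) := by
  obtain ⟨s, hs, hsA, -⟩ := exists_adapted_set C hC.2.2
  have htop : (⊤ : Submodule k (Fin n → k)) ≤ Submodule.span k (Set.range ((↑) : s → Fin n → k)) := by
    have := hsA ⊤ hC.2.1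
    rw [Submodule.top_coe, Set.inter_univ] at this
    rw [Subtype.range_coe, this]
  let b₀ : Basis s k (Fin n → k) := Basis.mk hs htop
  have hfin : Finite s := Module.Finite.finite_basis b₀
  let _ : Fintype s := Fintype.ofFinite s
  have hcard : Fintype.card s = n := by
    rw [← finrank_eq_card_basis b₀, finrank_fin_fun]
  let e : s ≃ Fin n := Fintype.equivFinOfCardEq hcard
  refine ⟨b₀.reindex e, fun A hA => ?_⟩
  conv_lhs => rw [← hsA A hA]
  congr 1
  ext v
  constructor
  · rintro ⟨hv, hvA⟩
    have : b₀.reindex e (e ⟨v, hv⟩) = v := by simp [b₀]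
    exact ⟨e ⟨v, hv⟩, by rw [Set.mem_ofPred_eq, this]; exact hvA, this⟩
  · rintro ⟨i, hi, rfl⟩
    refine ⟨?_, hi⟩
    simp [b₀]

namespace ParabolicLevi

variable [Finite k]

/-- Every flag belongs to a parabolic subgroup with a Levi component. -/
theorem exists_flagOf_eq {C : Finset (Submodule k (Fin n → k))} (hC : IsFlag C) :
    ∃ d : ParabolicLevi k n, d.flagOf = C := by
  classical
  obtain ⟨b, hb⟩ := exists_adapted_basis hC
  obtain ⟨F, hF⟩ := exists_frame b
  -- Here r A is the position of A in the flag and l i counts the members that miss b i, so for A in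
  -- C one has b i ∈ A exactly when l i ≤ r A.
  let r : Submodule k (Fin n → k) → ℕ := fun A => (C.filter fun A' => A' < A).card
  let l : Fin n → ℕ := fun i => (C.filter fun A' => b i ∉ A').card
  have hle : ∀ A ∈ C, ∀ i, b i ∈ A → l i ≤ r A := by
    intro A hA i hi
    refine Finset.card_le_card fun A' hA' => ?_
    obtain ⟨h1, h2⟩ := Finset.mem_filter.1 hA'
    refine Finset.mem_filter.2 ⟨h1, ?_⟩
    rcases hC.2.2.total hA h1 with h | h
    · exact absurd (h hi) h2
    · exact lt_of_le_of_ne h (by rintro rfl; exact h2 hi)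
  have hgt : ∀ A ∈ C, ∀ i, b i ∉ A → r A < l i := by
    intro A hA i hi
    refine Finset.card_lt_card (Finset.ssubset_iff_of_subset (fun A' hA' => ?_) |>.2 ⟨A, ?_, ?_⟩)
    · obtain ⟨h1, h2⟩ := Finset.mem_filter.1 hA'
      exact Finset.mem_filter.2 ⟨h1, fun h => hi (h2.le h)⟩
    · exact Finset.mem_filter.2 ⟨hA, hi⟩
    · simp
  let d : ParabolicLevi k n := ⟨l, F⟩
  have hrepr : ∀ v i, d.coordVec v i = b.repr v i := hF
  refine ⟨d, (Finset.eq_of_subset_of_card_le (fun A hA => ?_) ?_).symm⟩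
  · refine d.mem_flagOf.2 ⟨r A + 1, ?_⟩
    ext v
    have h0 : v ∈ A ↔ ((b.repr v).support : Set (Fin n)) ⊆ {i | b i ∈ A} := by
      conv_lhs => rw [hb A hA]
      exact Basis.mem_span_image b
    rw [mem_fil, h0]
    simp only [hrepr]
    have h1 : ∀ i, r A + 1 ≤ d.label i ↔ b i ∉ A := fun i =>
      ⟨fun h h' => absurd (hle A hA i h') (not_le_of_gt h), fun h => hgt A hA i h⟩
    simp only [h1]
    constructor
    · intro h i hi
      by_contra h'
      exact (Finsupp.mem_support_iff.1 hi) (h i h')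
    · intro h i hi
      by_contra h'
      have := h (Finsupp.mem_support_iff.2 h')
      exact hi this
  · rw [card_flagOf]
    -- The reverse inclusion of flags follows by counting: each label is the position of the least
    -- member containing the basis vector, which is non-zero.
    have h2 : Finset.univ.image d.label ⊆ (C.erase ⊥).image r := by
      intro m hm
      obtain ⟨i, _, rfl⟩ := Finset.mem_image.1 hm
      have hne : (C.filter fun A => b i ∈ A).Nonempty :=
        ⟨⊤, Finset.mem_filter.2 ⟨hC.2.1, Submodule.mem_top⟩⟩
      obtain ⟨A, hA⟩ := Finset.exists_minimal hne
      obtain ⟨hAC, hiA⟩ := Finset.mem_filter.1 hA.1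
      refine Finset.mem_image.2 ⟨A, Finset.mem_erase.2 ⟨?_, hAC⟩, ?_⟩
      · rintro rfl
        exact b.ne_zero i ((Submodule.mem_bot k).1 hiA)
      · refine le_antisymm (Finset.card_le_card fun A' hA' => ?_) (hle A hAC i hiA)
        obtain ⟨h3, h4⟩ := Finset.mem_filter.1 hA'
        refine Finset.mem_filter.2 ⟨h3, fun h5 => ?_⟩
        exact absurd (hA.2 (Finset.mem_filter.2 ⟨h3, h5⟩) h4.le) (not_le_of_gt h4)
    have h3 := (Finset.card_le_card h2).trans Finset.card_image_le
    rw [Finset.card_erase_of_mem hC.1] at h3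
    have h4 : 0 < C.card := Finset.card_pos.2 ⟨_, hC.1⟩
    omega

/-- Every flag can be refined to a complete one. -/
theorem exists_flagOf_subset_complete (d : ParabolicLevi k n) :
    ∃ F : GL (Fin n) k, d.flagOf ⊆ (⟨fun i => i.val, F⟩ : ParabolicLevi k n).flagOf := by
  classical
  -- After sorting the basis by label, every member of the flag is spanned by an initial segment.
  let σ : Equiv.Perm (Fin n) := Tuple.sort d.label
  have hσ : Monotone (d.label ∘ σ) := Tuple.monotone_sort d.label
  obtain ⟨b, hb⟩ := exists_basis_of_frame d.frame
  obtain ⟨F, hF⟩ := exists_frame (b.reindex σ.symm)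
  let d₁ : ParabolicLevi k n := ⟨fun i => i.val, F⟩
  have hF' : ∀ v i, d₁.coordVec v i = d.coordVec v (σ i) := by
    intro v i
    rw [coordVec_apply, coordVec_apply, ← hb]
    refine (hF v i).trans ?_
    simp
  refine ⟨F, fun A hA => d₁.mem_flagOf.2 ?_⟩
  obtain ⟨m, rfl⟩ := d.mem_flagOf.1 hA
  by_cases h : ∃ i, m ≤ d.label (σ i)
  · let S := Finset.univ.filter fun i => m ≤ d.label (σ i)
    have hS : S.Nonempty := h.imp fun i hi => Finset.mem_filter.2 ⟨Finset.mem_univ _, hi⟩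
    have hmin := (Finset.mem_filter.1 (S.min'_mem hS)).2
    refine ⟨(S.min' hS).val, ?_⟩
    ext v
    rw [mem_fil, mem_fil]
    constructor
    · intro hv i hi
      have h1 := hv (σ.symm i) (by
        refine S.min'_le _ (Finset.mem_filter.2 ⟨Finset.mem_univ _, ?_⟩)
        rwa [Equiv.apply_symm_apply])
      rwa [hF', Equiv.apply_symm_apply] at h1
    · intro hv i hi
      rw [hF']
      exact hv _ (hmin.trans (hσ (show S.min' hS ≤ i from hi)))
  · refine ⟨n, ?_⟩
    ext v
    rw [mem_fil, mem_fil]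
    constructor
    · intro _ i hi
      exact absurd ⟨σ.symm i, by rwa [Equiv.apply_symm_apply]⟩ h
    · intro _ i hi
      exact absurd i.2 (not_lt.2 hi)

/-- Refine both flags to complete ones; the change of frame carries one complete flag to the other.
-/
theorem exists_flagMap_subset {d₀ : ParabolicLevi k n} (h₀ : Function.Injective d₀.label)
    {C : Finset (Submodule k (Fin n → k))} (hC : IsFlag C) :
    ∃ g : GL (Fin n) k, flagMap (glEquiv g) C ⊆ d₀.flagOf := by
  classical
  obtain ⟨d, rfl⟩ := exists_flagOf_eq hC
  obtain ⟨F₁, h₁⟩ := d.exists_flagOf_subset_complete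
  obtain ⟨F₂, h₂⟩ := d₀.exists_flagOf_subset_complete
  let d₁ : ParabolicLevi k n := ⟨fun i => i.val, F₁⟩
  let d₂ : ParabolicLevi k n := ⟨fun i => i.val, F₂⟩
  have h₃ : d₀.flagOf = d₂.flagOf := by
    refine Finset.eq_of_subset_of_card_le h₂ ?_
    rw [card_flagOf, card_flagOf, Finset.card_image_of_injective _ h₀,
      Finset.card_image_of_injective _ Fin.val_injective]
  refine ⟨F₂ * F₁⁻¹, fun A hA => ?_⟩
  obtain ⟨B, hB, rfl⟩ := mem_flagMap.1 hA
  obtain ⟨m, rfl⟩ := d₁.mem_flagOf.1 (h₁ hB)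
  rw [h₃]
  refine d₂.mem_flagOf.2 ⟨m, ?_⟩
  have key : ∀ v, d₂.coordVec (glEquiv (F₂ * F₁⁻¹) v) = d₁.coordVec v := by
    intro v
    change glEquiv F₂⁻¹ _ = glEquiv F₁⁻¹ v
    rw [← LinearEquiv.trans_apply, ← glEquiv_mul, inv_mul_cancel_left]
  ext v
  constructor
  · intro hv
    refine ⟨(glEquiv (F₂ * F₁⁻¹)).symm v, fun i hi => ?_, LinearEquiv.apply_symm_apply _ _⟩
    rw [← key, LinearEquiv.apply_symm_apply]
    exact hv i hi
  · rintro ⟨w, hw, rfl⟩ i hi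
    have := hw i hi
    rw [← key] at this
    exact this

end ParabolicLevi

end Adapted

/-! ### The duality operation as a sum over all flags -/

section Link

variable [Fintype k]

/-- The family of invariant functions that is `f` in degree `n` and zero in the other degrees. -/
def ofInv : InvFun k n →ₗ[ℂ] ClassFun k := LinearMap.single ℂ (fun m => InvFun k m) n

theorem ofInv_apply_same (f : InvFun k n) : ofInv f n = f := by
  rw [ofInv, LinearMap.single_apply, Pi.single_eq_same]

theorem ofInv_apply_ne (f : InvFun k n) {m : ℕ} (h : m ≠ n) : ofInv f m = 0 := by
  rw [ofInv, LinearMap.single_apply, Pi.single_eq_of_ne h]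

theorem ev_ofInv_toLin' (f : InvFun k n) (x : Matrix (Fin n) (Fin n) k) :
    ev (ofInv f) (Matrix.toLin' x) = f.1 x := by
  rw [ev_toLin', ofInv_apply_same]

theorem ev_ofInv_of_ne {W : Type*} [AddCommGroup W] [Module k W] [Module.Finite k W]
    (f : InvFun k n) (x : End k W) (h : finrank k W ≠ n) : ev (ofInv f) x = 0 := by
  rw [ev, ofInv_apply_ne f h]
  rfl

namespace ParabolicLevi

variable (d : ParabolicLevi k n)

/-- The nilpotent radical, as a space of endomorphisms. -/
def nilEquiv : d.nilLie ≃ flagNil d.flagOf :=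
  (Matrix.toLin' (R := k) (m := Fin n) (n := Fin n)).toEquiv.subtypeEquiv
    (fun _ => d.mem_nilLie_iff)

theorem nilLie_le_parLie {x : Matrix (Fin n) (Fin n) k} (hx : x ∈ d.nilLie) : x ∈ d.parLie := by
  rw [mem_parLie]
  intro i j hij
  exact d.mem_nilLie.1 hx i j hij.le

/-- A kernel vector satisfies v = -yv and therefore descends through the filtration to zero. -/
theorem isUnit_one_add_nil {y : Matrix (Fin n) (Fin n) k} (hy : y ∈ d.nilLie) :
    IsUnit (1 + y) := by
  rw [← Matrix.mulVec_injective_iff_isUnit, ← Matrix.coe_mulVecLin, ← LinearMap.ker_eq_bot,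
    LinearMap.ker_eq_bot']
  intro v hv
  have hv' : v = -(y *ᵥ v) := by
    rw [Matrix.mulVecLin_apply, Matrix.add_mulVec, Matrix.one_mulVec] at hv
    exact eq_neg_of_add_eq_zero_left hv
  obtain ⟨m, hm⟩ := d.exists_fil_eq_top
  have h : ∀ j, v ∈ d.fil j → v ∈ d.fil 0 := by
    intro j
    induction j with
    | zero => exact id
    | succ j ih =>
      intro hj
      refine ih ?_
      rw [hv']
      exact (d.fil j).neg_mem (d.mem_nilLie_iff_fil.1 hy j hj)
  have := h m (by rw [hm]; trivial)
  rwa [fil_zero, Submodule.mem_bot] at this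

theorem card_unip : Nat.card d.unip = Nat.card d.nilLie := by
  refine Nat.card_congr (Equiv.ofBijective (fun g => ⟨g.1.1 - 1, g.2.2⟩) ⟨?_, ?_⟩)
  · intro g h hgh
    have := Subtype.ext_iff.1 hgh
    exact Subtype.ext (Units.ext (sub_left_injective this))
  · rintro ⟨y, hy⟩
    obtain ⟨g, hg⟩ := d.isUnit_one_add_nil hy
    have h1 : g.1 ∈ d.parLie := by
      rw [hg]; exact d.parLie.add_mem d.parLie.one_mem (d.nilLie_le_parLie hy)
    have h2 : g.1 - 1 = y := by rw [hg, add_sub_cancel_left]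
    exact ⟨⟨g, d.par_le_iff_aux h1, by rw [h2]; exact hy⟩, Subtype.ext h2⟩

/-- As z and π(z) differ by an element of 𝔲, and |U| = |𝔲|, the restriction at π(z) is the average
of f over z + 𝔲. This average involves only the flag, so the Levi component drops out. -/
theorem hcResFun_proj (f : InvFun k n) {z : Matrix (Fin n) (Fin n) k} (hz : z ∈ d.parLie) :
    hcResFun d f.1 (d.proj z) = flagTerm (ev (ofInv f)) (Matrix.toLin' z) d.flagOf := by
  classical
  rw [flagTerm, if_pos (d.mem_parLie_iff.1 hz), Fintype.expect_eq_sum_div_card, hcResFun,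
    card_unip, Nat.card_congr d.nilEquiv, Nat.card_eq_fintype_card, div_eq_inv_mul]
  congr 1
  have hs := d.sub_proj_mem_nilLie hz
  set c : Matrix (Fin n) (Fin n) k := z - d.proj z
  refine Finset.sum_bij' (fun y hy => d.nilEquiv ⟨y - c, d.nilLie.sub_mem
      (Finset.mem_filter.1 hy).2 hs⟩)
    (fun y _ => (d.nilEquiv.symm y).1 + c) (fun _ _ => Finset.mem_univ _) ?_ ?_ ?_ ?_
  · intro y _
    exact Finset.mem_filter.2 ⟨Finset.mem_univ _, d.nilLie.add_mem (d.nilEquiv.symm y).2 hs⟩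
  · intro y _
    simp
  · intro y _
    simp
  · intro y hy
    change f.1 _ = ev (ofInv f) (Matrix.toLin' z + Matrix.toLin' (y - c))
    rw [← map_add, ev_ofInv_toLin']
    refine congrArg f.1 ?_
    simp only [c]
    abel

variable [DecidableEq k]

/-- Instead of conjugating x by g, the flag is moved by g⁻¹. -/
theorem hcInd_hcRes_apply (f : InvFun k n) (x : Matrix (Fin n) (Fin n) k) :
    (hcInd d (hcRes d f)).1 x = (Nat.card d.par : ℂ)⁻¹ * ∑ g : GL (Fin n) k,
      flagTerm (ev (ofInv f)) (Matrix.toLin' x) (flagMap (glEquiv g).symm d.flagOf) := by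
  classical
  change hcIndFun d (hcResFun d f.1) x = _
  rw [hcIndFun, Finset.sum_filter]
  congr 1
  refine Finset.sum_congr rfl fun g _ => ?_
  have h1 : flagTerm (ev (ofInv f)) (Matrix.toLin' x) (flagMap (glEquiv g).symm d.flagOf)
      = flagTerm (ev (ofInv f)) (Matrix.toLin' (ad g x)) d.flagOf := by
    rw [← conj_glEquiv, ← flagTerm_map (glEquiv g) (fun y => ev_congr _ (conj_conj (glEquiv g) y)),
      flagMap_flagMap_symm]
  rw [h1]
  split_ifs with h
  · exact d.hcResFun_proj f h
  · rw [flagTerm, if_neg (fun h' => h (d.mem_parLie_iff.2 h'))]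

theorem card_par : Nat.card d.par
    = (Finset.univ.filter fun g : GL (Fin n) k => flagMap (glEquiv g) d.flagOf = d.flagOf).card := by
  classical
  rw [Nat.card_eq_fintype_card, Fintype.card_subtype]
  congr 1
  ext g
  simp only [Finset.mem_filter, Finset.mem_univ, true_and]
  exact d.mem_par_iff

theorem neg_one_pow_ssRank : (-1 : ℂ) ^ d.ssRank = (-1) ^ n * (-1) ^ (d.flagOf.card + 1) := by
  rw [card_flagOf]
  have h : (Finset.univ.image d.label).card ≤ n := by
    simpa using Finset.card_image_le (s := (Finset.univ : Finset (Fin n))) (f := d.label)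
  have key : ∀ c m : ℕ, c ≤ m → (-1 : ℂ) ^ (m - c) = (-1) ^ m * (-1) ^ (c + 1 + 1) := by
    intro c m hcm
    obtain ⟨e, rfl⟩ := Nat.exists_eq_add_of_le hcm
    rw [Nat.add_sub_cancel_left, ← pow_add]
    have : c + e + (c + 1 + 1) = e + 2 * (c + 1) := by ring
    rw [this, pow_add, pow_mul]
    simp
  exact key _ _ h

end ParabolicLevi

variable [DecidableEq k]

open Classical in
/-- Every flag is conjugate to exactly one subflag of a given complete flag. -/
theorem sum_card_transporter {d₀ : ParabolicLevi k n} (h₀ : Function.Injective d₀.label)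
    {C : Finset (Submodule k (Fin n → k))} (hC : IsFlag C) :
    ∑ C₁ : Finset (Submodule k (Fin n → k)) with IsFlag C₁ ∧ C₁ ⊆ d₀.flagOf,
      ((Finset.univ.filter fun g : GL (Fin n) k => flagMap (glEquiv g) C₁ = C₁).card : ℂ)⁻¹
        * (Finset.univ.filter fun g : GL (Fin n) k => flagMap (glEquiv g).symm C₁ = C).card
      = 1 := by
  obtain ⟨g₀, hg₀⟩ := ParabolicLevi.exists_flagMap_subset h₀ hC
  set C₂ := flagMap (glEquiv g₀) C with hC₂
  have hmem : C₂ ∈ Finset.univ.filter (fun C₁ => IsFlag C₁ ∧ C₁ ⊆ d₀.flagOf) :=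
    Finset.mem_filter.2 ⟨Finset.mem_univ _, hC.map _, hg₀⟩
  have hsymm : ∀ (g : GL (Fin n) k) (C₁ : Finset (Submodule k (Fin n → k))),
      flagMap (glEquiv g).symm C₁ = C ↔ C₁ = flagMap (glEquiv g) C := by
    intro g C₁
    constructor
    · rintro rfl; rw [flagMap_flagMap_symm]
    · rintro rfl; rw [flagMap_symm_flagMap]
  rw [Finset.sum_eq_single_of_mem C₂ hmem]
  -- The elements g with g⁻¹C₂ = C form a coset of the stabiliser of C₂.
  · have hcard : (Finset.univ.filter fun g : GL (Fin n) k => flagMap (glEquiv g) C₂ = C₂).card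
        = (Finset.univ.filter fun g : GL (Fin n) k => flagMap (glEquiv g).symm C₂ = C).card := by
      refine Finset.card_bij' (fun g _ => g * g₀) (fun g _ => g * g₀⁻¹) ?_ ?_ ?_ ?_
      · intro g hg
        refine Finset.mem_filter.2 ⟨Finset.mem_univ _, (hsymm _ _).2 ?_⟩
        rw [glEquiv_mul, ← flagMap_trans, ← hC₂, (Finset.mem_filter.1 hg).2]
      · intro g hg
        have := (hsymm _ _).1 (Finset.mem_filter.1 hg).2
        refine Finset.mem_filter.2 ⟨Finset.mem_univ _, ?_⟩
        rw [glEquiv_mul, ← flagMap_trans, glEquiv_inv, hC₂, flagMap_symm_flagMap, ← this]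
      · intro g _; simp
      · intro g _; simp
    rw [← hcard]
    refine inv_mul_cancel₀ ?_
    rw [Nat.cast_ne_zero]
    refine (Finset.card_pos.2 ⟨1, Finset.mem_filter.2 ⟨Finset.mem_univ _, ?_⟩⟩).ne'
    rw [glEquiv_one, flagMap_refl]
  · intro C₁ hC₁ hne
    obtain ⟨-, hC₁, hsub⟩ := Finset.mem_filter.1 hC₁
    suffices h : (Finset.univ.filter fun g : GL (Fin n) k => flagMap (glEquiv g).symm C₁ = C) = ∅ by
      rw [h, Finset.card_empty, Nat.cast_zero, mul_zero]
    refine Finset.filter_false_of_mem fun g _ hg => hne ?_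
    rw [hsymm] at hg
    -- Both images of A lie in one complete flag and have the same dimension, so they agree.
    have hkey : ∀ A ∈ C, A.map (glEquiv g).toLinearMap = A.map (glEquiv g₀).toLinearMap := by
      intro A hA
      refine d₀.isFlag_flagOf.eq_of_finrank_eq ?_ ?_ ?_
      · exact hsub (hg ▸ (map_mem_flagMap _).2 hA)
      · exact hg₀ ((map_mem_flagMap _).2 hA)
      · exact (LinearEquiv.finrank_map_eq _ A).trans (LinearEquiv.finrank_map_eq _ A).symm
    rw [hg, hC₂]
    ext A
    rw [mem_flagMap, mem_flagMap]
    constructor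
    · rintro ⟨B, hB, rfl⟩; exact ⟨B, hB, (hkey B hB).symm⟩
    · rintro ⟨B, hB, rfl⟩; exact ⟨B, hB, hkey B hB⟩

-- For fixed C the normalised sum over g runs once over the orbit of C, and the orbits of the
-- subflags of a complete flag partition all flags.
open Classical in
theorem sum_complete_flag {d₀ : ParabolicLevi k n} (h₀ : Function.Injective d₀.label)
    (φ : End k (Fin n → k) → ℂ) (x : End k (Fin n → k)) :
    ∑ C : Finset (Submodule k (Fin n → k)) with IsFlag C ∧ C ⊆ d₀.flagOf,
      (-1 : ℂ) ^ (C.card + 1) *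
        (((Finset.univ.filter fun g : GL (Fin n) k => flagMap (glEquiv g) C = C).card : ℂ)⁻¹
          * ∑ g : GL (Fin n) k, flagTerm φ x (flagMap (glEquiv g).symm C))
      = flagSum φ x := by
  have h1 : ∀ C ∈ Finset.univ.filter (fun C => IsFlag C ∧ C ⊆ d₀.flagOf),
      (-1 : ℂ) ^ (C.card + 1) *
        (((Finset.univ.filter fun g : GL (Fin n) k => flagMap (glEquiv g) C = C).card : ℂ)⁻¹
          * ∑ g : GL (Fin n) k, flagTerm φ x (flagMap (glEquiv g).symm C))
      = ∑ C' : Finset (Submodule k (Fin n → k)) with IsFlag C',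
        ((-1 : ℂ) ^ (C'.card + 1) * flagTerm φ x C') *
        (((Finset.univ.filter fun g : GL (Fin n) k => flagMap (glEquiv g) C = C).card : ℂ)⁻¹
        * (Finset.univ.filter fun g : GL (Fin n) k => flagMap (glEquiv g).symm C = C').card) := by
    intro C hC
    have h2 : ∑ g : GL (Fin n) k, flagTerm φ x (flagMap (glEquiv g).symm C)
        = ∑ C' : Finset (Submodule k (Fin n → k)) with IsFlag C', flagTerm φ x C' *
          (Finset.univ.filter fun g : GL (Fin n) k => flagMap (glEquiv g).symm C = C').card := by
      rw [← Finset.sum_fiberwise_of_maps_to (s := Finset.univ)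
        (t := Finset.univ.filter fun C' => IsFlag C')
        (g := fun g : GL (Fin n) k => flagMap (glEquiv g).symm C)
        (fun g _ => Finset.mem_filter.2 ⟨Finset.mem_univ _, (Finset.mem_filter.1 hC).2.1.map _⟩)]
      refine Finset.sum_congr rfl fun C' _ => ?_
      rw [Finset.sum_congr rfl (g := fun _ => flagTerm φ x C')
        (fun g hg => by rw [(Finset.mem_filter.1 hg).2]), Finset.sum_const, nsmul_eq_mul, mul_comm]
    rw [h2, Finset.mul_sum, Finset.mul_sum]
    refine Finset.sum_congr rfl fun C' hC' => ?_
    by_cases h3 : ∃ g : GL (Fin n) k, flagMap (glEquiv g).symm C = C'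
    · obtain ⟨g, rfl⟩ := h3
      rw [card_flagMap]
      ring
    · rw [Finset.filter_false_of_mem (fun g _ h => h3 ⟨g, h⟩)]
      simp
  rw [Finset.sum_congr rfl h1, Finset.sum_comm, flagSum]
  refine Finset.sum_congr rfl fun C hC => ?_
  rw [← Finset.mul_sum, sum_card_transporter h₀ (Finset.mem_filter.1 hC).2, mul_one]

/-- Parabolic subgroups containing B correspond to the subflags of the complete flag of B, and `lev`
enters only through these flags. -/
theorem dualityOp_apply {B : Subgroup (GL (Fin n) k)} (hB : IsBorel B)
    (lev : Subgroup (GL (Fin n) k) → ParabolicLevi k n)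
    (hlev : ∀ P : Subgroup (GL (Fin n) k), IsParabolic P → B ≤ P → (lev P).par = P)
    (f : InvFun k n) (x : Matrix (Fin n) (Fin n) k) :
    (dualityOp B lev f).1 x = (-1) ^ n * flagSum (ev (ofInv f)) (Matrix.toLin' x) := by
  classical
  obtain ⟨d₀, h₀, rfl⟩ := hB
  rw [← sum_complete_flag h₀, dualityOp, LinearMap.sum_apply, Submodule.coe_sum, Finset.sum_apply,
    Finset.mul_sum]
  have hmem : ∀ P, P ∈ (Set.toFinite {P : Subgroup (GL (Fin n) k) |
      IsParabolic P ∧ d₀.par ≤ P}).toFinset ↔ IsParabolic P ∧ d₀.par ≤ P := by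
    intro P; rw [Set.Finite.mem_toFinset]; rfl
  refine Finset.sum_bij (fun P _ => (lev P).flagOf) ?_ ?_ ?_ ?_
  · intro P hP
    obtain ⟨h1, h2⟩ := (hmem P).1 hP
    refine Finset.mem_filter.2 ⟨Finset.mem_univ _, (lev P).isFlag_flagOf, ?_⟩
    refine (lev P).flagOf_subset_of_par_le ?_
    rw [hlev P h1 h2]; exact h2
  · intro P hP P' hP' h
    obtain ⟨h1, h2⟩ := (hmem P).1 hP
    obtain ⟨h1', h2'⟩ := (hmem P').1 hP'
    rw [← hlev P h1 h2, ← hlev P' h1' h2']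
    exact le_antisymm (ParabolicLevi.par_le_of_flagOf_subset _ h.ge)
      (ParabolicLevi.par_le_of_flagOf_subset _ h.le)
  · intro C hC
    obtain ⟨-, hC, hsub⟩ := Finset.mem_filter.1 hC
    obtain ⟨d, rfl⟩ := ParabolicLevi.exists_flagOf_eq hC
    have h1 : IsParabolic d.par := ⟨d, rfl⟩
    have h2 := d.par_le_of_flagOf_subset hsub
    exact ⟨d.par, (hmem _).2 ⟨h1, h2⟩, ParabolicLevi.flagOf_eq_of_par_eq _ (hlev _ h1 h2)⟩
  · intro P _
    change (-1 : ℂ) ^ (lev P).ssRank * (hcInd (lev P) (hcRes (lev P) f)).1 x = _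
    rw [ParabolicLevi.hcInd_hcRes_apply, ParabolicLevi.card_par, ParabolicLevi.neg_one_pow_ssRank,
      mul_assoc]

end Link

end

section

variable {k : Type u} [Field k] {n : ℕ}

/-! ### Induction from two blocks is the product -/

section TwoBlocks

variable {n₁ n₂ : ℕ}

theorem twoBlocks_coordVec (v : Fin (n₁ + n₂) → k) : (twoBlocks k n₁ n₂).coordVec v = v := by
  change ((1 : GL (Fin (n₁ + n₂)) k)⁻¹).1 *ᵥ v = v
  simp

theorem twoBlocks_label_castAdd (i : Fin n₁) :
    (twoBlocks k n₁ n₂).label (Fin.castAdd n₂ i) = 0 := by simp [twoBlocks]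

theorem twoBlocks_label_natAdd (i : Fin n₂) :
    (twoBlocks k n₁ n₂).label (Fin.natAdd n₁ i) = 1 := by simp [twoBlocks]

theorem mem_twoBlocks_fil_one {v : Fin (n₁ + n₂) → k} :
    v ∈ (twoBlocks k n₁ n₂).fil 1 ↔ ∀ i, v (Fin.natAdd n₁ i) = 0 := by
  rw [ParabolicLevi.mem_fil, twoBlocks_coordVec]
  constructor
  · intro h i
    exact h _ (twoBlocks_label_natAdd i).ge
  · intro h i
    refine Fin.addCases (fun j hj => ?_) (fun j _ => h j) i
    rw [twoBlocks_label_castAdd] at hj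
    omega

theorem twoBlocks_fil_two : (twoBlocks k n₁ n₂).fil 2 = ⊤ := by
  rw [eq_top_iff]
  intro v _ i
  refine Fin.addCases (fun j hj => ?_) (fun j hj => ?_) i
  · rw [twoBlocks_label_castAdd] at hj; omega
  · rw [twoBlocks_label_natAdd] at hj; omega

theorem mem_twoBlocks_parLie [Finite k] {z : Matrix (Fin (n₁ + n₂)) (Fin (n₁ + n₂)) k} :
    z ∈ (twoBlocks k n₁ n₂).parLie ↔
      (twoBlocks k n₁ n₂).fil 1 ≤ ((twoBlocks k n₁ n₂).fil 1).comap (Matrix.toLin' z) := by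
  rw [ParabolicLevi.mem_parLie_iff]
  constructor
  · exact fun h => h _ (ParabolicLevi.fil_mem_flagOf _ 1)
  · intro h A hA
    obtain ⟨m, rfl⟩ := (ParabolicLevi.mem_flagOf _).1 hA
    match m with
    | 0 => rw [ParabolicLevi.fil_zero]; exact bot_le
    | 1 => exact h
    | m + 2 =>
      have : (twoBlocks k n₁ n₂).fil (m + 2) = ⊤ := by
        rw [eq_top_iff, ← twoBlocks_fil_two]
        exact ParabolicLevi.fil_mono _ (by omega)
      rw [this]
      simp

theorem isSubquot_upperBlock (z : Matrix (Fin (n₁ + n₂)) (Fin (n₁ + n₂)) k) :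
    IsSubquot (Matrix.toLin' z) ⊥ ((twoBlocks k n₁ n₂).fil 1) (Matrix.toLin' (upperBlock z)) := by
  refine ⟨LinearMap.funLeft k k (Fin.castAdd n₂) ∘ₗ Submodule.subtype _, fun u => ?_, fun v => ?_,
    fun v v' hv => ?_⟩
  · refine ⟨⟨Fin.append u 0, mem_twoBlocks_fil_one.2 fun i => by simp⟩, ?_⟩
    ext i
    simp [LinearMap.funLeft_apply]
  · have hv := mem_twoBlocks_fil_one.1 v.2
    rw [Submodule.mem_bot]
    constructor
    · intro h
      funext i
      exact Fin.addCases (fun j => congrFun h j) (fun j => hv j) i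
    · intro h
      funext i
      exact congrFun h (Fin.castAdd n₂ i)
  · have hv0 := mem_twoBlocks_fil_one.1 v.2
    funext i
    change (v' : Fin (n₁ + n₂) → k) (Fin.castAdd n₂ i) = _
    rw [hv]
    change ∑ j, z (Fin.castAdd n₂ i) j * v.1 j
      = ∑ j, z (Fin.castAdd n₂ i) (Fin.castAdd n₂ j) * v.1 (Fin.castAdd n₂ j)
    rw [Fin.sum_univ_add, add_eq_left]
    exact Finset.sum_eq_zero fun j _ => by rw [hv0, mul_zero]

theorem isSubquot_lowerBlock {z : Matrix (Fin (n₁ + n₂)) (Fin (n₁ + n₂)) k}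
    (hz : z ∈ (twoBlocks k n₁ n₂).parLie) :
    IsSubquot (Matrix.toLin' z) ((twoBlocks k n₁ n₂).fil 1) ⊤ (Matrix.toLin' (lowerBlock z)) := by
  refine ⟨LinearMap.funLeft k k (Fin.natAdd n₁) ∘ₗ Submodule.subtype _, fun u => ?_, fun v => ?_,
    fun v v' hv => ?_⟩
  · refine ⟨⟨Fin.append 0 u, trivial⟩, ?_⟩
    ext i
    simp [LinearMap.funLeft_apply]
  · rw [mem_twoBlocks_fil_one]
    exact ⟨fun h i => congrFun h i, fun h => funext h⟩
  · funext i
    change (v' : Fin (n₁ + n₂) → k) (Fin.natAdd n₁ i) = _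
    rw [hv]
    change ∑ j, z (Fin.natAdd n₁ i) j * v.1 j
      = ∑ j, z (Fin.natAdd n₁ i) (Fin.natAdd n₁ j) * v.1 (Fin.natAdd n₁ j)
    rw [Fin.sum_univ_add, add_eq_right]
    refine Finset.sum_eq_zero fun j _ => ?_
    have := (ParabolicLevi.mem_parLie _).1 hz (Fin.natAdd n₁ i) (Fin.castAdd n₂ j)
      (by rw [twoBlocks_label_castAdd, twoBlocks_label_natAdd]; exact Nat.zero_lt_one)
    rw [twoBlocks_coords] at this
    rw [this, zero_mul]

theorem finrank_twoBlocks_fil_one : finrank k ((twoBlocks k n₁ n₂).fil 1) = n₁ := by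
  obtain ⟨e, -⟩ := (isSubquot_subE (Matrix.toLin' (0 : Matrix (Fin (n₁ + n₂)) (Fin (n₁ + n₂)) k))
    ⟨(twoBlocks k n₁ n₂).fil 1, by simp⟩).conj (by simp) (isSubquot_upperBlock _)
  rw [e.finrank_eq, finrank_fin_fun]

theorem twoBlocks_proj_apply (z : Matrix (Fin (n₁ + n₂)) (Fin (n₁ + n₂)) k)
    (i j : Fin (n₁ + n₂)) : ((twoBlocks k n₁ n₂).proj z).1 i j
      = if (twoBlocks k n₁ n₂).label i = (twoBlocks k n₁ n₂).label j then z i j else 0 := by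
  have h : ((twoBlocks k n₁ n₂).proj z).1
      = blockDiagonalPart k (twoBlocks k n₁ n₂).label z := by
    rw [← twoBlocks_coords ((twoBlocks k n₁ n₂).proj z).1]
    conv_rhs => rw [← twoBlocks_coords z]
    exact AlgEquiv.apply_symm_apply _ _
  rw [h]
  rfl

theorem upperBlock_proj (z : Matrix (Fin (n₁ + n₂)) (Fin (n₁ + n₂)) k) :
    upperBlock ((twoBlocks k n₁ n₂).proj z).1 = upperBlock z := by
  ext i j
  simp only [upperBlock, Matrix.submatrix_apply, twoBlocks_proj_apply, twoBlocks_label_castAdd,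
    if_true]

theorem lowerBlock_proj (z : Matrix (Fin (n₁ + n₂)) (Fin (n₁ + n₂)) k) :
    lowerBlock ((twoBlocks k n₁ n₂).proj z).1 = lowerBlock z := by
  ext i j
  simp only [lowerBlock, Matrix.submatrix_apply, twoBlocks_proj_apply, twoBlocks_label_natAdd,
    if_true]

/-- Both subspaces can be moved into one complete flag, where the dimension determines the member.
-/
theorem exists_glEquiv_map_eq [Finite k] {V V' : Submodule k (Fin n → k)}
    (h : finrank k V = finrank k V') :
    ∃ g : GL (Fin n) k, V.map (glEquiv g).toLinearMap = V' := by
  classical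
  have hflag : ∀ A : Submodule k (Fin n → k), IsFlag {⊥, A, ⊤} := by
    intro A
    refine ⟨by simp, by simp, ?_⟩
    intro B hB B' hB' _
    simp only [Finset.coe_insert, Finset.coe_singleton, Set.mem_insert_iff,
      Set.mem_singleton_iff] at hB hB'
    rcases hB with rfl | rfl | rfl
    · exact Or.inl bot_le
    · rcases hB' with rfl | rfl | rfl
      · exact Or.inr bot_le
      · exact Or.inl le_rfl
      · exact Or.inl le_top
    · exact Or.inr le_top
  let d₀ : ParabolicLevi k n := ⟨fun i => i.val, 1⟩
  obtain ⟨g, hg⟩ := ParabolicLevi.exists_flagMap_subset (d₀ := d₀) Fin.val_injective (hflag V)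
  obtain ⟨g', hg'⟩ := ParabolicLevi.exists_flagMap_subset (d₀ := d₀) Fin.val_injective (hflag V')
  have h1 : V.map (glEquiv g).toLinearMap = V'.map (glEquiv g').toLinearMap := by
    refine d₀.isFlag_flagOf.eq_of_finrank_eq (hg ((map_mem_flagMap _).2 (by simp)))
      (hg' ((map_mem_flagMap _).2 (by simp))) ?_
    rw [LinearEquiv.finrank_map_eq, LinearEquiv.finrank_map_eq, h]
  refine ⟨g'⁻¹ * g, ?_⟩
  rw [glEquiv_mul, glEquiv_inv, LinearEquiv.coe_trans, Submodule.map_comp, h1,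
    ← Submodule.map_comp, ← LinearEquiv.coe_trans, LinearEquiv.self_trans_symm]
  exact Submodule.map_id V'

variable [Fintype k]

theorem prodAt_ofInv_eq_zero (f₁ : InvFun k n₁) (f₂ : InvFun k n₂) {W : Type*} [AddCommGroup W]
    [Module k W] [Finite W] (z : End k W) {V : Submodule k W} (h : finrank k V ≠ n₁) :
    prodAt (ofInv f₁) (ofInv f₂) z V = 0 := by
  rw [prodAt]
  split_ifs with hV
  · rw [ev_ofInv_of_ne f₁ _ h, zero_mul]
  · rfl

theorem prodAt_twoBlocks (f₁ : InvFun k n₁) (f₂ : InvFun k n₂)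
    {z : Matrix (Fin (n₁ + n₂)) (Fin (n₁ + n₂)) k} (hz : z ∈ (twoBlocks k n₁ n₂).parLie) :
    prodAt (ofInv f₁) (ofInv f₂) (Matrix.toLin' z) ((twoBlocks k n₁ n₂).fil 1)
      = (boxProd f₁ f₂).1 ((twoBlocks k n₁ n₂).proj z) := by
  have hst := mem_twoBlocks_parLie.1 hz
  rw [prodAt, dif_pos hst,
    (isSubquot_subE _ ⟨_, hst⟩).ev_eq hst (isSubquot_upperBlock z),
    (isSubquot_quotE _ ⟨_, hst⟩).ev_eq (by simp) (isSubquot_lowerBlock hz),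
    ev_ofInv_toLin', ev_ofInv_toLin']
  change _ = f₁.1 (upperBlock _) * f₂.1 (lowerBlock _)
  rw [upperBlock_proj, lowerBlock_proj]

variable [DecidableEq k]

-- The parabolic subgroup is the stabiliser of `fil 1`, and the elements carrying `fil 1` to V by
-- their inverse form a coset of it.
open Classical in
theorem card_par_twoBlocks {V : Submodule k (Fin (n₁ + n₂) → k)} (hV : finrank k V = n₁) :
    (Finset.univ.filter fun g : GL (Fin (n₁ + n₂)) k =>
      ((twoBlocks k n₁ n₂).fil 1).map (glEquiv g).symm.toLinearMap = V).card
      = Nat.card (twoBlocks k n₁ n₂).par := by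
  set V₀ := (twoBlocks k n₁ n₂).fil 1 with hV₀
  obtain ⟨g₀, hg₀⟩ := exists_glEquiv_map_eq (hV.trans finrank_twoBlocks_fil_one.symm)
  rw [← hV₀] at hg₀
  have hpar : ∀ g, g ∈ (twoBlocks k n₁ n₂).par ↔ V₀.map (glEquiv g).toLinearMap = V₀ := by
    intro g
    constructor
    · intro hg
      have := mem_twoBlocks_parLie.1 ((ParabolicLevi.mem_par _).1 hg).1
      exact Submodule.eq_of_le_of_finrank_eq (Submodule.map_le_iff_le_comap.2 this)
        (LinearEquiv.finrank_map_eq (glEquiv g) V₀)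
    · intro hg
      refine ParabolicLevi.par_le_iff_aux _ (mem_twoBlocks_parLie.2 ?_)
      exact Submodule.map_le_iff_le_comap.1 hg.le
  have hsymm : ∀ (g : GL (Fin (n₁ + n₂)) k) (A : Submodule k (Fin (n₁ + n₂) → k)),
      V₀.map (glEquiv g).symm.toLinearMap = A ↔ V₀ = A.map (glEquiv g).toLinearMap := by
    intro g A
    constructor
    · rintro rfl
      rw [← Submodule.map_comp, ← LinearEquiv.coe_trans, LinearEquiv.symm_trans_self]
      exact (Submodule.map_id _).symm
    · intro h
      rw [h, ← Submodule.map_comp, ← LinearEquiv.coe_trans, LinearEquiv.self_trans_symm]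
      exact Submodule.map_id _
  rw [Nat.card_eq_fintype_card, Fintype.card_subtype]
  refine Finset.card_bij' (fun g _ => g * g₀⁻¹) (fun g _ => g * g₀) ?_ ?_ ?_ ?_
  · intro g hg
    refine Finset.mem_filter.2 ⟨Finset.mem_univ _, (hpar _).2 ?_⟩
    rw [glEquiv_mul, LinearEquiv.coe_trans, Submodule.map_comp, glEquiv_inv,
      (hsymm g₀ V).2 hg₀.symm]
    exact ((hsymm g V).1 (Finset.mem_filter.1 hg).2).symm
  · intro g hg
    refine Finset.mem_filter.2 ⟨Finset.mem_univ _, (hsymm _ _).2 ?_⟩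
    rw [glEquiv_mul, LinearEquiv.coe_trans, Submodule.map_comp, hg₀]
    exact ((hpar g).1 (Finset.mem_filter.1 hg).2).symm
  · intro g _; simp
  · intro g _; simp

/-- The summand for g is the contribution of the subspace g⁻¹V₀ with V₀ = `fil 1`. Each
n₁-dimensional V arises from |P| elements g, and other V contribute nothing because `ofInv f₁`
vanishes outside degree n₁. -/
theorem hcInd_boxProd (f₁ : InvFun k n₁) (f₂ : InvFun k n₂) :
    hcInd (twoBlocks k n₁ n₂) (boxProd f₁ f₂) = mul (ofInv f₁) (ofInv f₂) (n₁ + n₂) := by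
  classical
  apply Subtype.ext
  funext x
  rw [← ev_toLin', ev_mul_eq_sum_prodAt]
  change hcIndFun (twoBlocks k n₁ n₂) (boxProd f₁ f₂).1 x = _
  rw [hcIndFun, Finset.sum_filter]
  set Φ := fun V => prodAt (ofInv f₁) (ofInv f₂) (Matrix.toLin' x) V with hΦ
  have h1 : ∀ g : GL (Fin (n₁ + n₂)) k,
      (if ad g x ∈ (twoBlocks k n₁ n₂).parLie then
        (boxProd f₁ f₂).1 ((twoBlocks k n₁ n₂).proj (ad g x)) else 0)
      = Φ (((twoBlocks k n₁ n₂).fil 1).map (glEquiv g).symm.toLinearMap) := by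
    intro g
    have e : Φ (((twoBlocks k n₁ n₂).fil 1).map (glEquiv g).symm.toLinearMap)
        = prodAt (ofInv f₁) (ofInv f₂) (Matrix.toLin' (ad g x)) ((twoBlocks k n₁ n₂).fil 1) := by
      refine prodAt_map _ _ (glEquiv g).symm (symm_intertwine fun w => ?_) _
      rw [← conj_glEquiv]
      exact conj_intertwine _ _ _
    rw [e]
    split_ifs with h
    · exact (prodAt_twoBlocks f₁ f₂ h).symm
    · rw [prodAt, dif_neg (fun h' => h (mem_twoBlocks_parLie.2 h'))]
  have h2 : ∑ g : GL (Fin (n₁ + n₂)) k,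
      Φ (((twoBlocks k n₁ n₂).fil 1).map (glEquiv g).symm.toLinearMap)
      = (Nat.card (twoBlocks k n₁ n₂).par : ℂ) * ∑ V, Φ V := by
    rw [← Finset.sum_fiberwise Finset.univ (fun g : GL (Fin (n₁ + n₂)) k =>
      ((twoBlocks k n₁ n₂).fil 1).map (glEquiv g).symm.toLinearMap), Finset.mul_sum]
    refine Finset.sum_congr rfl fun V _ => ?_
    rw [Finset.sum_congr rfl (g := fun _ => Φ V)
      (fun g hg => by rw [(Finset.mem_filter.1 hg).2]), Finset.sum_const, nsmul_eq_mul]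
    by_cases hV : finrank k V = n₁
    · rw [card_par_twoBlocks hV]
    · have : Φ V = 0 := prodAt_ofInv_eq_zero f₁ f₂ _ hV
      rw [this, mul_zero, mul_zero]
  have h3 : (Nat.card (twoBlocks k n₁ n₂).par : ℂ) ≠ 0 := by
    rw [Nat.cast_ne_zero]
    exact Nat.card_pos.ne'
  rw [Finset.sum_congr rfl (fun g _ => h1 g), h2, inv_mul_cancel_left₀ h3]

end TwoBlocks

/-! ### Existence of the family -/

section Family

variable [Fintype k]

/-- The duality operators. -/
def dualOp (k : Type u) [Field k] [Fintype k] (n : ℕ) : InvFun k n →ₗ[ℂ] InvFun k n :=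
  (-1 : ℂ) ^ n • (LinearMap.proj n ∘ₗ dual ∘ₗ ofInv)

theorem dualOp_apply (f : InvFun k n) : dualOp k n f = (-1 : ℂ) ^ n • dual (ofInv f) n := rfl

theorem dualOp_apply_apply (f : InvFun k n) (x : Matrix (Fin n) (Fin n) k) :
    (dualOp k n f).1 x = (-1 : ℂ) ^ n * flagSum (ev (ofInv f)) (Matrix.toLin' x) := by
  rw [← ev_dual, ev_toLin']
  rfl

/-- Flag terms only evaluate f on the given space, so `dual` respects the grading. -/
theorem dual_apply_congr {f g : ClassFun k} (h : f n = g n) : dual f n = dual g n := by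
  apply Subtype.ext
  funext x
  rw [← ev_toLin', ← ev_toLin', ev_dual, ev_dual]
  congr 1
  funext y
  rw [ev_eq_toMatrix f (Pi.basisFun k (Fin n)), ev_eq_toMatrix g (Pi.basisFun k (Fin n)), h]

theorem ofInv_dualOp (f : InvFun k n) : ofInv (dualOp k n f) = (-1 : ℂ) ^ n • dual (ofInv f) := by
  funext m
  by_cases h : m = n
  · subst h
    rw [ofInv_apply_same]
    rfl
  · rw [ofInv_apply_ne _ h, Pi.smul_apply,
      dual_apply_congr (g := 0) ((ofInv_apply_ne f h).trans rfl), map_zero, Pi.zero_apply,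
      smul_zero]

theorem mul_smul_smul (a b : ℂ) (f g : ClassFun k) : mul (a • f) (b • g) = (a * b) • mul f g := by
  refine classFun_ext fun W _ _ _ x => ?_
  rw [ev_smul, ev_mul, ev_mul, Finset.mul_sum]
  refine Finset.sum_congr rfl fun V _ => ?_
  rw [ev_smul, ev_smul]
  ring

variable [DecidableEq k]

/-- The signs multiply, and commutativity undoes the reversal of factors in `dual_mul`. -/
theorem dualOp_hcInd (n₁ n₂ : ℕ) (f₁ : InvFun k n₁) (f₂ : InvFun k n₂) :
    dualOp k (n₁ + n₂) (hcInd (twoBlocks k n₁ n₂) (boxProd f₁ f₂))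
      = hcInd (twoBlocks k n₁ n₂) (boxProd (dualOp k n₁ f₁) (dualOp k n₂ f₂)) := by
  rw [hcInd_boxProd, hcInd_boxProd, ofInv_dualOp, ofInv_dualOp, mul_smul_smul, dualOp_apply,
    dual_apply_congr (ofInv_apply_same _), dual_mul, mul_comm', ← pow_add]
  rfl

/-- The term of a flag with a proper parabolic subgroup is a value of a Harish-Chandra restriction,
or zero by definition, and so vanishes. The flag {0, k^n} has two members and zero nilpotent
radical; it contributes -f(x). -/
theorem dualOp_preCuspidal (hn : 0 < n) (f : InvFun k n) (hf : IsPreCuspidal f) :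
    dualOp k n f = (-1 : ℂ) ^ (n - 1) • f := by
  classical
  apply Subtype.ext
  funext x
  rw [dualOp_apply_apply]
  let d₀ : ParabolicLevi k n := ⟨fun _ => 0, 1⟩
  have hpar : d₀.parLie = ⊤ := by
    rw [eq_top_iff]
    intro y _
    rw [ParabolicLevi.mem_parLie]
    intro i j hij
    exact absurd hij (lt_irrefl _)
  have hpar' : d₀.par = ⊤ := by
    rw [eq_top_iff]
    intro g _
    exact d₀.par_le_iff_aux (by rw [hpar]; trivial)
  have hcard : d₀.flagOf.card = 2 := by
    have : Nonempty (Fin n) := ⟨⟨0, hn⟩⟩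
    rw [ParabolicLevi.card_flagOf, Finset.image_const Finset.univ_nonempty, Finset.card_singleton]
  have hnil : ∀ y : flagNil d₀.flagOf, y.1 = 0 := by
    rintro ⟨y, hy⟩
    rw [← Matrix.toLin'_toMatrix' y, ← ParabolicLevi.mem_nilLie_iff, ParabolicLevi.mem_nilLie] at hy
    have h0 : d₀.coords (LinearMap.toMatrix' y) = 0 := by
      ext i j
      exact hy i j le_rfl
    rw [map_eq_zero_iff _ d₀.coords.injective] at h0
    exact (map_eq_zero_iff _ LinearMap.toMatrix'.injective).1 h0
  have hsum : flagSum (ev (ofInv f)) (Matrix.toLin' x) = - f.1 x := by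
    rw [flagSum, Finset.sum_eq_single_of_mem d₀.flagOf
      (Finset.mem_filter.2 ⟨Finset.mem_univ _, d₀.isFlag_flagOf⟩)]
    · rw [hcard, flagTerm, if_pos (d₀.mem_parLie_iff.1 (by rw [hpar]; trivial)),
        Finset.expect_congr rfl (g := fun _ => f.1 x), Fintype.expect_const]
      · ring
      · intro y _
        rw [hnil, add_zero, ev_ofInv_toLin']
    · intro C hC hne
      obtain ⟨d, rfl⟩ := ParabolicLevi.exists_flagOf_eq (Finset.mem_filter.1 hC).2
      have hd : d.par ≠ ⊤ := fun h => hne (d.flagOf_eq_of_par_eq (h.trans hpar'.symm))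
      by_cases hx : x ∈ d.parLie
      · rw [← d.hcResFun_proj f hx]
        have := congrFun (Subtype.ext_iff.1 (hf d hd)) (d.proj x)
        change hcResFun d f.1 (d.proj x) = 0 at this
        rw [this, mul_zero]
      · rw [flagTerm, if_neg (fun h => hx (d.mem_parLie_iff.2 h)), mul_zero]
  rw [hsum]
  change _ = (-1 : ℂ) ^ (n - 1) * f.1 x
  obtain ⟨m, rfl⟩ := Nat.exists_eq_succ_of_ne_zero hn.ne'
  simp only [Nat.succ_eq_add_one, Nat.add_sub_cancel, pow_succ]
  ring

theorem isDualityFamily_dualOp : IsDualityFamily (dualOp k) where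
  zero := by
    refine LinearMap.ext fun f => Subtype.ext (funext fun x => ?_)
    have hx : x = 0 := Subsingleton.elim _ _
    rw [dualOp_apply, pow_zero, one_smul, hx, apply_zero_dual, ofInv_apply_same]
    rfl
  comm_hcInd := fun n₁ n₂ _ _ f₁ f₂ => dualOp_hcInd n₁ n₂ f₁ f₂
  preCuspidal := fun _ hn f hf => dualOp_preCuspidal hn f hf

end Family

/-! ### Frobenius reciprocity and uniqueness -/

section Uniqueness

variable [Fintype k]

open Classical in
/-- The characteristic function of the conjugacy class of `a`. -/
def classInd {A : Type u} [AddCommGroup A] [Module k A] (a : End k A) : ClassFun k :=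
  mkClass (fun _ _ _ _ x => if Conj x a then 1 else 0) (by
    intro W W' _ _ _ _ _ _ x x' h
    have : Conj x a ↔ Conj x' a := ⟨fun h' => h.symm.trans h', fun h' => h.trans h'⟩
    simp only [this])

variable {A B W : Type u} [AddCommGroup A] [Module k A] [AddCommGroup B] [Module k B]
  [AddCommGroup W] [Module k W] [Finite W]

open Classical in
theorem ev_classInd (a : End k A) (x : End k W) :
    ev (classInd a) x = if Conj x a then 1 else 0 := ev_mkClass _ _ _

theorem ofInv_classInd (a : End k A) (hn : finrank k A = n) :
    ofInv (classInd a n) = classInd a := by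
  classical
  funext m
  by_cases h : m = n
  · subst h; rw [ofInv_apply_same]
  · rw [ofInv_apply_ne _ h]
    apply Subtype.ext
    funext x
    rw [← ev_toLin', ev_classInd, if_neg]
    · rfl
    · rintro ⟨e, -⟩
      refine h ?_
      rw [← hn, ← e.finrank_eq, finrank_fin_fun]

open Classical in
theorem prodAt_classInd (a : End k A) (b : End k B) (x : End k W) (V : Submodule k W) :
    prodAt (classInd a) (classInd b) x V = if ∃ hV : V ≤ V.comap x,
      Conj (subE x ⟨V, hV⟩) a ∧ Conj (quotE x ⟨V, hV⟩) b then 1 else 0 := by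
  rw [prodAt]
  by_cases hV : V ≤ V.comap x
  · rw [dif_pos hV, ev_classInd, ev_classInd]
    by_cases h1 : Conj (subE x ⟨V, hV⟩) a
    · by_cases h2 : Conj (quotE x ⟨V, hV⟩) b
      · rw [if_pos h1, if_pos h2, if_pos ⟨hV, h1, h2⟩, one_mul]
      · rw [if_neg h2, mul_zero, if_neg]
        exact fun h => h2 h.2.2
    · rw [if_neg h1, zero_mul, if_neg]
      exact fun h => h1 h.2.1
  · rw [dif_neg hV, if_neg]
    rintro ⟨h, -⟩
    exact hV h

theorem prodAt_add_nil (f g : ClassFun k) (x : End k W) (V : Submodule k W)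
    (h : (W ⧸ V) →ₗ[k] V) :
    prodAt f g (x + V.subtype ∘ₗ h ∘ₗ V.mkQ) V = prodAt f g x V := by
  have h0 : ∀ v ∈ V, (x + V.subtype ∘ₗ h ∘ₗ V.mkQ) v = x v := by
    intro v hv
    have : V.mkQ v = 0 := by rw [← LinearMap.mem_ker, V.ker_mkQ]; exact hv
    rw [LinearMap.add_apply, LinearMap.comp_apply, LinearMap.comp_apply, this, map_zero, map_zero,
      add_zero]
  have hst : V ≤ V.comap (x + V.subtype ∘ₗ h ∘ₗ V.mkQ) ↔ V ≤ V.comap x := by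
    refine forall₂_congr fun v hv => ?_
    rw [Submodule.mem_comap, Submodule.mem_comap, h0 v hv]
  rw [prodAt, prodAt]
  by_cases hV : V ≤ V.comap x
  · rw [dif_pos hV, dif_pos (hst.2 hV)]
    congr 2
    · ext v
      exact h0 v v.2
    · apply LinearMap.ext
      intro q
      obtain ⟨w, rfl⟩ := V.mkQ_surjective q
      change V.mkQ (x w + (h (V.mkQ w) : W)) = V.mkQ (x w)
      rw [map_add, add_eq_left]
      exact (Submodule.Quotient.mk_eq_zero V).2 (h _).2
  · rw [dif_neg hV, dif_neg (fun h' => hV (hst.1 h'))]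

/-- A function orthogonal to a product of characteristic functions of classes has vanishing
restriction. -/
theorem ev_del_eq_zero_of_orthogonal [Finite A] [Finite B] (f : ClassFun k) (a : End k A)
    (b : End k B)
    (hW : ∃ (x : End k W) (V : Inv x), Conj (subE x V) a ∧ Conj (quotE x V) b)
    (h : ∑ x : End k W, ev (mul (classInd a) (classInd b)) x * ev f x = 0) :
    ev (del a f) b = 0 := by
  classical
  -- Frobenius reciprocity for one V: the weight `prodAt` is constant along x + Hom(W/V, V), so f
  -- may be replaced by its average there. Wherever the weight is non-zero, this average is the
  -- restriction of f at (a, b).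
  have h1 : ∀ V : Submodule k W,
      ∑ x : End k W, prodAt (classInd a) (classInd b) x V * ev f x
        = (∑ x : End k W, prodAt (classInd a) (classInd b) x V) * ev (del a f) b := by
    intro V
    have h2 : ∀ c : (W ⧸ V) →ₗ[k] V,
        ∑ x : End k W, prodAt (classInd a) (classInd b) x V * ev f x
        = ∑ x : End k W, prodAt (classInd a) (classInd b) x V
            * ev f (x + V.subtype ∘ₗ c ∘ₗ V.mkQ) := by
      intro c
      rw [← Equiv.sum_comp (Equiv.addRight (V.subtype ∘ₗ c ∘ₗ V.mkQ))]
      refine Finset.sum_congr rfl fun x _ => ?_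
      rw [Equiv.coe_addRight, prodAt_add_nil]
    rw [← Fintype.expect_const (ι := (W ⧸ V) →ₗ[k] V)
      (∑ x : End k W, prodAt (classInd a) (classInd b) x V * ev f x),
      Finset.expect_congr rfl (fun c _ => h2 c), Finset.expect_sum_comm, Finset.sum_mul]
    refine Finset.sum_congr rfl fun x _ => ?_
    rw [← Finset.mul_expect, prodAt_classInd]
    split_ifs with h3
    · obtain ⟨hV, ha, hb⟩ := h3
      have := ev_del_quotE f x ⟨V, hV⟩
      rw [← this, del_congr ha, ev_congr _ hb]
    · rw [zero_mul, zero_mul]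
  have h4 : (∑ V : Submodule k W, ∑ x : End k W, prodAt (classInd a) (classInd b) x V)
      * ev (del a f) b = 0 := by
    rw [Finset.sum_mul, ← Finset.sum_congr rfl (fun V _ => h1 V), Finset.sum_comm, ← h]
    refine Finset.sum_congr rfl fun x _ => ?_
    rw [ev_mul_eq_sum_prodAt, Finset.sum_mul]
  refine (mul_eq_zero.1 h4).resolve_left ?_
  -- The remaining factor counts pairs (V, x), and `hW` exhibits one.
  have h5 : (∑ V : Submodule k W, ∑ x : End k W, prodAt (classInd a) (classInd b) x V)
      = ((∑ V : Submodule k W, ∑ x : End k W, if ∃ hV : V ≤ V.comap x,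
      Conj (subE x ⟨V, hV⟩) a ∧ Conj (quotE x ⟨V, hV⟩) b then 1 else 0 : ℕ) : ℂ) := by
    push_cast
    exact Finset.sum_congr rfl fun V _ => Finset.sum_congr rfl fun x _ => prodAt_classInd a b x V
  rw [h5, Nat.cast_eq_zero]
  obtain ⟨x, V, ha, hb⟩ := hW
  intro h0
  rw [Finset.sum_eq_zero_iff] at h0
  have h6 := h0 V.1 (Finset.mem_univ _)
  rw [Finset.sum_eq_zero_iff] at h6
  have h7 := h6 x (Finset.mem_univ _)
  rw [if_pos ⟨V.2, ha, hb⟩] at h7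
  exact one_ne_zero h7

theorem subtype_comp_mkQ_mem_flagNil {C : Finset (Submodule k W)} (hC : IsFlag C)
    {V : Submodule k W} (hV : V ∈ C) (h : (W ⧸ V) →ₗ[k] V) :
    V.subtype ∘ₗ h ∘ₗ V.mkQ ∈ flagNil C := by
  intro A hA D hD w hw
  by_cases hAV : A ≤ V
  · have : V.mkQ w = 0 := by rw [← LinearMap.mem_ker, V.ker_mkQ]; exact hAV hw
    rw [Submodule.mem_comap, LinearMap.comp_apply, LinearMap.comp_apply, this, map_zero, map_zero]
    exact D.zero_mem
  · have hVA : V ≤ A := (hC.2.2.total hA hV).resolve_left hAV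
    exact hD V hV (lt_of_le_not_ge hVA hAV) (h _).2

/-- The nilpotent radical of C contains Hom(W/V, V) for each member V. Averaging along it first
gives the restriction for the single step V, which vanishes by hypothesis. Pre-cuspidality therefore
needs testing only on maximal parabolic subgroups. -/
theorem flagTerm_eq_zero (f : ClassFun k) {C : Finset (Submodule k W)} (hC : IsFlag C)
    {V : Submodule k W} (hV : V ∈ C)
    (h : ∀ (x : End k W) (hx : V ≤ V.comap x),
      ev (del (subE x ⟨V, hx⟩) f) (quotE x ⟨V, hx⟩) = 0) (x : End k W) :
    flagTerm (ev f) x C = 0 := by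
  unfold flagTerm
  split_ifs with hx
  swap
  · rfl
  have e : ∀ c : (W ⧸ V) →ₗ[k] V,
      Finset.expect Finset.univ (fun y : flagNil C => ev f (x + y.1 + V.subtype ∘ₗ c ∘ₗ V.mkQ))
      = Finset.expect Finset.univ (fun y : flagNil C => ev f (x + y.1)) := by
    intro c
    refine Eq.trans ?_ (expect_add_right (⟨_, subtype_comp_mkQ_mem_flagNil hC hV c⟩ : flagNil C)
      (fun y => ev f (x + y.1)))
    refine Finset.expect_congr rfl fun y _ => ?_
    rw [add_assoc]
    rfl
  rw [← Fintype.expect_const (ι := (W ⧸ V) →ₗ[k] V)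
    (Finset.expect Finset.univ (fun y : flagNil C => ev f (x + y.1))),
    ← Finset.expect_congr rfl (fun c _ => e c), Finset.expect_comm]
  refine Finset.expect_eq_zero fun y _ => ?_
  have hy : V ≤ V.comap (x + y.1) := by
    intro v hv
    refine V.add_mem (hx V hV hv) ?_
    exact y.2 V hV V (fun B _ hlt => hlt.le) hv
  rw [← h (x + y.1) hy, ev_del_quotE]

variable [DecidableEq k]

theorem isPreCuspidal_of_orthogonal (f : InvFun k n)
    (h : ∀ (n₁ n₂ : ℕ), 0 < n₁ → 0 < n₂ → n₁ + n₂ = n → ∀ (f₁ : InvFun k n₁) (f₂ : InvFun k n₂),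
      ∑ x, star ((mul (ofInv f₁) (ofInv f₂) n).1 x) * f.1 x = 0) :
    IsPreCuspidal f := by
  classical
  intro d hd
  apply Subtype.ext
  funext z
  change hcResFun d f.1 z = 0
  have hz := d.proj_of_mem z
  have hzp : (z : Matrix (Fin n) (Fin n) k) ∈ d.parLie := d.leviLie_le_parLie z.2
  rw [← hz, d.hcResFun_proj f hzp]
  obtain ⟨V, hVC, hV0, hV1⟩ : ∃ V ∈ d.flagOf, V ≠ ⊥ ∧ V ≠ ⊤ := by
    by_contra hcon
    push Not at hcon
    refine hd (eq_top_iff.2 fun g _ => d.par_le_iff_aux (d.mem_parLie_iff.2 fun A hA => ?_))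
    by_cases hA0 : A = ⊥
    · rw [hA0]; exact bot_le
    · rw [hcon A hA hA0]; simp
  refine flagTerm_eq_zero _ d.isFlag_flagOf hVC (fun x hx => ?_) _
  set a := subE x ⟨V, hx⟩
  set b := quotE x ⟨V, hx⟩
  refine ev_del_eq_zero_of_orthogonal (W := Fin n → k) _ a b
    ⟨x, ⟨V, hx⟩, Conj.refl _, Conj.refl _⟩ ?_
  have h1 : 0 < finrank k V := Submodule.one_le_finrank_iff.2 hV0
  have h2 : finrank k ((Fin n → k) ⧸ V) + finrank k V = n := by
    rw [Submodule.finrank_quotient_add_finrank, finrank_fin_fun]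
  have h3 : 0 < finrank k ((Fin n → k) ⧸ V) := by
    have := Submodule.finrank_lt hV1
    rw [finrank_fin_fun] at this
    omega
  have h4 := h _ _ h1 h3 ((add_comm _ _).trans h2) (classInd a _) (classInd b _)
  rw [ofInv_classInd a rfl, ofInv_classInd b rfl] at h4
  rw [← h4, ← Equiv.sum_comp (Matrix.toLin' (R := k) (m := Fin n) (n := Fin n)).toEquiv]
  refine Finset.sum_congr rfl fun y _ => ?_
  change ev _ (Matrix.toLin' y) * ev _ (Matrix.toLin' y) = _
  rw [ev_ofInv_toLin', ← ev_toLin']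
  congr 1
  -- Products of characteristic functions are real valued, so complex conjugation has no effect.
  rw [ev_mul_eq_sum_prodAt, star_sum]
  refine Finset.sum_congr rfl fun V' _ => ?_
  rw [prodAt_classInd]
  split_ifs <;> simp

/-- The span of the functions that are properly induced. -/
def inducedSpan (k : Type u) [Field k] [Fintype k] (n : ℕ) : Submodule ℂ (InvFun k n) :=
  Submodule.span ℂ {f | ∃ (n₁ n₂ : ℕ) (_ : 0 < n₁) (_ : 0 < n₂) (_ : n₁ + n₂ = n)
    (f₁ : InvFun k n₁) (f₂ : InvFun k n₂), f = mul (ofInv f₁) (ofInv f₂) n}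

/-- Every invariant function is the sum of a properly induced one and a pre-cuspidal one. -/
theorem exists_induced_add_preCuspidal (f : InvFun k n) :
    ∃ p ∈ inducedSpan k n, ∃ h : InvFun k n, IsPreCuspidal h ∧ f = p + h := by
  -- The orthogonal projection is taken for the standard Hermitian product on all functions on
  -- matrices.
  let ι : InvFun k n →ₗ[ℂ] EuclideanSpace ℂ (Matrix (Fin n) (Fin n) k) :=
    (WithLp.linearEquiv 2 ℂ (Matrix (Fin n) (Fin n) k → ℂ)).symm.toLinearMap ∘ₗ
      (InvFun k n).subtype
  obtain ⟨y, hy, z, hz, hyz⟩ := ((inducedSpan k n).map ι).exists_add_mem_mem_orthogonal (ι f)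
  obtain ⟨p, hp, rfl⟩ := hy
  refine ⟨p, hp, f - p, isPreCuspidal_of_orthogonal _ ?_, (add_sub_cancel p f).symm⟩
  intro n₁ n₂ h₁ h₂ hn f₁ f₂
  have hz' : z = ι (f - p) := by rw [map_sub, hyz, add_sub_cancel_left]
  have := (Submodule.mem_orthogonal _ z).1 hz (ι (mul (ofInv f₁) (ofInv f₂) n))
    (Submodule.mem_map_of_mem (Submodule.subset_span ⟨n₁, n₂, h₁, h₂, hn, f₁, f₂, rfl⟩))
  rw [hz', PiLp.inner_apply] at this
  rw [← this]
  refine Finset.sum_congr rfl fun x _ => ?_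
  rw [RCLike.inner_apply, mul_comm]
  rfl

/-- Strong induction on n: on properly induced functions the operators are given by those of smaller
degree, on pre-cuspidal ones by a sign, and both kinds together span. -/
theorem IsDualityFamily.unique {D D' : ∀ n : ℕ, InvFun k n →ₗ[ℂ] InvFun k n}
    (hD : IsDualityFamily D) (hD' : IsDualityFamily D') : D = D' := by
  funext n
  induction n using Nat.strong_induction_on with
  | _ n ih =>
  rcases Nat.eq_zero_or_pos n with rfl | hn
  · rw [hD.zero, hD'.zero]
  refine LinearMap.ext fun f => ?_
  obtain ⟨p, hp, h, hh, rfl⟩ := exists_induced_add_preCuspidal f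
  rw [map_add, map_add, hD.preCuspidal n hn h hh, hD'.preCuspidal n hn h hh]
  congr 1
  refine LinearMap.eqOn_span (f := D n) (g := D' n) ?_ hp
  rintro _ ⟨n₁, n₂, h₁, h₂, rfl, f₁, f₂, rfl⟩
  rw [← hcInd_boxProd, hD.comm_hcInd n₁ n₂ h₁ h₂, hD'.comm_hcInd n₁ n₂ h₁ h₂,
    ih n₁ (by omega), ih n₂ (by omega)]

theorem dualOp_eq_dualityOp {B : Subgroup (GL (Fin n) k)} (hB : IsBorel B)
    (lev : Subgroup (GL (Fin n) k) → ParabolicLevi k n)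
    (hlev : ∀ P : Subgroup (GL (Fin n) k), IsParabolic P → B ≤ P → (lev P).par = P) :
    dualOp k n = dualityOp B lev := by
  refine LinearMap.ext fun f => Subtype.ext (funext fun x => ?_)
  rw [dualOp_apply_apply, dualityOp_apply hB lev hlev]

end Uniqueness

end

end

end GLDuality

theorem mainTheorem3 (k : Type*) [Field k] [Fintype k] [DecidableEq k] :
    (∃! D : ∀ n : ℕ, GLDuality.InvFun k n →ₗ[ℂ] GLDuality.InvFun k n,
      GLDuality.IsDualityFamily D) ∧
    ∀ D : ∀ n : ℕ, GLDuality.InvFun k n →ₗ[ℂ] GLDuality.InvFun k n,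
      GLDuality.IsDualityFamily D →
      ∀ (n : ℕ) (B : Subgroup (GL (Fin n) k)), GLDuality.IsBorel B →
      ∀ lev : Subgroup (GL (Fin n) k) → GLDuality.ParabolicLevi k n,
        (∀ P : Subgroup (GL (Fin n) k), GLDuality.IsParabolic P → B ≤ P → (lev P).par = P) →
        D n = GLDuality.dualityOp B lev := by
  refine ⟨⟨GLDuality.dualOp k, GLDuality.isDualityFamily_dualOp,
    fun D hD => hD.unique GLDuality.isDualityFamily_dualOp⟩, ?_⟩
  intro D hD n B hB lev hlev
  rw [hD.unique GLDuality.isDualityFamily_dualOp]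
  exact GLDuality.dualOp_eq_dualityOp hB lev hlev
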